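/- Let $q\ge 1$, $N\ge 0$ be integers, $Z>0$ real, $V(x)=2/|x|$ on $\mathbb R^3$, and $\mathcal H=L^2(\mathbb R^3\times\{1,\dots,q\})$, where integrals $\int dx$ over $\mathbb R^3\times\{1,\dots,q\}$ include the sum over the spin variable and $|x-y|$ is the distance of the $\mathbb R^3$-components. Let $P$ be a density matrix, $P\in S_{N,q}$, that is, a trace class operator on $\mathcal H$ with $0\le P\le 1$ and $\operatorname{tr}P=N$. Write $P=\sum_n\lambda_n|\varphi_n\rangle\langle\varphi_n|$ with $(\varphi_n)$ orthonormal and put $$\rho_P(x)=\sum_n\lambda_n|\varphi_n(x)|^2,\qquad \tau_P(x,y)=\sum_n\lambda_n\varphi_n(x)\overline{\varphi_n(y)}.$$ Let $U_P=\rho_P*V$, $(K_P\psi)(x)=\int V(x-y)\,\tau_P(x,y)\,\psi(y)\,dy$, and let $$H_P=-\Delta-V+\frac1Z\,(U_P-K_P)$$ be the Fock operator, self-adjoint on the Sobolev space $H^2(\mathbb R^3\times\{1,\dots,q\})$. For $n\ge1$ let $E_n^\infty$ and $E_n^Z$ be the $n$-th eigenvalue, counted from below and with multiplicities, of $-\Delta-V$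 in $\mathcal H$ and of $H_P$, respectively; as usual, only eigenvalues below the essential spectrum are counted, and if there are fewer than $n$ of them, then the $n$-th eigenvalue is understood to be the bottom of the essential spectrum. **(a)** For all $n\ge 1$, $$E_n^\infty\le E_n^Z\le E_n^\infty+2\frac NZ+2\frac NZ\sqrt{E_n^\infty+1}.$$ **(b)** Suppose that $N\ge1$ and that $P$ minimizes the Hartree–Fock functional, that is, $P=\sum_{k=1}^N|\varphi_k\rangle\langle\varphi_k|$, where $(\varphi_1,\dots,\varphi_N)$ minimizes $$\mathcal E(\varphi_1,\dots,\varphi_N)=\sum_{k=1}^N\int\big(|\nabla\varphi_k(x)|^2-V(x)|\varphi_k(x)|^2\big)dx+\frac1{2Z}\iint\Big(\rho(x)\rho(y)-|\tau(x,y)|^2\Big)V(x-y)\,dx\,dy,$$ $$\rho(x)=\sum_{k=1}^N|\varphi_k(x)|^2,\qquad \tau(x,y)=\sum_{k=1}^N\varphi_k(x)\overline{\varphi_k(y)},$$ among all orthonormal $N$-tuples in $H^1(\mathbb R^3\times\{1,\dots,q\})$. Then $$E_N^Z\le E_N^\infty+2\frac{N-1}Z+2\frac{N-1}Z\sqrt{E_N^\infty+1}.$$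 -/

import Mathlib

open MeasureTheory Filter Topology
open scoped SchwartzMap LineDeriv Laplacian ENNReal ComplexConjugate

noncomputable section

namespace HartreeFock

/-! ### Eigenvalues of an unbounded operator, counted from below -/

section Abstract

variable {H : Type*} [NormedAddCommGroup H] [InnerProductSpace ℂ H]

/-- The span of all eigenvectors of `A` whose eigenvalue is at most `t`. Its dimension is the number
of eigenvalues of `A` in `(-∞, t]`, counted with multiplicities. -/
def lowEigenspace (A : H →ₗ.[ℂ] H) (t : ℝ) : Submodule ℂ H :=
  Submodule.span ℂ {ψ : H | ∃ μ : ℝ, μ ≤ t ∧ (ψ, (μ : ℂ) • ψ) ∈ A.graph}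

/-- The essential spectrum of a self-adjoint operator, by Weyl's criterion: `t` belongs to it iff
there is an orthonormal sequence `ψ k` in the domain with `(A - t) ψ k → 0`. -/
def essSpectrum (A : H →ₗ.[ℂ] H) : Set ℝ :=
  {t : ℝ | ∃ ψ : ℕ → A.domain, Orthonormal ℂ (fun k => (ψ k : H)) ∧
    Tendsto (fun k => A (ψ k) - (t : ℂ) • (ψ k : H)) atTop (𝓝 0)}

/-- The `n`-th eigenvalue (`n = 1, 2, …`) of a self-adjoint operator `A` that is bounded from below.
Eigenvalues are counted from below and with multiplicities. If `A` has at least `n` eigenvalues below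
its essential spectrum, this is the `n`-th of them; by the usual convention, it is the bottom of the
essential spectrum if `A` has fewer than `n` eigenvalues there. -/
def nthEigenvalue (A : H →ₗ.[ℂ] H) (n : ℕ) : ℝ :=
  sInf {t : ℝ | (n : Cardinal) ≤ Module.rank ℂ (lowEigenspace A t) ∨ t ∈ essSpectrum A}

end Abstract

/-! ### The Hilbert space `L²(ℝ³ × {1, …, q})` and its Sobolev spaces -/

/-- Physical space `ℝ³`. -/
abbrev Space : Type := EuclideanSpace ℝ (Fin 3)

/-- The Hilbert space `L²(ℝ³ × {1, …, q})` of one particle with `q` spin states. A function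
`ψ(x, s)` is written as the function `x ↦ (ψ(x, 1), …, ψ(x, q))` with values in `ℂ^q`; the norm
squared is `∑ₛ ∫ |ψ(x, s)|² dx`. -/
abbrev Hilb (q : ℕ) : Type := Lp (EuclideanSpace ℂ (Fin q)) 2 (volume : Measure Space)

variable {q : ℕ}

/-- The tempered distribution defined by an `L²` function. -/
abbrev toDistr (ψ : Hilb q) : 𝓢'(Space, EuclideanSpace ℂ (Fin q)) :=
  Lp.toTemperedDistribution ψ

theorem toDistr_injective : Function.Injective (toDistr (q := q)) :=
  LinearMap.ker_eq_bot.mp (Lp.ker_toTemperedDistributionCLM_eq_bot (F := EuclideanSpace ℂ (Fin q))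
    (μ := (volume : Measure Space)) (p := 2))

theorem toDistr_add (ψ χ : Hilb q) : toDistr (ψ + χ) = toDistr ψ + toDistr χ :=
  map_add (Lp.toTemperedDistributionCLM (EuclideanSpace ℂ (Fin q)) (volume : Measure Space) 2) ψ χ

theorem toDistr_smul (c : ℂ) (ψ : Hilb q) : toDistr (c • ψ) = c • toDistr ψ :=
  map_smul (Lp.toTemperedDistributionCLM (EuclideanSpace ℂ (Fin q)) (volume : Measure Space) 2) c ψ

/-- `ψ ∈ H^s`, for the `L²`-based Sobolev space of order `s`. -/
def IsSobolev (s : ℝ) (ψ : Hilb q) : Prop :=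
  TemperedDistribution.MemSobolev s 2 (toDistr ψ)

/-- The `L²` function that represents the tempered distribution `T` (`0` if there is none). -/
def toL2 (T : 𝓢'(Space, EuclideanSpace ℂ (Fin q))) : Hilb q :=
  open Classical in if h : ∃ f : Hilb q, toDistr f = T then h.choose else 0

theorem toL2_eq {T : 𝓢'(Space, EuclideanSpace ℂ (Fin q))} {f : Hilb q} (h : toDistr f = T) :
    toL2 T = f := by
  have hex : ∃ f : Hilb q, toDistr f = T := ⟨f, h⟩
  rw [toL2, dif_pos hex]
  exact toDistr_injective (hex.choose_spec.trans h.symm)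

theorem toDistr_toL2 {T : 𝓢'(Space, EuclideanSpace ℂ (Fin q))}
    (h : ∃ f : Hilb q, toDistr f = T) : toDistr (toL2 T) = T := by
  obtain ⟨f, hf⟩ := h
  rw [toL2_eq hf, hf]

theorem exists_laplacian {ψ : Hilb q} (h : IsSobolev 2 ψ) :
    ∃ f : Hilb q, toDistr f = Δ (toDistr ψ) := by
  have h2 := TemperedDistribution.MemSobolev.laplacian h
  rw [sub_self, TemperedDistribution.memSobolev_zero_iff] at h2
  obtain ⟨f, hf⟩ := h2
  exact ⟨f, hf.symm⟩

/-! ### The operators -/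

/-- The Sobolev space `H²`. -/
def sobolevTwo (q : ℕ) : Submodule ℂ (Hilb q) where
  carrier := {ψ | IsSobolev 2 ψ}
  zero_mem' := by
    have h := TemperedDistribution.memSobolev_fun_zero Space (EuclideanSpace ℂ (Fin q)) 2 2
    have h0 : toDistr (0 : Hilb q) = 0 :=
      map_zero (Lp.toTemperedDistributionCLM (EuclideanSpace ℂ (Fin q)) (volume : Measure Space) 2)
    change TemperedDistribution.MemSobolev 2 2 (toDistr (0 : Hilb q))
    rwa [h0]
  add_mem' := by
    intro ψ χ hψ hχ
    change TemperedDistribution.MemSobolev 2 2 (toDistr (ψ + χ))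
    rw [toDistr_add]
    exact TemperedDistribution.MemSobolev.add hψ hχ
  smul_mem' := by
    intro c ψ hψ
    change TemperedDistribution.MemSobolev 2 2 (toDistr (c • ψ))
    rw [toDistr_smul]
    exact TemperedDistribution.MemSobolev.smul c hψ

/-- The operator `-Δ` (distributional Laplacian) with domain `H²`. -/
def negLaplacian (q : ℕ) : Hilb q →ₗ.[ℂ] Hilb q where
  domain := sobolevTwo q
  toFun :=
    { toFun := fun ψ => -toL2 (Δ (toDistr (ψ : Hilb q)))
      map_add' := by
        intro ψ χ
        rw [← neg_add]
        congr 1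
        apply toL2_eq
        rw [toDistr_add, toDistr_toL2 (exists_laplacian ψ.2), toDistr_toL2 (exists_laplacian χ.2),
          Submodule.coe_add, toDistr_add]
        simp only [← TemperedDistribution.laplacianCLM_apply, map_add]
      map_smul' := by
        intro c ψ
        rw [RingHom.id_apply, smul_neg]
        congr 1
        apply toL2_eq
        rw [toDistr_smul, toDistr_toL2 (exists_laplacian ψ.2), Submodule.coe_smul, toDistr_smul]
        simp only [← TemperedDistribution.laplacianCLM_apply, map_smul] }

/-- The function `w ψ`. -/
def mulFun (w : Space → ℝ) (ψ : Hilb q) (x : Space) : EuclideanSpace ℂ (Fin q) :=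
  (w x : ℂ) • ψ x

theorem mulFun_zero (w : Space → ℝ) : mulFun w (0 : Hilb q) =ᵐ[volume] 0 := by
  filter_upwards [Lp.coeFn_zero (EuclideanSpace ℂ (Fin q)) 2 (volume : Measure Space)] with x hx
  rw [mulFun, hx, Pi.zero_apply, smul_zero]

theorem mulFun_add (w : Space → ℝ) (ψ χ : Hilb q) :
    mulFun w (ψ + χ) =ᵐ[volume] mulFun w ψ + mulFun w χ := by
  filter_upwards [Lp.coeFn_add ψ χ] with x hx
  rw [mulFun, hx, Pi.add_apply, Pi.add_apply, smul_add, mulFun, mulFun]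

theorem mulFun_smul (w : Space → ℝ) (c : ℂ) (ψ : Hilb q) :
    mulFun w (c • ψ) =ᵐ[volume] c • mulFun w ψ := by
  filter_upwards [Lp.coeFn_smul c ψ] with x hx
  rw [mulFun, hx, Pi.smul_apply, Pi.smul_apply, smul_comm, mulFun]

/-- The natural domain `{ψ ∈ L² | w ψ ∈ L²}` of the multiplication by `w`. -/
def mulDomain (q : ℕ) (w : Space → ℝ) : Submodule ℂ (Hilb q) where
  carrier := {ψ | MemLp (mulFun w ψ) 2 (volume : Measure Space)}
  zero_mem' := MemLp.zero.ae_eq (mulFun_zero w).symm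
  add_mem' := fun {ψ χ} hψ hχ => (MemLp.add hψ hχ).ae_eq (mulFun_add w ψ χ).symm
  smul_mem' := fun c ψ hψ => (MemLp.const_smul hψ c).ae_eq (mulFun_smul w c ψ).symm

theorem mem_mulDomain {w : Space → ℝ} {ψ : Hilb q} :
    ψ ∈ mulDomain q w ↔ MemLp (mulFun w ψ) 2 (volume : Measure Space) := Iff.rfl

theorem mulFun_toLp_add {w : Space → ℝ} {ψ χ : Hilb q} (hψ : MemLp (mulFun w ψ) 2 volume)
    (hχ : MemLp (mulFun w χ) 2 volume) (h : MemLp (mulFun w (ψ + χ)) 2 volume) :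
    h.toLp (mulFun w (ψ + χ)) = hψ.toLp (mulFun w ψ) + hχ.toLp (mulFun w χ) := by
  rw [← MemLp.toLp_add]
  exact MemLp.toLp_congr _ _ (mulFun_add w ψ χ)

theorem mulFun_toLp_smul {w : Space → ℝ} (c : ℂ) {ψ : Hilb q} (hψ : MemLp (mulFun w ψ) 2 volume)
    (h : MemLp (mulFun w (c • ψ)) 2 volume) :
    h.toLp (mulFun w (c • ψ)) = c • hψ.toLp (mulFun w ψ) := by
  rw [← MemLp.toLp_const_smul]
  exact MemLp.toLp_congr _ _ (mulFun_smul w c ψ)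

/-- The operator of multiplication by the real-valued function `w` on `ℝ³`, with its natural domain
`{ψ ∈ L² | w ψ ∈ L²}`. -/
def mulOp (q : ℕ) (w : Space → ℝ) : Hilb q →ₗ.[ℂ] Hilb q where
  domain := mulDomain q w
  toFun :=
    { toFun := fun ψ => MemLp.toLp (mulFun w (ψ : Hilb q)) (mem_mulDomain.1 ψ.2)
      map_add' := fun ψ χ => mulFun_toLp_add (mem_mulDomain.1 ψ.2) (mem_mulDomain.1 χ.2)
        (mem_mulDomain.1 (ψ + χ).2)
      map_smul' := fun c ψ => mulFun_toLp_smul c (mem_mulDomain.1 ψ.2)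
        (mem_mulDomain.1 (c • ψ).2) }

/-- The Coulomb function `V(x) = 2 / |x|`. -/
def coulomb (x : Space) : ℝ := 2 / ‖x‖

/-- A kernel on `ℝ³ × {1, …, q}`: the entry `τ x y s t` is `τ((x, s), (y, t))`. -/
abbrev SpinKernel (q : ℕ) : Type := Space → Space → Fin q → Fin q → ℂ

/-- `(K ψ)(x, s) = ∑ₜ ∫ V(x - y) τ((x, s), (y, t)) ψ(y, t) dy`. -/
def exchangeFun (τ : SpinKernel q) (ψ : Hilb q) (x : Space) : EuclideanSpace ℂ (Fin q) :=
  WithLp.toLp 2 fun s => ∫ y : Space, (coulomb (x - y) : ℂ) * ∑ t, τ x y s t * ψ y t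

/-- The integrals that define `K ψ` converge absolutely at almost every point. -/
def ExchangeConverges (τ : SpinKernel q) (ψ : Hilb q) : Prop :=
  ∀ᵐ x : Space, ∀ s, Integrable fun y : Space => (coulomb (x - y) : ℂ) * ∑ t, τ x y s t * ψ y t

theorem exchange_zero (τ : SpinKernel q) :
    ExchangeConverges τ 0 ∧ ∀ x, exchangeFun τ 0 x = 0 := by
  have key : ∀ x s, (fun y : Space => (coulomb (x - y) : ℂ) * ∑ t, τ x y s t * (0 : Hilb q) y t)
      =ᵐ[volume] fun _ => (0 : ℂ) := by
    intro x s
    filter_upwards [Lp.coeFn_zero (EuclideanSpace ℂ (Fin q)) 2 (volume : Measure Space)] with y hy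
    rw [hy]
    simp
  refine ⟨Eventually.of_forall fun x s => (integrable_zero _ _ _).congr (key x s).symm,
    fun x => ?_⟩
  ext s
  simp only [exchangeFun]
  rw [integral_congr_ae (key x s)]
  simp

theorem exchange_add (τ : SpinKernel q) {ψ χ : Hilb q} (hψ : ExchangeConverges τ ψ)
    (hχ : ExchangeConverges τ χ) : ExchangeConverges τ (ψ + χ) ∧
      exchangeFun τ (ψ + χ) =ᵐ[volume] exchangeFun τ ψ + exchangeFun τ χ := by
  have key : ∀ x s, (fun y : Space => (coulomb (x - y) : ℂ) * ∑ t, τ x y s t * (ψ + χ : Hilb q) y t)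
      =ᵐ[volume] fun y => (coulomb (x - y) : ℂ) * ∑ t, τ x y s t * ψ y t +
        (coulomb (x - y) : ℂ) * ∑ t, τ x y s t * χ y t := by
    intro x s
    filter_upwards [Lp.coeFn_add ψ χ] with y hy
    rw [hy]
    simp [mul_add, Finset.sum_add_distrib]
  constructor
  · filter_upwards [hψ, hχ] with x h1 h2 s
    exact ((h1 s).add (h2 s)).congr (key x s).symm
  · filter_upwards [hψ, hχ] with x h1 h2
    ext s
    simp only [exchangeFun, Pi.add_apply, PiLp.add_apply]
    rw [integral_congr_ae (key x s), integral_add (h1 s) (h2 s)]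

theorem exchange_smul (τ : SpinKernel q) (c : ℂ) {ψ : Hilb q} (hψ : ExchangeConverges τ ψ) :
    ExchangeConverges τ (c • ψ) ∧ exchangeFun τ (c • ψ) =ᵐ[volume] c • exchangeFun τ ψ := by
  have key : ∀ x s, (fun y : Space => (coulomb (x - y) : ℂ) * ∑ t, τ x y s t * (c • ψ : Hilb q) y t)
      =ᵐ[volume] fun y => c * ((coulomb (x - y) : ℂ) * ∑ t, τ x y s t * ψ y t) := by
    intro x s
    filter_upwards [Lp.coeFn_smul c ψ] with y hy
    simp only [hy, Pi.smul_apply, PiLp.smul_apply, smul_eq_mul, Finset.mul_sum]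
    exact Finset.sum_congr rfl fun t _ => by ring
  constructor
  · filter_upwards [hψ] with x h1 s
    exact ((h1 s).const_mul c).congr (key x s).symm
  · refine Eventually.of_forall fun x => ?_
    ext s
    simp only [exchangeFun, Pi.smul_apply, PiLp.smul_apply, smul_eq_mul]
    rw [integral_congr_ae (key x s), integral_const_mul]

/-- The natural domain of `K`: the integrals converge absolutely almost everywhere and define an
`L²` function. -/
def exchangeDomain (τ : SpinKernel q) : Submodule ℂ (Hilb q) where
  carrier := {ψ | ExchangeConverges τ ψ ∧ MemLp (exchangeFun τ ψ) 2 (volume : Measure Space)}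
  zero_mem' := by
    refine ⟨(exchange_zero τ).1, ?_⟩
    rw [funext (exchange_zero τ).2]
    exact MemLp.zero
  add_mem' := fun {ψ χ} hψ hχ => ⟨(exchange_add τ hψ.1 hχ.1).1,
    (MemLp.add hψ.2 hχ.2).ae_eq (exchange_add τ hψ.1 hχ.1).2.symm⟩
  smul_mem' := fun c ψ hψ => ⟨(exchange_smul τ c hψ.1).1,
    (MemLp.const_smul hψ.2 c).ae_eq (exchange_smul τ c hψ.1).2.symm⟩

theorem mem_exchangeDomain {τ : SpinKernel q} {ψ : Hilb q} : ψ ∈ exchangeDomain τ ↔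
    ExchangeConverges τ ψ ∧ MemLp (exchangeFun τ ψ) 2 (volume : Measure Space) := Iff.rfl

/-- The exchange operator `K` with kernel `V(x - y) τ(x, y)`, on its natural domain. -/
def exchangeOp (τ : SpinKernel q) : Hilb q →ₗ.[ℂ] Hilb q where
  domain := exchangeDomain τ
  toFun :=
    { toFun := fun ψ => MemLp.toLp (exchangeFun τ (ψ : Hilb q)) (mem_exchangeDomain.1 ψ.2).2
      map_add' := by
        intro ψ χ
        have hψ := mem_exchangeDomain.1 ψ.2
        have hχ := mem_exchangeDomain.1 χ.2
        exact (MemLp.toLp_congr _ (hψ.2.add hχ.2) (exchange_add τ hψ.1 hχ.1).2).trans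
          (MemLp.toLp_add hψ.2 hχ.2)
      map_smul' := by
        intro c ψ
        have hψ := mem_exchangeDomain.1 ψ.2
        exact (MemLp.toLp_congr _ (hψ.2.const_smul c) (exchange_smul τ c hψ.1).2).trans
          (MemLp.toLp_const_smul c hψ.2) }

/-! ### Density matrices, their densities and kernels -/

/-- `P ∈ S_{N,q}`: `0 ≤ P ≤ 1`, `P` is trace class and `tr P = N`. For a positive operator the last
two properties say that the sum of the diagonal matrix elements in an orthonormal basis is `N`. -/
structure IsDensityMatrix (N : ℕ) (P : Hilb q →L[ℂ] Hilb q) : Prop where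
  nonneg : P.IsPositive
  le_one : (1 - P).IsPositive
  trace : ∀ (ι : Type) (b : HilbertBasis ι ℂ (Hilb q)),
    HasSum (fun i => (inner ℂ (b i) (P (b i))).re) (N : ℝ)

/-- `P = ∑ₙ wₙ |φₙ⟩⟨φₙ|` with `wₙ` real and `φₙ` orthonormal. -/
def IsSpectralDecomposition (P : Hilb q →L[ℂ] Hilb q) (d : (ℕ → ℝ) × (ℕ → Hilb q)) : Prop :=
  Orthonormal ℂ d.2 ∧ ∀ ψ, HasSum (fun n => (d.1 n : ℂ) • (inner ℂ (d.2 n) ψ • d.2 n)) (P ψ)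

/-- A spectral decomposition of `P` (any one, if there is one: a density matrix has one, and the
density and the kernel below depend on the choice only on null sets). -/
def spectralData (P : Hilb q →L[ℂ] Hilb q) : (ℕ → ℝ) × (ℕ → Hilb q) :=
  Classical.epsilon (IsSpectralDecomposition P)

/-- The density `ρ(x) = ∑ₙ wₙ |φₙ(x)|²` of `P`, summed over the spin: `|φₙ(x)|² = ∑ₛ |φₙ(x, s)|²`. -/
def density (P : Hilb q →L[ℂ] Hilb q) (x : Space) : ℝ :=
  ∑' n, (spectralData P).1 n * ‖(spectralData P).2 n x‖ ^ 2

/-- The integral kernel `τ((x, s), (y, t)) = ∑ₙ wₙ φₙ(x, s) conj φₙ(y, t)` of `P`. -/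
def kernel (P : Hilb q →L[ℂ] Hilb q) : SpinKernel q := fun x y s t =>
  ∑' n, ((spectralData P).1 n : ℂ) *
    ((spectralData P).2 n x s * conj ((spectralData P).2 n y t))

/-- `U_P = ρ * V`; the sum over the spin is contained in `density`. -/
def directPotential (P : Hilb q →L[ℂ] Hilb q) (x : Space) : ℝ :=
  ∫ y : Space, density P y * coulomb (x - y)

/-- The Schrödinger operator `-Δ - V` in `L²(ℝ³ × {1, …, q})`. Its domain is `H²`, because
`V ψ ∈ L²` for all `ψ ∈ H²`. -/
def schrodingerOp (q : ℕ) : Hilb q →ₗ.[ℂ] Hilb q :=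
  negLaplacian q - mulOp q coulomb

/-- The Fock operator `H_P = -Δ - V + Z⁻¹ (U_P - K_P)`. The domain of this sum of operators is `H²`,
because `V ψ`, `U_P ψ` and `K_P ψ` are well defined and in `L²` for all `ψ ∈ H²` (Hardy). -/
def fockOp (Z : ℝ) (P : Hilb q →L[ℂ] Hilb q) : Hilb q →ₗ.[ℂ] Hilb q :=
  negLaplacian q - mulOp q coulomb +
    ((1 / Z : ℝ) : ℂ) • (mulOp q (directPotential P) - exchangeOp (kernel P))

/-! ### The Hartree–Fock functional -/

/-- `∫ |∇ψ|²`, for `ψ ∈ H¹`. -/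
def kineticEnergy (ψ : Hilb q) : ℝ :=
  ∑ i : Fin 3, ‖toL2 (∂_{EuclideanSpace.single i (1 : ℝ)} (toDistr ψ))‖ ^ 2

/-- The (rescaled) Hartree–Fock functional of the projection onto the span of orthonormal orbitals
`φ₁, …, φ_N ∈ H¹`:
`∑ₖ ∫ (|∇φₖ|² - V |φₖ|²) + (1 / 2Z) ∫∫ (ρ(x) ρ(y) - |τ(x, y)|²) V(x - y) dx dy`
with `ρ(x) = ∑ₖ |φₖ(x)|²` and `τ(x, y) = ∑ₖ φₖ(x) conj φₖ(y)`; the spin is summed over. -/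
def hfEnergy (Z : ℝ) {N : ℕ} (φ : Fin N → Hilb q) : ℝ :=
  ∑ k, (kineticEnergy (φ k) - ∫ x : Space, coulomb x * ‖φ k x‖ ^ 2) +
    1 / (2 * Z) * ∫ z : Space × Space,
      ((∑ k, ‖φ k z.1‖ ^ 2) * (∑ k, ‖φ k z.2‖ ^ 2) -
        ∑ s, ∑ t, ‖∑ k, φ k z.1 s * conj (φ k z.2 t)‖ ^ 2) * coulomb (z.1 - z.2)

/-- Orthonormal `N`-tuples of orbitals of finite kinetic energy. -/
def IsAdmissible {N : ℕ} (φ : Fin N → Hilb q) : Prop :=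
  Orthonormal ℂ φ ∧ ∀ k, IsSobolev 1 (φ k)

/-- `P` is the projection onto the span of the orbitals of a minimizer of the `N`-particle
Hartree–Fock functional. -/
def IsHFMinimizer (N : ℕ) (Z : ℝ) (P : Hilb q →L[ℂ] Hilb q) : Prop :=
  ∃ φ : Fin N → Hilb q, IsAdmissible φ ∧
    P = ∑ k, InnerProductSpace.rankOne ℂ (φ k) (φ k) ∧
    ∀ χ : Fin N → Hilb q, IsAdmissible χ → hfEnergy Z φ ≤ hfEnergy Z χ

end HartreeFock

end

/-!
The eigenvalues of both operators are controlled by the min-max principle on the form domain `H¹`: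
for a self-adjoint operator bounded below, a trial space of dimension `n` on which the quadratic form
is at most `s` gives `nthEigenvalue ≤ s` (`IsFormPerturbation.nthEigenvalue_le`), and conversely each
`s > nthEigenvalue` has such a trial space (`IsFormPerturbation.exists_trial`). Mathlib has no spectral
theorem for unbounded operators; the principle is derived from the resolvent `(A + c)⁻¹`, which is
bounded, by means of approximate eigenvectors of a positive bounded operator and Weyl's criterion.
The Schrödinger and the Fock operator qualify, as `-Δ + c` maps `H²` onto `L²` and as all potential
terms are bounded on `H¹` by a multiple of `‖∇ψ‖`, by Hardy's inequality.

For a density matrix with density `ρ` and kernel `τ`, let `U(ψ)` and `K(ψ)` be the direct and the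
exchange energy of `ψ`. Two inequalities carry the comparison:

* `K ≤ U` (`IsMeanField.exchangeForm_re_le`), by `|τ(x, y)|² ≤ ρ(x) ρ(y)`. Hence the Fock form is
  at least the Schrödinger form, which is the lower bound.
* `0 ≤ K` (`IsMeanField.exchangeForm_re_nonneg`), as `V` is a superposition of Gaussians and hence
  positive definite, and `U(ψ) ≤ 2 N ‖ψ‖ ‖∇ψ‖` (`IsMeanField.directForm_le`), by the Coulomb
  uncertainty principle `∫ V(x - y) |ψ(x)|² dx ≤ 2 ‖ψ‖ ‖∇ψ‖`. The latter for `y = 0` also shows that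
  `‖∇ψ‖ ≤ 1 + √(t + 1)` for a unit vector with Schrödinger energy at most `t`
  (`norm_grad_le`). Thus the Fock form is at most `t + 2 N / Z + 2 N / Z √(t + 1)` on a trial
  space of the Schrödinger operator for the level `t`.

For a minimizer of the Hartree-Fock functional, the trial space is the span of its `N` orbitals.
Given a unit vector `u` in that span, a unitary rotation of the orbitals, which changes neither the
density and kernel nor the energy, makes `u` the last one (`exists_rotation`). As an orbital does not
interact with itself, the Fock energy of `u` equals its energy in the mean field of the other `N - 1`
orbitals (`meanFieldEnergy_succ`), and the Hartree-Fock energy depends on `u` through that same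
quantity (`hfEnergy_succ`). By minimality it does not exceed the energy, in the field of the
`N - 1` orbitals, of any unit vector `ψ` orthogonal to them. An `N`-dimensional trial space of the
Schrödinger operator contains such a `ψ`, and the bound above applies to it with mass `N - 1`.
-/

namespace HartreeFock

/-! ### The variational principle for eigenvalues -/

section MinMax

variable {H : Type*} [NormedAddCommGroup H] [InnerProductSpace ℂ H]

local notation "⟪" x ", " y "⟫" => inner ℂ x y

/-- A positive bounded operator has its norm as an approximate eigenvalue. -/
theorem exists_approx_eigenvector {Q : H →L[ℂ] H} (hsymm : ∀ f g, ⟪Q f, g⟫ = ⟪f, Q g⟫)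
    (hpos : ∀ f, 0 ≤ (⟪f, Q f⟫).re) (hQ : Q ≠ 0) {ε : ℝ} (hε : 0 < ε) :
    ∃ φ : H, φ ≠ 0 ∧ ‖Q φ - (‖Q‖ : ℂ) • φ‖ ≤ ε * ‖φ‖ := by
  set r := ‖Q‖ with hr
  have hr0 : 0 < r := norm_pos_iff.mpr hQ
  have hs : 0 < √(r ^ 2 + ε ^ 2) := Real.sqrt_pos.mpr (by positivity)
  have hs2 : √(r ^ 2 + ε ^ 2) ^ 2 = r ^ 2 + ε ^ 2 := Real.sq_sqrt (by positivity)
  have hlt : r ^ 2 / √(r ^ 2 + ε ^ 2) < r := by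
    rw [div_lt_iff₀ hs, pow_two]
    gcongr
    exact Real.lt_sqrt_of_sq_lt (by nlinarith)
  obtain ⟨φ, hφ1, hφ⟩ := ContinuousLinearMap.exists_lt_apply_of_lt_opNorm Q hlt
  have hφ2 : r ^ 4 < (r ^ 2 + ε ^ 2) * ‖Q φ‖ ^ 2 := by
    rw [div_lt_iff₀ hs] at hφ
    calc r ^ 4 = (r ^ 2) ^ 2 := by ring
      _ < (‖Q φ‖ * √(r ^ 2 + ε ^ 2)) ^ 2 := by gcongr
      _ = _ := by rw [mul_pow, hs2]; ring
  have hle : ‖Q φ‖ ≤ r * ‖φ‖ := Q.le_opNorm φ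
  have hle2 : ‖Q (Q φ)‖ ≤ r * ‖Q φ‖ := Q.le_opNorm _
  refine ⟨φ, ?_, ?_⟩
  · rintro rfl
    simp at hφ2
    nlinarith [pow_pos hr0 4]
  set u := Q φ - (r : ℂ) • φ with hu
  -- `(Q + r)` is bounded below by `r`, and `(Q + r) (Q - r) φ = Q² φ - r² φ`
  have h1 : r ^ 2 * ‖u‖ ^ 2 ≤ ‖Q u + (r : ℂ) • u‖ ^ 2 := by
    rw [norm_add_sq (𝕜 := ℂ), norm_smul, Complex.norm_real, Real.norm_of_nonneg hr0.le,
      inner_smul_right, hsymm]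
    have := hpos u
    simp only [RCLike.re_to_complex, Complex.re_ofReal_mul]
    nlinarith [sq_nonneg ‖Q u‖, mul_nonneg hr0.le this]
  have h2 : Q u + (r : ℂ) • u = Q (Q φ) - ((r ^ 2 : ℝ) : ℂ) • φ := by
    rw [hu, map_sub, map_smul, smul_sub, smul_smul]
    push_cast
    rw [pow_two]
    abel
  have h3 : ‖Q (Q φ) - ((r ^ 2 : ℝ) : ℂ) • φ‖ ^ 2 =
      ‖Q (Q φ)‖ ^ 2 - 2 * r ^ 2 * ‖Q φ‖ ^ 2 + r ^ 4 * ‖φ‖ ^ 2 := by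
    rw [norm_sub_sq (𝕜 := ℂ), norm_smul, Complex.norm_real, Real.norm_of_nonneg (by positivity),
      inner_smul_right, hsymm]
    simp only [RCLike.re_to_complex, Complex.re_ofReal_mul]
    have : (⟪Q φ, Q φ⟫).re = ‖Q φ‖ ^ 2 := by
      rw [inner_self_eq_norm_sq_to_K]; norm_cast
    rw [this]
    ring
  rw [h2, h3] at h1
  have h4 : ‖Q (Q φ)‖ ^ 2 ≤ r ^ 2 * ‖Q φ‖ ^ 2 := by
    rw [← mul_pow]; gcongr
  have h5 : ‖Q φ‖ ^ 2 ≤ r ^ 2 * ‖φ‖ ^ 2 := by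
    rw [← mul_pow]; gcongr
  have h6 : ‖u‖ ^ 2 ≤ r ^ 2 * ‖φ‖ ^ 2 - ‖Q φ‖ ^ 2 := by
    have : r ^ 2 * ‖u‖ ^ 2 ≤ r ^ 2 * (r ^ 2 * ‖φ‖ ^ 2 - ‖Q φ‖ ^ 2) := by nlinarith
    exact le_of_mul_le_mul_left this (by positivity)
  have h7 : ‖φ‖ ^ 2 ≤ 1 := by
    have := norm_nonneg φ
    nlinarith
  have h8 : r ^ 2 * ‖u‖ ^ 2 ≤ r ^ 2 * (ε * ‖φ‖) ^ 2 := by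
    rw [mul_pow]
    nlinarith [pow_pos hr0 2, pow_pos hε 2, mul_le_mul_of_nonneg_left h5 (sq_nonneg ε),
      mul_le_mul_of_nonneg_left h6 (sq_nonneg r), mul_le_mul_of_nonneg_left h7 (pow_pos hr0 4).le]
  exact le_of_sq_le_sq (le_of_mul_le_mul_left h8 (by positivity)) (by positivity)

/-- `R = (A + c)⁻¹` for a self-adjoint operator `A` with `A + c ≥ 1`, characterized by bounded
operators only: the graph of `A` is `{(R f, f - c R f)}`, and `A + c ≥ 1` reads
`‖R f‖² ≤ ⟨f, R f⟩`. -/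
structure IsResolvent (A : H →ₗ.[ℂ] H) (c : ℝ) (R : H →L[ℂ] H) : Prop where
  symm : ∀ f g, ⟪R f, g⟫ = ⟪f, R g⟫
  sq_le : ∀ f, ‖R f‖ ^ 2 ≤ (⟪f, R f⟫).re
  mem_graph_iff : ∀ x y, (x, y) ∈ A.graph ↔ R (y + (c : ℂ) • x) = x

variable {A : H →ₗ.[ℂ] H} {c : ℝ} {R : H →L[ℂ] H}

theorem IsResolvent.mem_graph (h : IsResolvent A c R) (f : H) :
    (R f, f - (c : ℂ) • R f) ∈ A.graph := by
  rw [h.mem_graph_iff, sub_add_cancel]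

theorem IsResolvent.graph_symm (h : IsResolvent A c R) {x y x' y' : H} (hx : (x, y) ∈ A.graph)
    (hx' : (x', y') ∈ A.graph) : ⟪y, x'⟫ = ⟪x, y'⟫ := by
  rw [h.mem_graph_iff] at hx hx'
  have := h.symm (y + (c : ℂ) • x) (y' + (c : ℂ) • x')
  rw [hx, hx', inner_add_left, inner_add_right, inner_smul_left, inner_smul_right,
    Complex.conj_ofReal] at this
  exact (add_right_cancel this).symm

theorem IsResolvent.norm_sq_le (h : IsResolvent A c R) {x y : H} (hx : (x, y) ∈ A.graph) :
    (1 - c) * ‖x‖ ^ 2 ≤ (⟪x, y⟫).re := by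
  rw [h.mem_graph_iff] at hx
  have h1 := h.sq_le (y + (c : ℂ) • x)
  rw [hx, inner_add_left, inner_smul_left, Complex.conj_ofReal, Complex.add_re,
    Complex.re_ofReal_mul, ← inner_conj_symm y x, Complex.conj_re, inner_self_eq_norm_sq_to_K] at h1
  have h2 : (((‖x‖ : ℂ)) ^ 2).re = ‖x‖ ^ 2 := by norm_cast
  simp only [Complex.coe_algebraMap] at h1
  rw [h2] at h1
  linarith

theorem re_inner_self_eq (x : H) : (⟪x, x⟫).re = ‖x‖ ^ 2 := by
  rw [inner_self_eq_norm_sq_to_K]; norm_cast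

/-- If `m` is an approximate eigenvalue of `A` on the subspace `K`, but no eigenvalue there, then
approximate eigenvectors can be found orthogonal to any finite-dimensional subspace `F` of the
domain: otherwise the components along `F` converge along a subsequence, and the limit of the
approximate eigenvectors is an eigenvector. -/
theorem IsResolvent.exists_approx_orthogonal (h : IsResolvent A c R) {K : Submodule ℂ H}
    (hK : IsClosed (K : Set H)) {m : ℝ}
    (happrox : ∀ ε > 0, ∃ x y : H, (x, y) ∈ A.graph ∧ x ∈ K ∧ ‖x‖ = 1 ∧ ‖y - (m : ℂ) • x‖ < ε)
    (hno : ∀ x ∈ K, (x, (m : ℂ) • x) ∈ A.graph → x = 0)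
    (F : Submodule ℂ H) [FiniteDimensional ℂ F] (hFK : F ≤ K) (hFA : F ≤ A.domain)
    [CompleteSpace H] {ε : ℝ} (hε : 0 < ε) :
    ∃ x y : H, (x, y) ∈ A.graph ∧ x ∈ K ∧ x ∈ Fᗮ ∧ ‖x‖ = 1 ∧ ‖y - (m : ℂ) • x‖ < ε := by
  by_contra hcon
  push Not at hcon
  have hbelow : ∀ x y : H, (x, y) ∈ A.graph → x ∈ K → x ∈ Fᗮ → ε * ‖x‖ ≤ ‖y - (m : ℂ) • x‖ := by
    intro x y hxy hxK hxF
    by_cases hx : x = 0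
    · simp [hx]
    have hx' : 0 < ‖x‖ := norm_pos_iff.mpr hx
    have := hcon (((‖x‖⁻¹ : ℝ) : ℂ) • x) (((‖x‖⁻¹ : ℝ) : ℂ) • y)
      (A.graph.smul_mem _ hxy) (K.smul_mem _ hxK) (Fᗮ.smul_mem _ hxF)
      (by rw [norm_smul, Complex.norm_real, norm_inv, norm_norm, inv_mul_cancel₀ hx'.ne'])
    rw [smul_comm, ← smul_sub, norm_smul, Complex.norm_real, norm_inv, norm_norm] at this
    rwa [← div_eq_inv_mul, le_div_iff₀ hx'] at this
  choose x y hxy hxK hx1 hlim using fun k : ℕ => happrox (1 / (k + 1)) (by positivity)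
  have hη : Tendsto (fun k => y k - (m : ℂ) • x k) atTop (𝓝 0) :=
    squeeze_zero_norm (fun k => (hlim k).le) tendsto_one_div_add_atTop_nhds_zero_nat
  let T : F →ₗ[ℂ] H := A.toFun ∘ₗ Submodule.inclusion hFA - (m : ℂ) • F.subtype
  have hT : ∀ f : F, ((f : H), T f + (m : ℂ) • (f : H)) ∈ A.graph := by
    intro f
    have := A.mem_graph (Submodule.inclusion hFA f)
    simpa [T] using this
  have hTc : Continuous T := T.continuous_of_finiteDimensional
  have : ProperSpace F := FiniteDimensional.proper ℂ F
  have hbdd : ∀ k, F.orthogonalProjectionOnto (x k) ∈ Metric.closedBall (0 : F) 1 := by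
    intro k
    rw [mem_closedBall_zero_iff]
    exact (F.norm_orthogonalProjectionOnto_apply_le _).trans (hx1 k).le
  obtain ⟨f, -, σ, hσ, hf⟩ := tendsto_subseq_of_bounded Metric.isBounded_closedBall hbdd
  set f' : ℕ → F := fun k => F.orthogonalProjectionOnto (x (σ k)) with hf'
  set z : ℕ → H := fun k => x (σ k) - f' k with hz
  have hzg : ∀ k, (z k, y (σ k) - (T (f' k) + (m : ℂ) • (f' k : H))) ∈ A.graph := fun k =>
    A.graph.sub_mem (hxy (σ k)) (hT (f' k))
  have hzK : ∀ k, z k ∈ K := fun k => K.sub_mem (hxK _) (hFK (f' k).2)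
  have hzF : ∀ k, z k ∈ Fᗮ := fun k => F.sub_starProjection_mem_orthogonal (x (σ k))
  have hw : Tendsto (fun k => (y (σ k) - (m : ℂ) • x (σ k)) - T (f' k)) atTop (𝓝 (0 - T f)) :=
    (hη.comp hσ.tendsto_atTop).sub ((hTc.tendsto f).comp hf)
  have hzc : CauchySeq z := by
    rw [Metric.cauchySeq_iff']
    intro δ hδ
    obtain ⟨n, hn⟩ := Metric.cauchySeq_iff'.1 hw.cauchySeq (ε * δ) (by positivity)
    refine ⟨n, fun k hk => ?_⟩
    have h1 := hbelow _ _ (A.graph.sub_mem (hzg k) (hzg n)) (K.sub_mem (hzK k) (hzK n))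
      (Fᗮ.sub_mem (hzF k) (hzF n))
    have h2 := hn k hk
    rw [dist_eq_norm] at h2 ⊢
    have h3 : y (σ k) - (T (f' k) + (m : ℂ) • (f' k : H)) - (y (σ n) - (T (f' n) + (m : ℂ) • (f' n : H)))
        - (m : ℂ) • (z k - z n) = (y (σ k) - (m : ℂ) • x (σ k)) - T (f' k) -
          ((y (σ n) - (m : ℂ) • x (σ n)) - T (f' n)) := by
      simp only [hz, smul_sub]
      abel
    rw [h3] at h1
    exact lt_of_mul_lt_mul_left (h1.trans_lt h2) hε.le
  obtain ⟨z0, hz0⟩ := cauchySeq_tendsto_of_complete hzc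
  have hxlim : Tendsto (fun k => x (σ k)) atTop (𝓝 (z0 + f)) := by
    have : Tendsto (fun k => z k + (f' k : H)) atTop (𝓝 (z0 + f)) :=
      hz0.add ((continuous_subtype_val.tendsto f).comp hf)
    refine this.congr fun k => ?_
    simp [hz]
  set x0 := z0 + (f : H)
  have hx01 : ‖x0‖ = 1 := by
    refine tendsto_nhds_unique hxlim.norm ?_
    simp [hx1]
  have hx0K : x0 ∈ K := hK.mem_of_tendsto hxlim (Eventually.of_forall fun k => hxK _)
  have hylim : Tendsto (fun k => y (σ k)) atTop (𝓝 ((m : ℂ) • x0)) := by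
    have := (hη.comp hσ.tendsto_atTop).add (hxlim.const_smul (m : ℂ))
    rw [zero_add] at this
    refine this.congr fun k => ?_
    simp
  have hx0g : (x0, (m : ℂ) • x0) ∈ A.graph := by
    rw [h.mem_graph_iff]
    refine tendsto_nhds_unique ?_ hxlim
    have := (R.continuous.tendsto _).comp (hylim.add (hxlim.const_smul (c : ℂ)))
    refine this.congr fun k => ?_
    exact (h.mem_graph_iff _ _).1 (hxy (σ k))
  have := hno x0 hx0K hx0g
  rw [this, norm_zero] at hx01
  exact zero_ne_one hx01

/-- Weyl's criterion: an approximate eigenvalue on a closed subspace which is not an eigenvalue there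
belongs to the essential spectrum. -/
theorem IsResolvent.mem_essSpectrum [CompleteSpace H] (h : IsResolvent A c R) {K : Submodule ℂ H}
    (hK : IsClosed (K : Set H)) {m : ℝ}
    (happrox : ∀ ε > 0, ∃ x y : H, (x, y) ∈ A.graph ∧ x ∈ K ∧ ‖x‖ = 1 ∧ ‖y - (m : ℂ) • x‖ < ε)
    (hno : ∀ x ∈ K, (x, (m : ℂ) • x) ∈ A.graph → x = 0) : m ∈ essSpectrum A := by
  -- the first component keeps track of the position in the sequence
  let p : ℕ × A.domain → Prop := fun a => (a.2 : H) ∈ K ∧ ‖(a.2 : H)‖ = 1 ∧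
    ‖A a.2 - (m : ℂ) • (a.2 : H)‖ < 1 / (a.1 + 1)
  let r : ℕ × A.domain → ℕ × A.domain → Prop := fun a b => a.1 < b.1 ∧ ⟪(a.2 : H), (b.2 : H)⟫ = 0
  obtain ⟨g, hg, hgr⟩ := exists_seq_of_forall_finset_exists p r (by
    intro s hs
    let F : Submodule ℂ H := Submodule.span ℂ ((fun a : ℕ × A.domain => (a.2 : H)) '' (s : Set _))
    have : FiniteDimensional ℂ F :=
      FiniteDimensional.span_of_finite ℂ (s.finite_toSet.image _)
    have hFK : F ≤ K := Submodule.span_le.2 (by rintro _ ⟨a, ha, rfl⟩; exact (hs a ha).1)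
    have hFA : F ≤ A.domain := Submodule.span_le.2 (by rintro _ ⟨a, ha, rfl⟩; exact a.2.2)
    let k := s.sup Prod.fst + 1
    obtain ⟨x, y, hxy, hxK, hxF, hx1, hlt⟩ := h.exists_approx_orthogonal hK happrox hno F hFK hFA
      (ε := 1 / (k + 1)) (by positivity)
    obtain ⟨x', rfl, rfl⟩ := LinearPMap.mem_graph_iff A |>.1 hxy
    refine ⟨(k, x'), ⟨hxK, hx1, hlt⟩, fun a ha => ⟨?_, ?_⟩⟩
    · exact Nat.lt_succ_of_le (Finset.le_sup (f := Prod.fst) ha)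
    · exact hxF _ (Submodule.subset_span ⟨a, ha, rfl⟩))
  refine ⟨fun k => (g k).2, ⟨fun k => (hg k).2.1, ?_⟩, ?_⟩
  · intro i j hij
    rcases lt_or_gt_of_ne hij with hlt | hlt
    · exact (hgr i j hlt).2
    · rw [← inner_conj_symm, (hgr j i hlt).2, map_zero]
  · have hmono : StrictMono fun k => (g k).1 := strictMono_nat_of_lt_succ fun k =>
      (hgr k (k + 1) k.lt_succ_self).1
    refine squeeze_zero_norm (fun k => ?_) tendsto_one_div_add_atTop_nhds_zero_nat
    refine (hg k).2.2.le.trans ?_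
    have : (k : ℝ) ≤ (g k).1 := by exact_mod_cast hmono.le_apply
    gcongr

theorem exists_ne_zero_mem_orthogonal (M F : Submodule ℂ H) [FiniteDimensional ℂ M]
    [FiniteDimensional ℂ F] (h : Module.finrank ℂ F < Module.finrank ℂ M) :
    ∃ x ∈ M, x ∈ Fᗮ ∧ x ≠ 0 := by
  let f : M →ₗ[ℂ] F := (F.orthogonalProjectionOnto : H →ₗ[ℂ] F) ∘ₗ M.subtype
  have hf := f.ker_ne_bot_of_finrank_lt h
  obtain ⟨x, hx, hx0⟩ := (Submodule.ne_bot_iff _).1 hf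
  refine ⟨x, x.2, ?_, fun h0 => hx0 (Subtype.ext h0)⟩
  rw [LinearMap.mem_ker] at hx
  exact F.orthogonalProjectionOnto_eq_zero_iff.1 hx

theorem sum_mem_graph {ι : Type*} {s : Finset ι} {x y : ι → H}
    (h : ∀ i ∈ s, (x i, y i) ∈ A.graph) : (∑ i ∈ s, x i, ∑ i ∈ s, y i) ∈ A.graph := by
  have := A.graph.sum_mem h
  rwa [show (∑ i ∈ s, (x i, y i)) = (∑ i ∈ s, x i, ∑ i ∈ s, y i) from
    Prod.ext (by simp [Prod.fst_sum]) (by simp [Prod.snd_sum])] at this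

theorem mem_lowEigenspace {t μ : ℝ} {x : H} (hμ : μ ≤ t) (hx : (x, (μ : ℂ) • x) ∈ A.graph) :
    x ∈ lowEigenspace A t :=
  Submodule.subset_span ⟨μ, hμ, hx⟩

theorem IsResolvent.map_lowEigenspace_orthogonal (h : IsResolvent A c R) (t : ℝ) {g : H}
    (hg : g ∈ (lowEigenspace A t)ᗮ) : R g ∈ (lowEigenspace A t)ᗮ := by
  suffices hle : lowEigenspace A t ≤ (Submodule.span ℂ {R g})ᗮ by
    intro x hx
    rw [← inner_conj_symm, hle hx _ (Submodule.mem_span_singleton_self _), map_zero]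
  refine Submodule.span_le.2 ?_
  rintro e ⟨μ, hμ, he⟩
  rw [SetLike.mem_coe, Submodule.mem_orthogonal_singleton_iff_inner_right]
  have h0 : ⟪g, e⟫ = 0 := by
    rw [← inner_conj_symm, hg e (mem_lowEigenspace hμ he), map_zero]
  have h1 : ((μ + c : ℝ) : ℂ) • R e = e := by
    have := (h.mem_graph_iff _ _).1 he
    rw [← add_smul, map_smul] at this
    exact_mod_cast this
  by_cases hμc : μ + c = 0
  · rw [hμc] at h1
    rw [← h1]
    simp
  · have h2 : ((μ + c : ℝ) : ℂ) * ⟪R g, e⟫ = 0 := by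
      rw [h.symm, ← inner_smul_right, h1, h0]
    exact (mul_eq_zero.1 h2).resolve_left (by exact_mod_cast hμc)

/-- A trial space of dimension `n` on which the quadratic form is at most `s` forces `n` eigenvalues
or a point of the essential spectrum in `(-∞, s]`. On the orthogonal complement of the eigenvectors
with eigenvalue `≤ s`, the bounded operator `R = (A + c)⁻¹` has norm `r ≥ 1 / (s + c)`, so that
`1 / r - c ≤ s` is an approximate eigenvalue of `A` there. -/
theorem IsResolvent.exists_le_of_trial [CompleteSpace H] (h : IsResolvent A c R) {n : ℕ} {s : ℝ}
    (M : Submodule ℂ H) [FiniteDimensional ℂ M] (hM : Module.finrank ℂ M = n)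
    (hs : ∀ x ∈ M, ∃ y, (x, y) ∈ A.graph ∧ (⟪x, y⟫).re ≤ s * ‖x‖ ^ 2) :
    ∃ t ≤ s, (n : Cardinal) ≤ Module.rank ℂ (lowEigenspace A t) ∨ t ∈ essSpectrum A := by
  by_contra hcon
  push Not at hcon
  set L := lowEigenspace A s with hL
  have hrank := (hcon s le_rfl).1
  have hLfin : FiniteDimensional ℂ L :=
    Module.rank_lt_aleph0_iff.1 (hrank.trans (Cardinal.natCast_lt_aleph0))
  have hfr : Module.finrank ℂ L < Module.finrank ℂ M := by
    rw [hM]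
    rw [← Module.finrank_eq_rank] at hrank
    exact_mod_cast hrank
  obtain ⟨x, hxM, hxL, hx0⟩ := exists_ne_zero_mem_orthogonal M L hfr
  obtain ⟨y, hxy, hle⟩ := hs x hxM
  set K := Lᗮ with hK
  let Q : K →L[ℂ] K := (R.comp K.subtypeL).codRestrict K fun g =>
    h.map_lowEigenspace_orthogonal s g.2
  have hQ : ∀ g : K, ((Q g : K) : H) = R g := fun g => rfl
  have hn0 : 0 < ‖x‖ ^ 2 := by positivity
  set w := y + (c : ℂ) • x with hw
  have hRw : R w = x := (h.mem_graph_iff _ _).1 hxy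
  have hxQ : R x = (Q ⟨x, hxL⟩ : K) := rfl
  have hwx : ⟪w, R x⟫ = ⟪x, x⟫ := by rw [← h.symm, hRw]
  have hQ0 : Q ≠ 0 := by
    intro h0
    rw [hxQ, h0] at hwx
    rw [show (0 : K →L[ℂ] K) ⟨x, hxL⟩ = 0 from rfl, ZeroMemClass.coe_zero, inner_zero_right] at hwx
    exact hx0 (inner_self_eq_zero.1 hwx.symm)
  set r := ‖Q‖ with hr
  have hr0 : 0 < r := (norm_pos_iff (a := Q)).2 hQ0
  have hb : (⟪x, R x⟫).re ≤ r * ‖x‖ ^ 2 := by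
    refine (Complex.re_le_norm _).trans ((norm_inner_le_norm _ _).trans ?_)
    have := Q.le_opNorm ⟨x, hxL⟩
    have h2 : ‖R x‖ ≤ r * ‖x‖ := this
    nlinarith [norm_nonneg x]
  have ha : (⟪w, x⟫).re ≤ (s + c) * ‖x‖ ^ 2 := by
    rw [hw, inner_add_left, inner_smul_left, Complex.conj_ofReal, Complex.add_re,
      Complex.re_ofReal_mul, re_inner_self_eq, ← inner_conj_symm, Complex.conj_re]
    linarith
  have hrs : 1 / r - c ≤ s := by
    -- positivity of `R` on the vector `w - x / r`
    have hpos : 0 ≤ (⟪w - ((1 / r : ℝ) : ℂ) • x, R (w - ((1 / r : ℝ) : ℂ) • x)⟫).re :=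
      (sq_nonneg _).trans (h.sq_le _)
    rw [map_sub, map_smul, hRw, inner_sub_left, inner_sub_right, inner_sub_right,
      inner_smul_left, inner_smul_left, inner_smul_right, inner_smul_right, Complex.conj_ofReal,
      hwx] at hpos
    simp only [Complex.sub_re, Complex.re_ofReal_mul, re_inner_self_eq] at hpos
    have h3 : 1 / r * (1 / r * (⟪x, R x⟫).re) ≤ 1 / r * ‖x‖ ^ 2 := by
      have : 1 / r * (⟪x, R x⟫).re ≤ ‖x‖ ^ 2 := by
        rw [one_div, inv_mul_le_iff₀ hr0]; exact hb
      gcongr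
    have h4 : (1 / r) * ‖x‖ ^ 2 ≤ (s + c) * ‖x‖ ^ 2 := by linarith
    linarith [le_of_mul_le_mul_right h4 hn0]
  refine (hcon _ hrs).2 (h.mem_essSpectrum (K := K) (L.isClosed_orthogonal) ?_ ?_)
  · intro ε hε
    set δ := min (r / 2) (ε * r ^ 2 / 4) with hδ
    have hδ0 : 0 < δ := by positivity
    obtain ⟨φ, hφ0, hφ⟩ := exists_approx_eigenvector (Q := Q) (fun f g => h.symm f g)
      (fun f => (sq_nonneg _).trans (h.sq_le (f : H))) hQ0 hδ0
    have hφ' : ‖R φ - (r : ℂ) • (φ : H)‖ ≤ δ * ‖(φ : H)‖ := hφ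
    have hφn : 0 < ‖(φ : H)‖ := norm_pos_iff.2 (by simpa using hφ0)
    have hlow : r / 2 * ‖(φ : H)‖ ≤ ‖R φ‖ := by
      have h1 : ‖(r : ℂ) • (φ : H)‖ ≤ ‖R φ‖ + ‖R φ - (r : ℂ) • (φ : H)‖ := by
        rw [norm_sub_rev]
        exact norm_le_norm_add_norm_sub' _ _
      rw [norm_smul, Complex.norm_real, Real.norm_of_nonneg hr0.le] at h1
      nlinarith [min_le_left (r / 2) (ε * r ^ 2 / 4)]
    have hRφ : 0 < ‖R φ‖ := lt_of_lt_of_le (by positivity) hlow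
    set a : ℂ := ((‖R φ‖⁻¹ : ℝ) : ℂ) with ha
    have han : ‖a‖ = ‖R φ‖⁻¹ := by rw [ha, Complex.norm_real, norm_inv, norm_norm]
    refine ⟨a • R φ, a • (φ - (c : ℂ) • R φ), A.graph.smul_mem _ (h.mem_graph φ),
      K.smul_mem _ (h.map_lowEigenspace_orthogonal s φ.2), ?_, ?_⟩
    · rw [norm_smul, han, inv_mul_cancel₀ hRφ.ne']
    · have heq : a • ((φ : H) - (c : ℂ) • R φ) - ((1 / r - c : ℝ) : ℂ) • a • R φ =
          (-(a * ((1 / r : ℝ) : ℂ))) • (R φ - (r : ℂ) • (φ : H)) := by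
        have hrc : (r : ℂ) ≠ 0 := by exact_mod_cast hr0.ne'
        simp only [smul_sub, smul_smul, neg_smul]
        push_cast
        rw [sub_mul, sub_smul]
        have e1 : -(a * (1 / (r : ℂ))) * r = -a := by field_simp
        rw [e1, mul_comm (1 / (r : ℂ)) a, mul_comm (c : ℂ) a, neg_smul]
        abel
      rw [heq, norm_smul, norm_neg, norm_mul, han, Complex.norm_real,
        Real.norm_of_nonneg (by positivity)]
      calc ‖R φ‖⁻¹ * (1 / r) * ‖R φ - (r : ℂ) • (φ : H)‖
          ≤ (r / 2 * ‖(φ : H)‖)⁻¹ * (1 / r) * (ε * r ^ 2 / 4 * ‖(φ : H)‖) := by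
            gcongr
            exact hφ'.trans (by gcongr; exact min_le_right _ _)
        _ = ε / 2 := by field_simp; norm_num
        _ < ε := by linarith
  · intro z hzK hz
    have hzL : z ∈ L := mem_lowEigenspace hrs hz
    have := hzK z hzL
    exact inner_self_eq_zero.1 this

/-- Eigenvectors for different eigenvalues are orthogonal, so the quadratic form is at most `t` on the
whole span of the eigenvectors with eigenvalue at most `t`. -/
theorem IsResolvent.re_inner_le_of_mem_lowEigenspace (h : IsResolvent A c R) {t : ℝ} {x : H}
    (hx : x ∈ lowEigenspace A t) : ∃ y, (x, y) ∈ A.graph ∧ (⟪x, y⟫).re ≤ t * ‖x‖ ^ 2 := by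
  let E : Set.Iic t → Submodule ℂ H := fun μ =>
    { carrier := {x | (x, ((μ : ℝ) : ℂ) • x) ∈ A.graph}
      zero_mem' := by
        rw [Set.mem_ofPred_eq, smul_zero]
        exact A.graph.zero_mem
      add_mem' := fun {x y} hx hy => by
        have := A.graph.add_mem hx hy
        simpa using this
      smul_mem' := fun a x hx => by
        have := A.graph.smul_mem a hx
        simpa [smul_comm a] using this }
  have hle : lowEigenspace A t ≤ ⨆ μ, E μ := by
    refine Submodule.span_le.2 ?_
    rintro x ⟨μ, hμ, hx⟩
    exact Submodule.mem_iSup_of_mem (⟨μ, hμ⟩ : Set.Iic t) hx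
  obtain ⟨f, hf, hfx⟩ := (Submodule.mem_iSup_iff_exists_finsupp _ _).1 (hle hx)
  have horth : ∀ μ ν : Set.Iic t, μ ≠ ν → ⟪f μ, f ν⟫ = 0 := by
    intro μ ν hμν
    have := h.graph_symm (hf μ) (hf ν)
    rw [inner_smul_left, inner_smul_right, Complex.conj_ofReal, ← sub_eq_zero, ← sub_mul] at this
    refine (mul_eq_zero.1 this).resolve_left ?_
    intro h'
    rw [sub_eq_zero] at h'
    exact hμν (Subtype.ext (by exact_mod_cast h'))
  have hxs : x = ∑ μ ∈ f.support, f μ := hfx.symm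
  refine ⟨∑ μ ∈ f.support, ((μ : ℝ) : ℂ) • f μ, ?_, ?_⟩
  · nth_rewrite 1 [hxs]
    exact sum_mem_graph fun μ _ => hf μ
  · have key : ∀ a : Set.Iic t → ℝ, (⟪x, ∑ μ ∈ f.support, ((a μ : ℝ) : ℂ) • f μ⟫).re =
        ∑ μ ∈ f.support, a μ * ‖f μ‖ ^ 2 := by
      intro a
      rw [inner_sum, Complex.re_sum]
      refine Finset.sum_congr rfl fun μ hμ => ?_
      rw [inner_smul_right, Complex.re_ofReal_mul, hxs, sum_inner,
        Finset.sum_eq_single μ (fun ν _ hν => horth ν μ hν) (fun h' => absurd hμ h'),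
        re_inner_self_eq]
    rw [key fun μ => (μ : ℝ)]
    have h2 := key fun _ => 1
    simp only [Complex.ofReal_one, one_smul, one_mul, ← hxs] at h2
    rw [re_inner_self_eq] at h2
    rw [h2, Finset.mul_sum]
    gcongr with μ _
    exact μ.2

/-- The span of `n` late members of a Weyl sequence for `t` is a trial space for each level `s > t`. -/
theorem IsResolvent.exists_trial_of_mem_essSpectrum {t : ℝ} (ht : t ∈ essSpectrum A)
    {s : ℝ} (hts : t < s) (n : ℕ) : ∃ M : Submodule ℂ H, FiniteDimensional ℂ M ∧
      Module.finrank ℂ M = n ∧ ∀ x ∈ M, ∃ y, (x, y) ∈ A.graph ∧ (⟪x, y⟫).re ≤ s * ‖x‖ ^ 2 := by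
  obtain ⟨ψ, hψ, hlim⟩ := ht
  have hδ : 0 < (s - t) / (n + 1) := div_pos (by linarith) (by positivity)
  obtain ⟨k, hk⟩ := Metric.tendsto_atTop.1 hlim _ hδ
  let v : Fin n → A.domain := fun i => ψ (k + i)
  have hv : Orthonormal ℂ fun i => (v i : H) :=
    hψ.comp (fun i : Fin n => k + (i : ℕ)) fun i j hij => Fin.ext (by simpa using hij)
  refine ⟨Submodule.span ℂ (Set.range fun i => (v i : H)),
    FiniteDimensional.span_of_finite ℂ (Set.finite_range _), ?_, ?_⟩
  · simpa using finrank_span_eq_card hv.linearIndependent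
  · intro x hx
    obtain ⟨a, rfl⟩ := (Submodule.mem_span_range_iff_exists_fun ℂ).1 hx
    set x := ∑ i, a i • (v i : H) with hxdef
    refine ⟨∑ i, a i • A (v i), ?_, ?_⟩
    · exact sum_mem_graph fun i _ => A.graph.smul_mem (a i) (A.mem_graph (v i))
    · have ha : ∀ i, ‖a i‖ ≤ ‖x‖ := by
        intro i
        have : a i = ⟪(v i : H), x⟫ := (hv.inner_right_fintype a i).symm
        rw [this]
        refine (norm_inner_le_norm _ _).trans ?_
        rw [hv.1 i, one_mul]
      have hsub : ∑ i, a i • A (v i) = (t : ℂ) • x + ∑ i, a i • (A (v i) - (t : ℂ) • (v i : H)) := by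
        simp only [smul_sub, Finset.sum_sub_distrib, hxdef, Finset.smul_sum, smul_comm (t : ℂ)]
        abel
      have hbound : ‖∑ i, a i • (A (v i) - (t : ℂ) • (v i : H))‖ ≤ (s - t) * ‖x‖ := by
        calc _ ≤ ∑ i, ‖a i • (A (v i) - (t : ℂ) • (v i : H))‖ := norm_sum_le _ _
          _ ≤ ∑ i : Fin n, ‖x‖ * ((s - t) / (n + 1)) := by
            gcongr with i
            rw [norm_smul]
            have := hk (k + i) (by simp)
            rw [dist_zero_right] at this
            gcongr
            exact ha i
          _ = (n / (n + 1) : ℝ) * ((s - t) * ‖x‖) := by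
            rw [Finset.sum_const, Finset.card_univ, Fintype.card_fin, nsmul_eq_mul]
            ring
          _ ≤ 1 * ((s - t) * ‖x‖) := by
            have : 0 ≤ (s - t) * ‖x‖ := mul_nonneg (by linarith) (norm_nonneg _)
            gcongr
            rw [div_le_one (by positivity)]
            linarith
          _ = _ := one_mul _
      rw [hsub, inner_add_right, inner_smul_right, Complex.add_re, Complex.re_ofReal_mul,
        re_inner_self_eq]
      have := (Complex.re_le_norm _).trans (norm_inner_le_norm (𝕜 := ℂ) x
        (∑ i, a i • (A (v i) - (t : ℂ) • (v i : H))))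
      nlinarith [norm_nonneg x]

theorem IsResolvent.bddBelow (h : IsResolvent A c R) {n : ℕ} (hn : 1 ≤ n) :
    BddBelow {t : ℝ | (n : Cardinal) ≤ Module.rank ℂ (lowEigenspace A t) ∨ t ∈ essSpectrum A} := by
  refine ⟨1 - c, ?_⟩
  intro t ht
  have key : ∀ s, t < s → 1 - c ≤ s := by
    intro s hts
    rcases ht with ht | ht
    · have hpos : 0 < Module.rank ℂ (lowEigenspace A t) :=
        lt_of_lt_of_le (by exact_mod_cast hn) ht
      obtain ⟨x, hx⟩ := rank_pos_iff_exists_ne_zero.1 hpos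
      obtain ⟨y, hy, hle⟩ := h.re_inner_le_of_mem_lowEigenspace x.2
      have := (h.norm_sq_le hy).trans hle
      have hx0 : 0 < ‖(x : H)‖ ^ 2 := by
        have : (x : H) ≠ 0 := by simpa using hx
        positivity
      linarith [le_of_mul_le_mul_right this hx0]
    · obtain ⟨M, hMf, hM, hMs⟩ := IsResolvent.exists_trial_of_mem_essSpectrum ht hts 1
      obtain ⟨x, hx⟩ := (Module.finrank_pos_iff_exists_ne_zero (R := ℂ) (M := M)).1
        (by rw [hM]; exact one_pos)
      obtain ⟨y, hy, hle⟩ := hMs x x.2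
      have := (h.norm_sq_le hy).trans hle
      have hx0 : 0 < ‖(x : H)‖ ^ 2 := by
        have : (x : H) ≠ 0 := by simpa using hx
        positivity
      linarith [le_of_mul_le_mul_right this hx0]
  exact le_of_forall_gt_imp_ge_of_dense key

/-- Min-max principle, upper bounds. -/
theorem IsResolvent.nthEigenvalue_le [CompleteSpace H] (h : IsResolvent A c R) {n : ℕ} (hn : 1 ≤ n)
    {s : ℝ} (M : Submodule ℂ H) [FiniteDimensional ℂ M] (hM : Module.finrank ℂ M = n)
    (hs : ∀ x ∈ M, ∃ y, (x, y) ∈ A.graph ∧ (⟪x, y⟫).re ≤ s * ‖x‖ ^ 2) :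
    nthEigenvalue A n ≤ s := by
  obtain ⟨t, hts, ht⟩ := h.exists_le_of_trial M hM hs
  exact (csInf_le (h.bddBelow hn) ht).trans hts

/-- Min-max principle, existence of trial spaces. -/
theorem IsResolvent.exists_trial [CompleteSpace H] (h : IsResolvent A c R) {n : ℕ}
    (hdim : ∃ M : Submodule ℂ H, FiniteDimensional ℂ M ∧ Module.finrank ℂ M = n ∧ M ≤ A.domain)
    {s : ℝ} (hs : nthEigenvalue A n < s) : ∃ M : Submodule ℂ H, FiniteDimensional ℂ M ∧
      Module.finrank ℂ M = n ∧ ∀ x ∈ M, ∃ y, (x, y) ∈ A.graph ∧ (⟪x, y⟫).re ≤ s * ‖x‖ ^ 2 := by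
  have hne : {t : ℝ | (n : Cardinal) ≤ Module.rank ℂ (lowEigenspace A t) ∨
      t ∈ essSpectrum A}.Nonempty := by
    obtain ⟨M, hMf, hM, hMA⟩ := hdim
    let T : M →L[ℂ] H := LinearMap.toContinuousLinearMap (A.toFun ∘ₗ Submodule.inclusion hMA)
    obtain ⟨t, -, ht⟩ := h.exists_le_of_trial (s := ‖T‖) M hM (by
      intro x hx
      refine ⟨T ⟨x, hx⟩, A.mem_graph (Submodule.inclusion hMA ⟨x, hx⟩), ?_⟩
      have h1 : ‖T ⟨x, hx⟩‖ ≤ ‖T‖ * ‖x‖ := T.le_opNorm _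
      have h2 := (Complex.re_le_norm _).trans (norm_inner_le_norm (𝕜 := ℂ) x (T ⟨x, hx⟩))
      nlinarith [norm_nonneg x])
    exact ⟨t, ht⟩
  obtain ⟨t, ht, hts⟩ := exists_lt_of_csInf_lt hne hs
  rcases ht with ht | ht
  · obtain ⟨v, hv⟩ := Module.le_rank_iff.1 ht
    have hv' : LinearIndependent ℂ fun i => (v i : H) :=
      hv.map' (lowEigenspace A t).subtype (Submodule.ker_subtype _)
    refine ⟨Submodule.span ℂ (Set.range fun i => (v i : H)),
    FiniteDimensional.span_of_finite ℂ (Set.finite_range _), ?_, ?_⟩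
    · simpa using finrank_span_eq_card hv'
    · intro x hx
      have hx' : x ∈ lowEigenspace A t := by
        refine Submodule.span_le.2 ?_ hx
        rintro _ ⟨i, rfl⟩
        exact (v i).2
      obtain ⟨y, hy, hle⟩ := h.re_inner_le_of_mem_lowEigenspace hx'
      exact ⟨y, hy, hle.trans (by gcongr)⟩
  · exact IsResolvent.exists_trial_of_mem_essSpectrum ht hts n

end MinMax

/-! ### Form-bounded perturbations of a positive operator -/

section FormPerturbation

variable {H E : Type*} [NormedAddCommGroup H] [InnerProductSpace ℂ H]
  [NormedAddCommGroup E] [InnerProductSpace ℂ E]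

local notation "⟪" x ", " y "⟫" => inner ℂ x y

/-- `A = G* G + B`, where the form domain `D` of the positive operator `G* G` is larger than its
domain, and `B` is symmetric on `D` and bounded by `G`. In the application, `D = H¹`, `G` is the
gradient, and `B` is the sum of the potentials. -/
structure IsFormPerturbation (A : H →ₗ.[ℂ] H) {D : Submodule ℂ H} (G : D →ₗ[ℂ] E)
    (B : D →ₗ[ℂ] H) (C : ℝ) : Prop where
  domain_le : A.domain ≤ D
  inner_eq : ∀ (χ : D) (ψ : A.domain), ⟪(χ : H), A ψ⟫ =
    ⟪G χ, G (Submodule.inclusion domain_le ψ)⟫ + ⟪(χ : H), B (Submodule.inclusion domain_le ψ)⟫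
  symm : ∀ χ ψ : D, ⟪B χ, (ψ : H)⟫ = ⟪(χ : H), B ψ⟫
  bound : ∀ χ, ‖B χ‖ ≤ C * ‖G χ‖
  surj : ∀ c : ℝ, 0 < c → ∀ f : H, ∃ ψ : A.domain,
    A ψ - B (Submodule.inclusion domain_le ψ) + (c : ℂ) • (ψ : H) = f
  dense : ∀ ψ : D, ∀ ε > 0, ∃ χ : A.domain,
    ‖(ψ : H) - χ‖ < ε ∧ ‖G ψ - G (Submodule.inclusion domain_le χ)‖ < ε

/-- The quadratic form `‖G ψ‖² + ⟨ψ, B ψ⟩` of `G* G + B`. -/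
noncomputable def energyForm {D : Submodule ℂ H} (G : D →ₗ[ℂ] E) (B : D →ₗ[ℂ] H) (ψ : D) : ℝ :=
  ‖G ψ‖ ^ 2 + (⟪(ψ : H), B ψ⟫).re

variable {A : H →ₗ.[ℂ] H} {D : Submodule ℂ H} {G : D →ₗ[ℂ] E} {B : D →ₗ[ℂ] H} {C : ℝ}

theorem IsFormPerturbation.re_inner_eq (h : IsFormPerturbation A G B C) (ψ : A.domain) :
    (⟪(ψ : H), A ψ⟫).re = energyForm G B (Submodule.inclusion h.domain_le ψ) := by
  rw [show (ψ : H) = (Submodule.inclusion h.domain_le ψ : D) from rfl, h.inner_eq, Complex.add_re,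
    re_inner_self_eq, energyForm]

theorem IsFormPerturbation.inner_symm (h : IsFormPerturbation A G B C) (χ ψ : A.domain) :
    ⟪A χ, (ψ : H)⟫ = ⟪(χ : H), A ψ⟫ := by
  have h1 := h.inner_eq (Submodule.inclusion h.domain_le χ) ψ
  have h2 := h.inner_eq (Submodule.inclusion h.domain_le ψ) χ
  have h3 := h.symm (Submodule.inclusion h.domain_le χ) (Submodule.inclusion h.domain_le ψ)
  simp only [Submodule.coe_inclusion] at h1 h2 h3
  rw [← inner_conj_symm, h2, h1, map_add, inner_conj_symm, inner_conj_symm, h3]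

theorem abs_re_inner_le_of_bound (hB : ∀ χ, ‖B χ‖ ≤ C * ‖G χ‖) (ψ : D) :
    |(⟪(ψ : H), B ψ⟫).re| ≤ ‖(ψ : H)‖ * (C * ‖G ψ‖) :=
  (Complex.abs_re_le_norm _).trans ((norm_inner_le_norm _ _).trans (by gcongr; exact hB ψ))

/-- `A + c` is invertible for large `c`: the operator `G* G + c` is, and `B (G* G + c)⁻¹` has norm
less than `1`. -/
theorem IsFormPerturbation.exists_isResolvent [CompleteSpace H] (h : IsFormPerturbation A G B C) :
    ∃ (c : ℝ) (R : H →L[ℂ] H), IsResolvent A c R := by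
  -- `c ≥ 4 C²` gives `‖B (G* G + c)⁻¹‖ ≤ C / (2 √c)`, hence at most `1 / 2`
  set c : ℝ := 4 * C ^ 2 + 1 with hc
  have hc0 : 0 < c := by positivity
  let ι := Submodule.inclusion h.domain_le
  -- coercivity of `A + c`
  have hcoer : ∀ ψ : A.domain, ‖(ψ : H)‖ ^ 2 ≤ (⟪(ψ : H), A ψ + (c : ℂ) • (ψ : H)⟫).re := by
    intro ψ
    rw [inner_add_right, inner_smul_right, Complex.add_re, Complex.re_ofReal_mul, re_inner_self_eq,
      h.re_inner_eq, energyForm]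
    have := neg_le_of_abs_le (abs_re_inner_le_of_bound h.bound (ι ψ))
    have h2 : ((ι ψ : D) : H) = ψ := rfl
    rw [h2] at this
    change _ ≤ ‖G (ι ψ)‖ ^ 2 + (⟪(ψ : H), B (ι ψ)⟫).re + _
    nlinarith [sq_nonneg (‖G (ι ψ)‖ - C * ‖(ψ : H)‖), sq_nonneg (‖G (ι ψ)‖),
      sq_nonneg (C * ‖(ψ : H)‖)]
  let Lc : A.domain →ₗ[ℂ] H := A.toFun - B ∘ₗ ι + (c : ℂ) • A.domain.subtype
  have hLc : ∀ ψ, Lc ψ = A ψ - B (ι ψ) + (c : ℂ) • (ψ : H) := fun ψ => rfl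
  have hLform : ∀ ψ, ‖G (ι ψ)‖ ^ 2 + c * ‖(ψ : H)‖ ^ 2 ≤ ‖(ψ : H)‖ * ‖Lc ψ‖ := by
    intro ψ
    refine le_trans (le_of_eq ?_) ((Complex.re_le_norm _).trans (norm_inner_le_norm (𝕜 := ℂ) _ _))
    rw [hLc, inner_add_right, inner_sub_right, inner_smul_right, Complex.add_re, Complex.sub_re,
      Complex.re_ofReal_mul, re_inner_self_eq, h.re_inner_eq, energyForm]
    have h2 : ((ι ψ : D) : H) = ψ := rfl
    change _ = ‖G (ι ψ)‖ ^ 2 + (⟪((ι ψ : D) : H), B (ι ψ)⟫).re - _ + _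
    rw [h2]
    ring
  have hinj : Function.Injective Lc := by
    rw [← LinearMap.ker_eq_bot, LinearMap.ker_eq_bot']
    intro ψ hψ
    have := hLform ψ
    rw [hψ, norm_zero, mul_zero] at this
    have h3 : ‖(ψ : H)‖ ^ 2 ≤ 0 := by nlinarith [sq_nonneg ‖G (ι ψ)‖, sq_nonneg ‖(ψ : H)‖]
    have h4 : ‖(ψ : H)‖ = 0 := by nlinarith [norm_nonneg (ψ : H), pow_nonneg (norm_nonneg (ψ : H)) 2]
    exact Subtype.ext (norm_eq_zero.1 h4)
  let e := LinearEquiv.ofBijective Lc ⟨hinj, fun f => h.surj c hc0 f⟩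
  have he : ∀ g, Lc (e.symm g) = g := fun g => e.apply_symm_apply g
  -- `Φ = B (G* G + c)⁻¹`, and `(A + c)⁻¹ = (G* G + c)⁻¹ (1 + Φ)⁻¹`
  let Φ : H →L[ℂ] H := (B ∘ₗ ι ∘ₗ e.symm.toLinearMap).mkContinuous (1 / 2) (by
    intro g
    have h1 := hLform (e.symm g)
    rw [he] at h1
    have h2 : ‖B (ι (e.symm g))‖ ≤ C * ‖G (ι (e.symm g))‖ := h.bound _
    change ‖B (ι (e.symm g))‖ ≤ _
    refine h2.trans (le_of_sq_le_sq ?_ (by positivity))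
    set a := ‖G (ι (e.symm g))‖
    set n := ‖((e.symm g : A.domain) : H)‖
    have h3 : 4 * c * a ^ 2 ≤ ‖g‖ ^ 2 := by
      nlinarith [sq_nonneg (2 * c * n - ‖g‖), mul_le_mul_of_nonneg_left h1 hc0.le]
    nlinarith [sq_nonneg a, sq_nonneg (C * a)])
  have hΦ : ‖Φ‖ < 1 := lt_of_le_of_lt (LinearMap.mkContinuous_norm_le _ (by norm_num) _) (by norm_num)
  obtain ⟨U, hU⟩ := isUnit_one_sub_of_norm_lt_one (x := -Φ) (by rwa [norm_neg])
  have hUg : ∀ f, (↑U⁻¹ : H →L[ℂ] H) f + Φ ((↑U⁻¹ : H →L[ℂ] H) f) = f := by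
    intro f
    have : (↑U : H →L[ℂ] H) ((↑U⁻¹ : H →L[ℂ] H) f) = f := by
      rw [← mul_apply_eq_comp, U.mul_inv, one_apply_eq_self]
    rw [hU] at this
    simpa using this
  let S : H →ₗ[ℂ] A.domain := e.symm.toLinearMap ∘ₗ (↑U⁻¹ : H →L[ℂ] H).toLinearMap
  have hS : ∀ f, A (S f) + (c : ℂ) • (S f : H) = f := by
    intro f
    have h1 := he ((↑U⁻¹ : H →L[ℂ] H) f)
    rw [hLc] at h1
    have h2 := hUg f
    have h3 : Φ ((↑U⁻¹ : H →L[ℂ] H) f) = B (ι (S f)) := rfl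
    rw [h3] at h2
    change A (S f) - B (ι (S f)) + (c : ℂ) • (S f : H) = _ at h1
    rw [← h1] at h2
    refine Eq.trans ?_ h2
    abel
  have hSle : ∀ f, ‖(S f : H)‖ ^ 2 ≤ (⟪(S f : H), f⟫).re := by
    intro f
    have := hcoer (S f)
    rwa [hS f] at this
  let R : H →L[ℂ] H := (A.domain.subtype ∘ₗ S).mkContinuous 1 (by
    intro f
    have h1 := (hSle f).trans ((Complex.re_le_norm _).trans (norm_inner_le_norm (𝕜 := ℂ) _ _))
    change ‖(S f : H)‖ ≤ _
    rw [one_mul]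
    by_cases h0 : ‖(S f : H)‖ = 0
    · rw [h0]; positivity
    · rw [pow_two] at h1
      exact le_of_mul_le_mul_left h1 (lt_of_le_of_ne (norm_nonneg _) (Ne.symm h0)))
  have hR : ∀ f, R f = S f := fun f => rfl
  refine ⟨c, R, ⟨?_, ?_, ?_⟩⟩
  · intro f g
    have h1 := h.inner_symm (S f) (S g)
    rw [hR, hR]
    conv_lhs => rw [← hS g]
    conv_rhs => rw [← hS f]
    rw [inner_add_right, inner_add_left, h1, inner_smul_left, inner_smul_right, Complex.conj_ofReal]
  · intro f
    rw [hR, ← inner_conj_symm, Complex.conj_re]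
    exact hSle f
  · intro x y
    constructor
    · intro hxy
      obtain ⟨ψ, rfl, rfl⟩ := (LinearPMap.mem_graph_iff A).1 hxy
      rw [hR]
      set f := A ψ + (c : ℂ) • (ψ : H)
      have h1 := hcoer (S f - ψ)
      have h2 : A (S f - ψ) + (c : ℂ) • ((S f - ψ : A.domain) : H) = 0 := by
        rw [LinearPMap.map_sub, Submodule.coe_sub, smul_sub]
        have := hS f
        rw [sub_add_sub_comm, this, sub_self]
      rw [h2, inner_zero_right, Complex.zero_re] at h1
      have h3 : ‖((S f - ψ : A.domain) : H)‖ = 0 := by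
        nlinarith [norm_nonneg ((S f - ψ : A.domain) : H)]
      rw [norm_eq_zero, Submodule.coe_sub, sub_eq_zero] at h3
      exact h3
    · intro hxy
      rw [hR] at hxy
      have := hS (y + (c : ℂ) • x)
      rw [hxy] at this
      rw [LinearPMap.mem_graph_iff]
      exact ⟨_, hxy, add_right_cancel this⟩

/-- A linear map that is small on an orthonormal basis is small. -/
theorem norm_sum_inner_smul_le {V F : Type*} [NormedAddCommGroup V] [InnerProductSpace ℂ V]
    [NormedAddCommGroup F] [NormedSpace ℂ F] {m : ℕ} (b : OrthonormalBasis (Fin m) ℂ V)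
    {u : Fin m → F} {κ : ℝ} (hκ : 0 ≤ κ) (hu : ∀ i, ‖u i‖ ≤ κ / (m + 1)) (x : V) :
    ‖∑ i, ⟪b i, x⟫ • u i‖ ≤ κ * ‖x‖ := by
  calc _ ≤ ∑ i, ‖⟪b i, x⟫ • u i‖ := norm_sum_le _ _
    _ ≤ ∑ i : Fin m, ‖x‖ * (κ / (m + 1)) := by
      gcongr with i
      rw [norm_smul]
      gcongr
      · refine (norm_inner_le_norm _ _).trans ?_
        rw [b.orthonormal.1 i, one_mul]
      · exact hu i
    _ = (m / (m + 1) : ℝ) * (κ * ‖x‖) := by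
      rw [Finset.sum_const, Finset.card_univ, Fintype.card_fin, nsmul_eq_mul]
      ring
    _ ≤ 1 * (κ * ‖x‖) := by
      gcongr
      rw [div_le_one (by positivity)]
      linarith
    _ = _ := one_mul _

/-- The energy form depends continuously on the vector, in the norm of the form domain. -/
theorem energyForm_le_of_close {C s t Γ κ : ℝ} (hbound : ∀ χ, ‖B χ‖ ≤ C * ‖G χ‖) (hC : 0 ≤ C)
    {X Y : D} (hκ0 : 0 ≤ κ) (hκ1 : κ ≤ 1 / 2)
    (hκK : κ * (2 * Γ + 1 + C * Γ + 2 * C + 3 * |s| + 1) ≤ s - t)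
    (hq : energyForm G B X ≤ t * ‖(X : H)‖ ^ 2)
    (e1 : ‖(X : H) - Y‖ ≤ κ * ‖(X : H)‖) (e2 : ‖G X - G Y‖ ≤ κ * ‖(X : H)‖)
    (e3 : ‖G X‖ ≤ Γ * ‖(X : H)‖) : energyForm G B Y ≤ s * ‖(Y : H)‖ ^ 2 := by
  simp only [energyForm] at hq ⊢
  have hN0 : 0 ≤ ‖(X : H)‖ := norm_nonneg _
  generalize hN : ‖(X : H)‖ = N at *
  have e4 : ‖G Y‖ ≤ ‖G X‖ + κ * N := by
    have := norm_le_norm_add_norm_sub' (G Y) (G X)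
    rw [norm_sub_rev] at this
    linarith
  have e5 : ‖(Y : H)‖ ≤ N + κ * N := by
    have := norm_le_norm_add_norm_sub' (Y : H) (X : H)
    rw [norm_sub_rev] at this
    linarith
  have e6 : N ≤ ‖(Y : H)‖ + κ * N := by
    have := norm_le_norm_add_norm_sub' (X : H) (Y : H)
    linarith
  have e7 : (⟪(Y : H), B Y⟫).re - (⟪(X : H), B X⟫).re ≤
      ‖(Y : H)‖ * (C * (κ * N)) + κ * N * (C * (Γ * N)) := by
    have : ⟪(Y : H), B Y⟫ - ⟪(X : H), B X⟫ = ⟪(Y : H), B (Y - X)⟫ + ⟪(Y : H) - X, B X⟫ := by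
      rw [map_sub, inner_sub_right, inner_sub_left]
      ring
    rw [← Complex.sub_re, this, Complex.add_re]
    refine add_le_add ((Complex.re_le_norm _).trans ((norm_inner_le_norm _ _).trans ?_))
      ((Complex.re_le_norm _).trans ((norm_inner_le_norm _ _).trans ?_))
    · gcongr
      refine (hbound _).trans ?_
      rw [map_sub, norm_sub_rev]
      gcongr
    · rw [norm_sub_rev]
      gcongr
      exact (hbound _).trans (by gcongr)
  have hκN : κ * N ≤ N / 2 := by nlinarith
  have hκN0 : 0 ≤ κ * N := by positivity
  have f1 : ‖G Y‖ ^ 2 ≤ ‖G X‖ ^ 2 + (2 * Γ + 1) * (κ * N ^ 2) := by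
    have : ‖G Y‖ ^ 2 ≤ (‖G X‖ + κ * N) ^ 2 := by gcongr
    nlinarith [mul_le_mul_of_nonneg_right e3 hκN0, mul_le_mul_of_nonneg_right hκN hκN0]
  have f2 : ‖(Y : H)‖ * (C * (κ * N)) ≤ 2 * C * (κ * N ^ 2) := by
    have : ‖(Y : H)‖ ≤ 2 * N := by linarith
    calc _ ≤ (2 * N) * (C * (κ * N)) := by gcongr
      _ = _ := by ring
  have f3 : |N ^ 2 - ‖(Y : H)‖ ^ 2| ≤ 3 * (κ * N ^ 2) := by
    have hp : 0 ≤ ‖(Y : H)‖ := norm_nonneg _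
    rw [abs_le]
    constructor
    · nlinarith [mul_le_mul_of_nonneg_right hκN hκN0, mul_nonneg hκN0 hN0]
    · nlinarith [mul_nonneg hκN0 hN0, mul_nonneg hκN0 hp]
  have f4 : s * N ^ 2 - 3 * |s| * (κ * N ^ 2) ≤ s * ‖(Y : H)‖ ^ 2 := by
    have : s * (N ^ 2 - ‖(Y : H)‖ ^ 2) ≤ |s| * (3 * (κ * N ^ 2)) := by
      refine (le_abs_self _).trans ?_
      rw [abs_mul]
      gcongr
    linarith
  have f5 : κ * (2 * Γ + 1 + C * Γ + 2 * C + 3 * |s| + 1) * N ^ 2 ≤ (s - t) * N ^ 2 := by gcongr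
  have f6 : 0 ≤ κ * N ^ 2 := by positivity
  have f7 : κ * (2 * Γ + 1 + C * Γ + 2 * C + 3 * |s| + 1) * N ^ 2 = (2 * Γ + 1) * (κ * N ^ 2) + C * Γ * (κ * N ^ 2) +
    2 * C * (κ * N ^ 2) + 3 * |s| * (κ * N ^ 2) + κ * N ^ 2 := by ring
  have f8 : κ * N * (C * (Γ * N)) = C * Γ * (κ * N ^ 2) := by ring
  linarith

/-- Min-max principle with trial spaces in the form domain. -/
theorem IsFormPerturbation.nthEigenvalue_le [CompleteSpace H] (h : IsFormPerturbation A G B C)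
    {n : ℕ} (hn : 1 ≤ n) {t : ℝ} (M : Submodule ℂ D) [FiniteDimensional ℂ M]
    (hM : Module.finrank ℂ M = n) (ht : ∀ x ∈ M, energyForm G B x ≤ t * ‖(x : H)‖ ^ 2) :
    nthEigenvalue A n ≤ t := by
  obtain ⟨c, R, hR⟩ := h.exists_isResolvent
  refine le_of_forall_gt_imp_ge_of_dense fun s hs => ?_
  let ι := Submodule.inclusion h.domain_le
  let GM : M →L[ℂ] E := LinearMap.toContinuousLinearMap (G ∘ₗ M.subtype)
  set Γ := ‖GM‖ with hΓ
  have hΓ0 : 0 ≤ Γ := norm_nonneg GM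
  have hGM : ∀ x : M, ‖G x‖ ≤ Γ * ‖((x : D) : H)‖ := fun x => GM.le_opNorm x
  set C' := max C 0 with hC'
  have hC'0 : 0 ≤ C' := le_max_right _ _
  have hbound : ∀ χ, ‖B χ‖ ≤ C' * ‖G χ‖ := fun χ =>
    (h.bound χ).trans (by gcongr; exact le_max_left _ _)
  set K := 2 * Γ + 1 + C' * Γ + 2 * C' + 3 * |s| + 1 with hK
  have hK0 : 0 < K := by positivity
  set κ := min (1 / 2) ((s - t) / K) with hκ
  have hκ0 : 0 < κ := lt_min (by norm_num) (div_pos (by linarith) hK0)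
  have hκ1 : κ ≤ 1 / 2 := min_le_left _ _
  have hκK : κ * K ≤ s - t := (le_div_iff₀ hK0).1 (min_le_right _ _)
  let b := stdOrthonormalBasis ℂ M
  set m := Module.finrank ℂ M
  have hδ : 0 < κ / (m + 1) := by positivity
  choose χ hχ1 hχ2 using fun i => h.dense (b i : D) (κ / (m + 1)) hδ
  -- `J` moves an orthonormal basis of `M` slightly, into the operator domain
  let J : M →ₗ[ℂ] A.domain := b.toBasis.constr ℂ χ
  have hJ : ∀ x : M, J x = ∑ i, ⟪b i, x⟫ • χ i := by
    intro x
    simp [J, Module.Basis.constr_apply_fintype, b.repr_apply_apply]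
  have hx : ∀ x : M, x = ∑ i, ⟪b i, x⟫ • b i := fun x => (b.sum_repr' x).symm
  have hJ1 : ∀ x : M, ‖((x : D) : H) - J x‖ ≤ κ * ‖((x : D) : H)‖ := by
    intro x
    have := norm_sum_inner_smul_le b hκ0.le (u := fun i => ((b i : D) : H) - χ i) (fun i => (hχ1 i).le) x
    have h1 : ((x : D) : H) = ∑ i, ⟪b i, x⟫ • ((b i : D) : H) := by
      conv_lhs => rw [hx x]
      simp
    convert this using 2
    · rw [hJ, h1]
      simp [smul_sub, Finset.sum_sub_distrib]
    · rfl
  have hJ2 : ∀ x : M, ‖G x - G (ι (J x))‖ ≤ κ * ‖((x : D) : H)‖ := by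
    intro x
    have := norm_sum_inner_smul_le b hκ0.le (u := fun i => G (b i) - G (ι (χ i))) (fun i => (hχ2 i).le) x
    have h1 : G (x : D) = ∑ i, ⟪b i, x⟫ • G (b i : D) := by
      conv_lhs => rw [hx x]
      simp
    convert this using 2
    · rw [hJ, h1]
      simp [smul_sub, Finset.sum_sub_distrib]
    · rfl
  have hJinj : Function.Injective (A.domain.subtype ∘ₗ J) := by
    rw [← LinearMap.ker_eq_bot, LinearMap.ker_eq_bot']
    intro x hx0
    have h1 := hJ1 x
    have h2 : ((J x : A.domain) : H) = 0 := hx0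
    rw [h2, sub_zero] at h1
    have h3 : ‖((x : D) : H)‖ = 0 := by nlinarith [norm_nonneg ((x : D) : H)]
    exact Subtype.ext (Subtype.ext (norm_eq_zero.1 h3))
  refine hR.nthEigenvalue_le hn (LinearMap.range (A.domain.subtype ∘ₗ J)) ?_ ?_
  · rw [LinearMap.finrank_range_of_inj hJinj]
    exact hM
  · rintro _ ⟨x, rfl⟩
    refine ⟨A (J x), A.mem_graph _, ?_⟩
    change (⟪((J x : A.domain) : H), A (J x)⟫).re ≤ s * ‖((J x : A.domain) : H)‖ ^ 2
    rw [h.re_inner_eq]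
    change energyForm G B (ι (J x)) ≤ _
    exact energyForm_le_of_close hbound hC'0 hκ0.le hκ1 hκK (ht x x.2) (hJ1 x)
      (hJ2 x) (hGM x)

theorem IsFormPerturbation.exists_trial [CompleteSpace H] (h : IsFormPerturbation A G B C) {n : ℕ}
    (hdim : ∃ M : Submodule ℂ H, FiniteDimensional ℂ M ∧ Module.finrank ℂ M = n ∧ M ≤ A.domain)
    {s : ℝ} (hs : nthEigenvalue A n < s) : ∃ M : Submodule ℂ D, FiniteDimensional ℂ M ∧
      Module.finrank ℂ M = n ∧ ∀ x ∈ M, energyForm G B x ≤ s * ‖(x : H)‖ ^ 2 := by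
  obtain ⟨c, R, hR⟩ := h.exists_isResolvent
  obtain ⟨M, hMf, hM, hMs⟩ := hR.exists_trial hdim hs
  have hMA : M ≤ A.domain := fun x hx => by
    obtain ⟨y, hy, -⟩ := hMs x hx
    exact LinearPMap.mem_domain_of_mem_graph hy
  let e := Submodule.comapSubtypeEquivOfLe (hMA.trans h.domain_le)
  refine ⟨M.comap D.subtype, e.symm.finiteDimensional, by rw [e.finrank_eq, hM], ?_⟩
  intro x hx
  obtain ⟨y, hy, hle⟩ := hMs x hx
  obtain ⟨ψ, hψ, rfl⟩ := (LinearPMap.mem_graph_iff A).1 hy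
  have : x = Submodule.inclusion h.domain_le ψ := Subtype.ext hψ.symm
  rw [this, ← h.re_inner_eq, Submodule.coe_inclusion, hψ]
  exact hle

end FormPerturbation

/-! ### The Sobolev spaces and the gradient -/

section Sobolev

variable {q : ℕ}

local notation "⟪" x ", " y "⟫" => inner ℂ x y

open TemperedDistribution FourierTransform

/-- A Fourier multiplier with a bounded symbol is bounded on `L²`. -/
theorem exists_fourierMultiplier {g : Space → ℂ} (hg : g.HasTemperateGrowth) {C : ℝ}
    (hC : ∀ x, ‖g x‖ ≤ C) (h : Hilb q) : ∃ h' : Hilb q,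
      toDistr h' = fourierMultiplierCLM (EuclideanSpace ℂ (Fin q)) g (toDistr h) ∧
        ‖h'‖ ≤ C * ‖h‖ := by
  have hC0 : 0 ≤ C := (norm_nonneg _).trans (hC 0)
  let g' : BoundedContinuousFunction Space ℂ :=
    BoundedContinuousFunction.ofNormedAddCommGroup g hg.1.continuous C hC
  have hmem : MemLp g ∞ (volume : Measure Space) := g'.memLp_top
  refine ⟨𝓕⁻ ((hmem.toLp g) • 𝓕 h), ?_, ?_⟩
  · rw [toDistr, ← Lp.fourierInv_toTemperedDistribution_eq,
      MeasureTheory.Lp.toTemperedDistribution_smul_eq hg hmem, fourierMultiplierCLM_apply,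
      Lp.fourier_toTemperedDistribution_eq]
  · have h1 : ‖𝓕⁻ ((hmem.toLp g) • 𝓕 h)‖ = ‖(hmem.toLp g) • 𝓕 h‖ :=
      (Lp.fourierTransformₗᵢ Space (EuclideanSpace ℂ (Fin q))).symm.norm_map _
    rw [h1]
    refine (Lp.norm_smul_le _ _).trans ?_
    rw [Lp.norm_fourier_eq]
    gcongr
    rw [Lp.norm_toLp]
    refine ENNReal.toReal_le_of_le_ofReal hC0 ?_
    rw [eLpNorm_exponent_top]
    exact eLpNormEssSup_le_of_ae_bound (Eventually.of_forall hC)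

/-- The Sobolev space `H¹`. -/
def sobolevOne (q : ℕ) : Submodule ℂ (Hilb q) where
  carrier := {ψ | IsSobolev 1 ψ}
  zero_mem' := by
    have h := memSobolev_fun_zero Space (EuclideanSpace ℂ (Fin q)) 1 2
    have h0 : toDistr (0 : Hilb q) = 0 :=
      map_zero (Lp.toTemperedDistributionCLM (EuclideanSpace ℂ (Fin q)) (volume : Measure Space) 2)
    change MemSobolev 1 2 (toDistr (0 : Hilb q))
    rwa [h0]
  add_mem' := by
    intro ψ χ hψ hχ
    change MemSobolev 1 2 (toDistr (ψ + χ))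
    rw [toDistr_add]
    exact MemSobolev.add hψ hχ
  smul_mem' := by
    intro c ψ hψ
    change MemSobolev 1 2 (toDistr (c • ψ))
    rw [toDistr_smul]
    exact MemSobolev.smul c hψ

theorem mem_sobolevOne {ψ : Hilb q} : ψ ∈ sobolevOne q ↔ IsSobolev 1 ψ := Iff.rfl

theorem mem_sobolevTwo {ψ : Hilb q} : ψ ∈ sobolevTwo q ↔ IsSobolev 2 ψ := Iff.rfl

theorem sobolevTwo_le_sobolevOne : sobolevTwo q ≤ sobolevOne q := fun _ hψ =>
  MemSobolev.mono (by norm_num) hψ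

theorem exists_lineDeriv {ψ : Hilb q} (h : IsSobolev 1 ψ) (m : Space) :
    ∃ f : Hilb q, toDistr f = ∂_{m} (toDistr ψ) := by
  have h2 := MemSobolev.lineDerivOp (m := m) h
  rw [sub_self, memSobolev_zero_iff] at h2
  obtain ⟨f, hf⟩ := h2
  exact ⟨f, hf.symm⟩

/-- The `i`-th unit vector of `ℝ³`. -/
noncomputable abbrev unitVec (i : Fin 3) : Space := EuclideanSpace.single i (1 : ℝ)

/-- The weak partial derivative `∂ᵢ : H¹ → L²`. -/
noncomputable def weakDeriv (i : Fin 3) : sobolevOne q →ₗ[ℂ] Hilb q where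
  toFun ψ := toL2 (∂_{unitVec i} (toDistr (ψ : Hilb q)))
  map_add' ψ χ := by
    apply toL2_eq
    rw [toDistr_add, toDistr_toL2 (exists_lineDeriv ψ.2 _), toDistr_toL2 (exists_lineDeriv χ.2 _),
      Submodule.coe_add, toDistr_add, LineDeriv.lineDerivOp_add]
  map_smul' c ψ := by
    apply toL2_eq
    rw [toDistr_smul, toDistr_toL2 (exists_lineDeriv ψ.2 _), Submodule.coe_smul, toDistr_smul,
      LineDeriv.lineDerivOp_smul, RingHom.id_apply]

theorem toDistr_weakDeriv (i : Fin 3) (ψ : sobolevOne q) :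
    toDistr (weakDeriv i ψ) = ∂_{unitVec i} (toDistr (ψ : Hilb q)) :=
  toDistr_toL2 (exists_lineDeriv ψ.2 _)

/-- The gradient `H¹ → L²`, with values in the Hilbert sum of three copies of `L²`. -/
noncomputable def grad (q : ℕ) : sobolevOne q →ₗ[ℂ] PiLp 2 (fun _ : Fin 3 => Hilb q) :=
  (WithLp.linearEquiv 2 ℂ (Fin 3 → Hilb q)).symm.toLinearMap ∘ₗ LinearMap.pi weakDeriv

theorem grad_apply (ψ : sobolevOne q) (i : Fin 3) : grad q ψ i = weakDeriv i ψ := rfl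

theorem kineticEnergy_eq (ψ : sobolevOne q) : kineticEnergy (ψ : Hilb q) = ‖grad q ψ‖ ^ 2 := by
  rw [PiLp.norm_sq_eq_of_L2]
  rfl

theorem inner_grad (χ ψ : sobolevOne q) :
    ⟪grad q χ, grad q ψ⟫ = ∑ i, ⟪weakDeriv i χ, weakDeriv i ψ⟫ := by
  rw [PiLp.inner_apply]
  rfl

/-- The element of `L²` defined by a Schwartz function. -/
noncomputable abbrev schwartzL2 (f : 𝓢(Space, EuclideanSpace ℂ (Fin q))) : Hilb q :=
  f.toLp 2 (volume : Measure Space)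

theorem toDistr_schwartzL2 (f : 𝓢(Space, EuclideanSpace ℂ (Fin q))) : toDistr (schwartzL2 f) =
    f.toTemperedDistributionCLM Space (EuclideanSpace ℂ (Fin q)) volume :=
  Lp.toTemperedDistribution_toLp_eq f

theorem schwartz_mem_sobolevTwo (f : 𝓢(Space, EuclideanSpace ℂ (Fin q))) :
    schwartzL2 f ∈ sobolevTwo q := by
  change MemSobolev 2 2 (toDistr (schwartzL2 f))
  rw [toDistr_schwartzL2]
  exact f.memSobolev

/-- The element of `H¹` defined by a Schwartz function. -/
noncomputable def schwartzH1 (f : 𝓢(Space, EuclideanSpace ℂ (Fin q))) : sobolevOne q :=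
  ⟨schwartzL2 f, sobolevTwo_le_sobolevOne (schwartz_mem_sobolevTwo f)⟩

theorem weakDeriv_schwartzH1 (i : Fin 3) (f : 𝓢(Space, EuclideanSpace ℂ (Fin q))) :
    weakDeriv i (schwartzH1 f) = schwartzL2 (∂_{unitVec i} f) := by
  apply toL2_eq
  change toDistr (schwartzL2 (∂_{unitVec i} f)) = ∂_{unitVec i} (toDistr (schwartzL2 f))
  rw [toDistr_schwartzL2, toDistr_schwartzL2, lineDerivOp_toTemperedDistributionCLM_eq]

theorem norm_one_add_rpow_le_one {r : ℝ} (hr : r ≤ 0) (x : Space) :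
    ‖(((1 + ‖x‖ ^ 2) ^ r : ℝ) : ℂ)‖ ≤ 1 := by
  rw [Complex.norm_real, Real.norm_of_nonneg (by positivity)]
  exact Real.rpow_le_one_of_one_le_of_nonpos (by nlinarith [sq_nonneg ‖x‖]) hr

/-- The operator `(1 - Δ / 4π²)^{-1/2}` is bounded from `L²` to `H¹`. -/
theorem exists_bessel_neg_one (h : Hilb q) : ∃ ψ : sobolevOne q,
    toDistr (ψ : Hilb q) = besselPotential Space (EuclideanSpace ℂ (Fin q)) (-1) (toDistr h) ∧
      ‖(ψ : Hilb q)‖ ≤ ‖h‖ ∧ ‖grad q ψ‖ ≤ 6 * Real.pi * ‖h‖ := by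
  obtain ⟨u, hu, hun⟩ := exists_fourierMultiplier (q := q)
    (g := fun x : Space => (((1 + ‖x‖ ^ 2) ^ (-1 / 2 : ℝ) : ℝ) : ℂ)) (by fun_prop)
    (norm_one_add_rpow_le_one (by norm_num)) h
  have hu' : toDistr u = besselPotential Space (EuclideanSpace ℂ (Fin q)) (-1) (toDistr h) := hu
  have hmem : IsSobolev 1 u := by
    refine ⟨h, ?_⟩
    rw [hu', besselPotential_besselPotential_apply]
    simp
  refine ⟨⟨u, hmem⟩, hu', by simpa using hun, ?_⟩
  have hi : ∀ i, ‖weakDeriv i ⟨u, hmem⟩‖ ≤ 2 * Real.pi * ‖h‖ := by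
    intro i
    obtain ⟨v, hv, hvn⟩ := exists_fourierMultiplier (q := q)
      (g := fun x : Space => (((1 + ‖x‖ ^ 2) ^ (-1 / 2 : ℝ) : ℝ) : ℂ) *
        ((inner ℝ x (unitVec i) : ℝ) : ℂ))
      (by fun_prop) (C := 1) (by
        intro x
        rw [norm_mul, Complex.norm_real, Complex.norm_real, Real.norm_of_nonneg (by positivity)]
        have h1 : ‖(inner ℝ x (unitVec i) : ℝ)‖ ≤ ‖x‖ := by
          refine (norm_inner_le_norm _ _).trans ?_
          simp
        have h2 : ‖x‖ ≤ (1 + ‖x‖ ^ 2) ^ (1 / 2 : ℝ) := by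
          rw [← Real.sqrt_eq_rpow]
          exact Real.le_sqrt_of_sq_le (by linarith)
        calc _ ≤ (1 + ‖x‖ ^ 2) ^ (-1 / 2 : ℝ) * (1 + ‖x‖ ^ 2) ^ (1 / 2 : ℝ) := by
              gcongr
              exact h1.trans h2
          _ = 1 := by
            rw [← Real.rpow_add (by positivity)]
            norm_num) h
    have hw : weakDeriv i ⟨u, hmem⟩ = (2 * Real.pi * Complex.I : ℂ) • v := by
      apply toL2_eq
      rw [toDistr_smul, hv, hu, lineDeriv_eq_fourierMultiplierCLM,
        fourierMultiplierCLM_fourierMultiplierCLM_apply (by fun_prop) (by fun_prop)]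
      rfl
    rw [hw, norm_smul]
    have : ‖(2 * Real.pi * Complex.I : ℂ)‖ = 2 * Real.pi := by
      simp [abs_of_pos Real.pi_pos]
    rw [this]
    have := Real.pi_pos
    nlinarith
  have h3 : ‖grad q ⟨u, hmem⟩‖ ^ 2 ≤ (6 * Real.pi * ‖h‖) ^ 2 := by
    rw [PiLp.norm_sq_eq_of_L2]
    calc _ ≤ ∑ _i : Fin 3, (2 * Real.pi * ‖h‖) ^ 2 := by
          gcongr with i
          exact hi i
      _ ≤ _ := by
        rw [Finset.sum_const, Finset.card_univ, Fintype.card_fin, nsmul_eq_mul]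
        push_cast
        nlinarith [sq_nonneg (Real.pi * ‖h‖)]
  exact le_of_sq_le_sq h3 (by have := Real.pi_pos; positivity)

/-- Schwartz functions are dense in `H¹`. -/
theorem exists_schwartz_close (ψ : sobolevOne q) {ε : ℝ} (hε : 0 < ε) :
    ∃ f : 𝓢(Space, EuclideanSpace ℂ (Fin q)),
      ‖(ψ : Hilb q) - schwartzH1 f‖ < ε ∧ ‖grad q ψ - grad q (schwartzH1 f)‖ < ε := by
  obtain ⟨h, hh⟩ := ψ.2
  have hδ : 0 < ε / (6 * Real.pi + 1) := by have := Real.pi_pos; positivity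
  obtain ⟨g, hg⟩ := (SchwartzMap.denseRange_toLpCLM (p := 2) (μ := (volume : Measure Space))
    (F := EuclideanSpace ℂ (Fin q)) ENNReal.ofNat_ne_top).exists_dist_lt h hδ
  rw [SchwartzMap.toLpCLM_apply, dist_eq_norm] at hg
  obtain ⟨χ, hχ, hχ1, hχ2⟩ := exists_bessel_neg_one (h - schwartzL2 g)
  let f : 𝓢(Space, EuclideanSpace ℂ (Fin q)) := SchwartzMap.fourierMultiplierCLM
    (EuclideanSpace ℂ (Fin q)) (fun x : Space => (((1 + ‖x‖ ^ 2) ^ (-1 / 2 : ℝ) : ℝ) : ℂ)) g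
  have hf : toDistr (schwartzL2 f) =
      besselPotential Space (EuclideanSpace ℂ (Fin q)) (-1) (toDistr (schwartzL2 g)) := by
    rw [toDistr_schwartzL2, toDistr_schwartzL2, besselPotential,
      fourierMultiplierCLM_toTemperedDistributionCLM_eq (by fun_prop)]
  have hsub : χ = ψ - schwartzH1 f := by
    apply Subtype.ext
    apply toDistr_injective
    have e1 : ∀ a b : Hilb q, toDistr (a - b) = toDistr a - toDistr b := fun a b =>
      map_sub (Lp.toTemperedDistributionCLM (EuclideanSpace ℂ (Fin q)) (volume : Measure Space) 2) a b
    rw [hχ, Submodule.coe_sub, e1, e1, map_sub]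
    have e2 : toDistr ((schwartzH1 f : sobolevOne q) : Hilb q) = toDistr (schwartzL2 f) := rfl
    rw [e2, hf]
    have e3 : toDistr h = Lp.toTemperedDistribution h := rfl
    rw [e3, ← hh, besselPotential_besselPotential_apply]
    simp
  have hlt : (6 * Real.pi + 1) * ‖h - schwartzL2 g‖ < ε := by
    rw [lt_div_iff₀ (by have := Real.pi_pos; positivity)] at hg
    linarith
  have hn := norm_nonneg (h - schwartzL2 g)
  have hp := mul_nonneg Real.pi_pos.le hn
  refine ⟨f, ?_, ?_⟩
  · rw [← Submodule.coe_sub, ← hsub]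
    linarith
  · rw [← map_sub, ← hsub]
    linarith

theorem exists_seq_schwartz (ψ : sobolevOne q) :
    ∃ f : ℕ → 𝓢(Space, EuclideanSpace ℂ (Fin q)),
      Tendsto (fun k => ((schwartzH1 (f k) : sobolevOne q) : Hilb q)) atTop (𝓝 ψ) ∧
        Tendsto (fun k => grad q (schwartzH1 (f k))) atTop (𝓝 (grad q ψ)) := by
  choose f hf1 hf2 using fun k : ℕ => exists_schwartz_close ψ (ε := 1 / (k + 1)) (by positivity)
  refine ⟨f, ?_, ?_⟩
  · rw [tendsto_iff_norm_sub_tendsto_zero]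
    refine squeeze_zero (fun _ => norm_nonneg _) (fun k => ?_)
      tendsto_one_div_add_atTop_nhds_zero_nat
    rw [norm_sub_rev]
    exact (hf1 k).le
  · rw [tendsto_iff_norm_sub_tendsto_zero]
    refine squeeze_zero (fun _ => norm_nonneg _) (fun k => ?_)
      tendsto_one_div_add_atTop_nhds_zero_nat
    rw [norm_sub_rev]
    exact (hf2 k).le

theorem inner_toLp_schwartz (f g : 𝓢(Space, EuclideanSpace ℂ (Fin q))) :
    ⟪schwartzL2 f, schwartzL2 g⟫ = ∫ x, ⟪f x, g x⟫ := by
  rw [L2.inner_def]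
  refine integral_congr_ae ?_
  filter_upwards [f.coeFn_toLp 2 (volume : Measure Space), g.coeFn_toLp 2 (volume : Measure Space)]
    with x hf hg
  rw [hf, hg]

/-- Integration by parts in `H¹`. -/
theorem inner_weakDeriv (i : Fin 3) (χ ψ : sobolevOne q) :
    ⟪(χ : Hilb q), weakDeriv i ψ⟫ = -⟪weakDeriv i χ, (ψ : Hilb q)⟫ := by
  obtain ⟨f, hf1, hf2⟩ := exists_seq_schwartz χ
  obtain ⟨g, hg1, hg2⟩ := exists_seq_schwartz ψ
  have hc : Continuous fun v : PiLp 2 (fun _ : Fin 3 => Hilb q) => v i := by fun_prop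
  have hf3 : Tendsto (fun k => weakDeriv i (schwartzH1 (f k))) atTop (𝓝 (weakDeriv i χ)) :=
    (hc.tendsto _).comp hf2
  have hg3 : Tendsto (fun k => weakDeriv i (schwartzH1 (g k))) atTop (𝓝 (weakDeriv i ψ)) :=
    (hc.tendsto _).comp hg2
  refine tendsto_nhds_unique (hf1.inner hg3) ?_
  refine (hf3.inner hg1).neg.congr fun k => ?_
  rw [weakDeriv_schwartzH1, weakDeriv_schwartzH1]
  change -⟪schwartzL2 (∂_{unitVec i} (f k)), schwartzL2 (g k)⟫ =
    ⟪schwartzL2 (f k), schwartzL2 (∂_{unitVec i} (g k))⟫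
  rw [inner_toLp_schwartz, inner_toLp_schwartz]
  have := SchwartzMap.integral_bilinear_lineDerivOp_right_eq_neg_left (μ := volume) (f k) (g k)
    (isBoundedBilinearMap_inner (𝕜 := ℂ)
      (E := EuclideanSpace ℂ (Fin q))).toContinuousLinearMap (unitVec i)
  exact this.symm

theorem weakDeriv_mem (ψ : sobolevTwo q) (i : Fin 3) :
    weakDeriv i (Submodule.inclusion sobolevTwo_le_sobolevOne ψ) ∈ sobolevOne q := by
  rw [mem_sobolevOne, IsSobolev, toDistr_weakDeriv, Submodule.coe_inclusion]
  have h := MemSobolev.lineDerivOp (m := unitVec i) (mem_sobolevTwo.1 ψ.2)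
  rwa [show (2 : ℝ) - 1 = 1 by norm_num] at h

/-- `-Δ` as a linear map on `H²`. -/
noncomputable def negLaplacianMap (q : ℕ) : sobolevTwo q →ₗ[ℂ] Hilb q := (negLaplacian q).toFun

theorem negLaplacianMap_eq (ψ : sobolevTwo q) :
    negLaplacianMap q ψ = -toL2 (Δ (toDistr (ψ : Hilb q))) := rfl

theorem toDistr_sum {ι : Type*} (s : Finset ι) (f : ι → Hilb q) :
    toDistr (∑ i ∈ s, f i) = ∑ i ∈ s, toDistr (f i) :=
  map_sum (Lp.toTemperedDistributionCLM (EuclideanSpace ℂ (Fin q)) (volume : Measure Space) 2) f s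

theorem laplacian_eq_sum_unitVec (T : 𝓢'(Space, EuclideanSpace ℂ (Fin q))) :
    Δ T = ∑ i : Fin 3, ∂_{unitVec i} (∂_{unitVec i} T) := by
  rw [TemperedDistribution.laplacian_eq_sum (EuclideanSpace.basisFun (Fin 3) ℝ)]
  simp only [EuclideanSpace.basisFun_apply]

theorem negLaplacian_apply (ψ : sobolevTwo q) : negLaplacianMap q ψ =
    -∑ i, weakDeriv i ⟨weakDeriv i (Submodule.inclusion sobolevTwo_le_sobolevOne ψ),
      weakDeriv_mem ψ i⟩ := by
  rw [negLaplacianMap_eq]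
  congr 1
  apply toL2_eq
  rw [laplacian_eq_sum_unitVec, toDistr_sum]
  refine Finset.sum_congr rfl fun i _ => ?_
  rw [toDistr_weakDeriv, toDistr_weakDeriv, Submodule.coe_inclusion]

theorem inner_negLaplacian (χ : sobolevOne q) (ψ : sobolevTwo q) :
    ⟪(χ : Hilb q), negLaplacianMap q ψ⟫ =
      ⟪grad q χ, grad q (Submodule.inclusion sobolevTwo_le_sobolevOne ψ)⟫ := by
  rw [negLaplacian_apply, inner_neg_right, inner_sum, inner_grad, ← Finset.sum_neg_distrib]
  refine Finset.sum_congr rfl fun i _ => ?_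
  rw [inner_weakDeriv, neg_neg]

theorem fourierMultiplierCLM_add {g₁ g₂ : Space → ℂ} (hg₁ : g₁.HasTemperateGrowth)
    (hg₂ : g₂.HasTemperateGrowth) (f : 𝓢'(Space, EuclideanSpace ℂ (Fin q))) :
    fourierMultiplierCLM (EuclideanSpace ℂ (Fin q)) (g₁ + g₂) f =
      fourierMultiplierCLM (EuclideanSpace ℂ (Fin q)) g₁ f +
        fourierMultiplierCLM (EuclideanSpace ℂ (Fin q)) g₂ f := by
  simp [fourierMultiplierCLM_apply, smulLeftCLM_add hg₁ hg₂, FourierTransform.fourierInv_add]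

/-- `-Δ + c` maps `H²` onto `L²`. -/
theorem negLaplacian_surj {c : ℝ} (hc : 0 < c) (f : Hilb q) :
    ∃ ψ : sobolevTwo q, negLaplacianMap q ψ + (c : ℂ) • (ψ : Hilb q) = f := by
  set f' : Hilb q := (c : ℂ)⁻¹ • f with hf'
  set a : ℝ := 2 * Real.pi / √c with ha
  have ha2 : a ^ 2 * c = (2 * Real.pi) ^ 2 := by
    rw [ha, div_pow, Real.sq_sqrt hc.le]
    field_simp
  have ha0 : 0 < a := by have := Real.pi_pos; positivity
  -- the symbol of `(-Δ + c)⁻¹`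
  let g : Space → ℂ := fun x => (((1 + ‖a • x‖ ^ 2) ^ (-1 : ℝ) : ℝ) : ℂ)
  have hg0 : (fun x : Space => (1 + ‖a • x‖ ^ 2) ^ (-1 : ℝ)).HasTemperateGrowth :=
    (Function.hasTemperateGrowth_one_add_norm_sq_rpow Space (-1)).comp
      (a • ContinuousLinearMap.id ℝ Space).hasTemperateGrowth
  have hg : g.HasTemperateGrowth := Function.HasTemperateGrowth.comp Function.Complex.hasTemperateGrowth_ofReal hg0
  have hnorm : ∀ x : Space, ‖a • x‖ ^ 2 = a ^ 2 * ‖x‖ ^ 2 := by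
    intro x
    rw [norm_smul, mul_pow, Real.norm_of_nonneg ha0.le]
  obtain ⟨u, hu, -⟩ := exists_fourierMultiplier hg (C := 1)
    (fun x => norm_one_add_rpow_le_one (by norm_num) _) f'
  have hu2 : IsSobolev 2 u := by
    obtain ⟨v, hv, -⟩ := exists_fourierMultiplier (q := q)
      (g := g * fun x : Space => (((1 + ‖x‖ ^ 2) ^ (2 / 2 : ℝ) : ℝ) : ℂ))
      (hg.mul (by fun_prop)) (C := 1 + 1 / a ^ 2) (by
        intro x
        rw [Pi.mul_apply, norm_mul, Complex.norm_real, Complex.norm_real,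
          Real.norm_of_nonneg (by positivity), Real.norm_of_nonneg (by positivity), hnorm,
          Real.rpow_neg_one, div_self two_ne_zero, Real.rpow_one,
          inv_mul_le_iff₀ (by positivity)]
        have : (1 + a ^ 2 * ‖x‖ ^ 2) * (1 + 1 / a ^ 2) =
          1 + ‖x‖ ^ 2 + (1 / a ^ 2 + a ^ 2 * ‖x‖ ^ 2) := by field_simp; ring
        rw [this]
        have : 0 ≤ 1 / a ^ 2 + a ^ 2 * ‖x‖ ^ 2 := by positivity
        linarith) f'
    refine ⟨v, ?_⟩
    change _ = toDistr v
    rw [hv, hu, besselPotential,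
      fourierMultiplierCLM_fourierMultiplierCLM_apply hg (by fun_prop)]
  have hu2' : u ∈ sobolevTwo q := hu2
  refine ⟨⟨u, hu2'⟩, ?_⟩
  apply toDistr_injective
  rw [toDistr_add, toDistr_smul]
  have h1 : toDistr (negLaplacianMap q ⟨u, hu2'⟩) = -Δ (toDistr u) := by
    have e1 : ∀ a : Hilb q, toDistr (-a) = -toDistr a := fun a =>
      map_neg (Lp.toTemperedDistributionCLM (EuclideanSpace ℂ (Fin q)) (volume : Measure Space) 2) a
    change toDistr (-toL2 (Δ (toDistr u))) = _
    rw [e1, toDistr_toL2 (exists_laplacian hu2)]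
  have h2 : ((2 * Real.pi) ^ 2 : ℂ) • (g * fun x : Space => Complex.ofReal (‖x‖ ^ 2)) +
      (c : ℂ) • g = fun _ => (c : ℂ) := by
    funext x
    have e1 : (0 : ℝ) < 1 + a ^ 2 * ‖x‖ ^ 2 := by positivity
    have e2 : (2 * Real.pi) ^ 2 * ((1 + a ^ 2 * ‖x‖ ^ 2)⁻¹ * ‖x‖ ^ 2) +
        c * (1 + a ^ 2 * ‖x‖ ^ 2)⁻¹ = c := by
      rw [← ha2]
      field_simp
      ring
    simp only [Pi.add_apply, Pi.smul_apply, Pi.mul_apply, smul_eq_mul, g, hnorm, Real.rpow_neg_one]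
    exact_mod_cast e2
  rw [h1, laplacian_eq_fourierMultiplierCLM, hu,
    fourierMultiplierCLM_fourierMultiplierCLM_apply hg (by fun_prop), neg_smul, neg_neg,
    ← Complex.coe_smul, show (((2 * Real.pi) ^ 2 : ℝ) : ℂ) = (2 * Real.pi : ℂ) ^ 2 by push_cast; rfl]
  have hg2 : (g * fun x : Space => Complex.ofReal (‖x‖ ^ 2)).HasTemperateGrowth :=
    hg.mul (by fun_prop)
  have hg3 : (((2 * Real.pi) ^ 2 : ℂ) •
      (g * fun x : Space => Complex.ofReal (‖x‖ ^ 2))).HasTemperateGrowth :=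
    (Function.HasTemperateGrowth.const _).smul hg2
  have hg4 : ((c : ℂ) • g).HasTemperateGrowth := (Function.HasTemperateGrowth.const _).smul hg
  have h3 := fourierMultiplierCLM_add hg3 hg4 (toDistr f')
  rw [fourierMultiplierCLM_smul hg2, fourierMultiplierCLM_smul hg, h2,
    fourierMultiplierCLM_const] at h3
  have h4 : (c : ℂ) • toDistr f' = toDistr f := by
    rw [← toDistr_smul, hf', smul_smul, mul_inv_cancel₀ (by exact_mod_cast hc.ne'), one_smul]
  rw [← h4]
  exact h3.symm

end Sobolev

/-! ### Hardy's inequality and the Coulomb uncertainty principle -/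

section Hardy

variable {q : ℕ}

local notation "⟪" x ", " y "⟫" => inner ℂ x y

/-- The regularized inverse power `(|x - y|² + ε)^{-a}`. -/
noncomputable def regPow (y : Space) (ε a : ℝ) (x : Space) : ℝ := (‖x - y‖ ^ 2 + ε) ^ (-a)

theorem regPow_nonneg (y : Space) {ε : ℝ} (hε : 0 < ε) (a : ℝ) (x : Space) : 0 ≤ regPow y ε a x := by
  unfold regPow; positivity

theorem continuous_regPow (y : Space) {ε : ℝ} (hε : 0 < ε) (a : ℝ) : Continuous (regPow y ε a) := by
  unfold regPow
  refine Continuous.rpow_const (by fun_prop) fun x => Or.inl ?_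
  positivity

theorem regPow_le (y : Space) {ε : ℝ} (hε : 0 < ε) {a : ℝ} (ha : 0 ≤ a) (x : Space) :
    regPow y ε a x ≤ ε ^ (-a) := by
  unfold regPow
  exact Real.rpow_le_rpow_of_nonpos hε (by nlinarith [sq_nonneg ‖x - y‖]) (by linarith)

theorem regPow_sq_mul_le (y : Space) {ε : ℝ} (hε : 0 < ε) (a : ℝ) (x : Space) :
    ‖x - y‖ ^ 2 * regPow y ε a x ^ 2 ≤ regPow y ε (2 * a - 1) x := by
  unfold regPow
  have h0 : 0 < ‖x - y‖ ^ 2 + ε := by positivity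
  have h1 : (‖x - y‖ ^ 2 + ε) ^ (-(2 * a - 1)) =
      (‖x - y‖ ^ 2 + ε) * ((‖x - y‖ ^ 2 + ε) ^ (-a)) ^ 2 := by
    generalize ‖x - y‖ ^ 2 + ε = u at h0 ⊢
    rw [← Real.rpow_natCast (u ^ (-a)) 2, ← Real.rpow_mul h0.le]
    nth_rewrite 2 [← Real.rpow_one u]
    rw [← Real.rpow_add h0]
    congr 1
    push_cast
    ring
  rw [h1]
  gcongr
  linarith

/-- The `i`-th component of the vector field `(x - y) (|x - y|² + ε)^{-a}`. -/
noncomputable def regField (y : Space) (ε a : ℝ) (i : Fin 3) (x : Space) : ℝ :=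
  (x i - y i) * regPow y ε a x

/-- The derivative of the `i`-th component in the `i`-th direction. -/
noncomputable def regFieldDeriv (y : Space) (ε a : ℝ) (i : Fin 3) (x : Space) : ℝ :=
  regPow y ε a x - 2 * a * (x i - y i) ^ 2 * regPow y ε (a + 1) x

theorem hasLineDerivAt_regField (y : Space) {ε : ℝ} (hε : 0 < ε) (a : ℝ) (i : Fin 3) (x : Space) :
    HasLineDerivAt ℝ (regField y ε a i) (regFieldDeriv y ε a i x) x (unitVec i) := by
  unfold HasLineDerivAt
  have h0 : 0 < ‖x - y‖ ^ 2 + ε := by positivity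
  have h1 : ∀ t : ℝ, (x + t • unitVec i) i - y i = (x i - y i) + t := by
    intro t
    simp [unitVec]
    ring
  have h2 : ∀ t : ℝ, ‖x + t • unitVec i - y‖ ^ 2 = ‖x - y‖ ^ 2 + 2 * (x i - y i) * t + t ^ 2 := by
    intro t
    rw [show x + t • unitVec i - y = (x - y) + t • unitVec i by abel, norm_add_sq_real, norm_smul,
      inner_smul_right, EuclideanSpace.inner_single_right]
    simp
    ring
  have h3 : (fun t : ℝ => regField y ε a i (x + t • unitVec i)) = fun t =>
      ((x i - y i) + t) * (‖x - y‖ ^ 2 + 2 * (x i - y i) * t + t ^ 2 + ε) ^ (-a) := by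
    funext t
    rw [regField, regPow, h1, h2]
  rw [h3]
  have h4 : HasDerivAt (fun t : ℝ => (x i - y i) + t) 1 0 := (hasDerivAt_id 0).const_add _
  have h5 : HasDerivAt (fun t : ℝ => ‖x - y‖ ^ 2 + 2 * (x i - y i) * t + t ^ 2 + ε)
      (2 * (x i - y i)) 0 := by
    have e1 : HasDerivAt (fun t : ℝ => ‖x - y‖ ^ 2 + 2 * (x i - y i) * t)
      (2 * (x i - y i) * 1) 0 := ((hasDerivAt_id (0 : ℝ)).const_mul _).const_add _
    have e2 := (e1.add (hasDerivAt_pow 2 (0 : ℝ))).add_const ε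
    simpa using e2
  have h6 := h5.rpow_const (p := -a) (Or.inl (by simpa using h0.ne'))
  have h7 := h4.mul h6
  refine h7.congr_deriv ?_
  simp only [regFieldDeriv, regPow]
  norm_num
  rw [show -1 + -a = -a - 1 by ring]
  ring

theorem sum_sub_sq (x y : Space) : ∑ i, (x i - y i) ^ 2 = ‖x - y‖ ^ 2 := by
  rw [EuclideanSpace.norm_sq_eq]
  simp

theorem sub_sq_mul_regPow_le (y : Space) {ε : ℝ} (hε : 0 < ε) (a : ℝ) (x : Space) :
    ‖x - y‖ ^ 2 * regPow y ε (a + 1) x ≤ regPow y ε a x := by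
  unfold regPow
  have h0 : 0 < ‖x - y‖ ^ 2 + ε := by positivity
  have h1 : (‖x - y‖ ^ 2 + ε) ^ (-a) =
      (‖x - y‖ ^ 2 + ε) * (‖x - y‖ ^ 2 + ε) ^ (-(a + 1)) := by
    nth_rewrite 2 [← Real.rpow_one (‖x - y‖ ^ 2 + ε)]
    rw [← Real.rpow_add h0]
    congr 1
    ring
  rw [h1]
  gcongr
  linarith

theorem sub_sq_le (x y : Space) (i : Fin 3) : (x i - y i) ^ 2 ≤ ‖x - y‖ ^ 2 := by
  rw [← sum_sub_sq]
  exact Finset.single_le_sum (f := fun i => (x i - y i) ^ 2) (fun i _ => sq_nonneg _)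
    (Finset.mem_univ i)

/-- The divergence of `(x - y) (|x - y|² + ε)^{-a}` is at least `(3 - 2a) (|x - y|² + ε)^{-a}`. -/
theorem le_sum_regFieldDeriv (y : Space) {ε : ℝ} (hε : 0 < ε) {a : ℝ} (ha : 0 ≤ a) (x : Space) :
    (3 - 2 * a) * regPow y ε a x ≤ ∑ i, regFieldDeriv y ε a i x := by
  simp only [regFieldDeriv, Finset.sum_sub_distrib]
  rw [← Finset.sum_mul, ← Finset.mul_sum, sum_sub_sq]
  have := sub_sq_mul_regPow_le y hε a x
  simp
  nlinarith

theorem abs_regFieldDeriv_le (y : Space) {ε : ℝ} (hε : 0 < ε) {a : ℝ} (ha : 0 ≤ a) (i : Fin 3)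
    (x : Space) : |regFieldDeriv y ε a i x| ≤ (1 + 2 * a) * ε ^ (-a) := by
  have h1 := regPow_le y hε ha x
  have h2 := regPow_nonneg y hε a x
  have h3 := sub_sq_mul_regPow_le y hε a x
  have h4 : 0 ≤ (x i - y i) ^ 2 * regPow y ε (a + 1) x :=
    mul_nonneg (sq_nonneg _) (regPow_nonneg y hε _ x)
  have h5 : (x i - y i) ^ 2 * regPow y ε (a + 1) x ≤ regPow y ε a x :=
    (mul_le_mul_of_nonneg_right (sub_sq_le x y i) (regPow_nonneg y hε _ x)).trans h3
  unfold regFieldDeriv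
  rw [abs_le]
  constructor
  · nlinarith
  · nlinarith

theorem regField_sq_le (y : Space) {ε : ℝ} (hε : 0 < ε) (a : ℝ) (i : Fin 3)
    (x : Space) : regField y ε a i x ^ 2 ≤ regPow y ε (2 * a - 1) x := by
  rw [regField, mul_pow]
  exact (mul_le_mul_of_nonneg_right (sub_sq_le x y i) (sq_nonneg _)).trans
    (regPow_sq_mul_le y hε a x)

theorem continuous_regField (y : Space) {ε : ℝ} (hε : 0 < ε) (a : ℝ) (i : Fin 3) :
    Continuous (regField y ε a i) := by
  unfold regField
  exact Continuous.mul (by fun_prop) (continuous_regPow y hε a)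

theorem continuous_regFieldDeriv (y : Space) {ε : ℝ} (hε : 0 < ε) (a : ℝ) (i : Fin 3) :
    Continuous (regFieldDeriv y ε a i) := by
  unfold regFieldDeriv
  exact (continuous_regPow y hε a).sub (Continuous.mul (by fun_prop) (continuous_regPow y hε _))

theorem integrable_norm_sq_schwartz (f : 𝓢(Space, EuclideanSpace ℂ (Fin q))) :
    Integrable fun x => ‖f x‖ ^ 2 :=
  (f.memLp 2 volume).integrable_norm_pow two_ne_zero

theorem integral_norm_sq_schwartz (f : 𝓢(Space, EuclideanSpace ℂ (Fin q))) :
    ∫ x, ‖f x‖ ^ 2 = ‖schwartzL2 f‖ ^ 2 := by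
  have h := inner_toLp_schwartz f f
  have h2 : ∫ x, ⟪f x, f x⟫ = ((∫ x, ‖f x‖ ^ 2 : ℝ) : ℂ) := by
    rw [← integral_complex_ofReal]
    refine integral_congr_ae (Eventually.of_forall fun x => ?_)
    simp [inner_self_eq_norm_sq_to_K]
  rw [h2, inner_self_eq_norm_sq_to_K] at h
  apply Complex.ofReal_injective
  rw [← h]
  push_cast
  rfl

theorem integrable_regPow_mul (f : 𝓢(Space, EuclideanSpace ℂ (Fin q))) (y : Space) {ε a : ℝ}
    (hε : 0 < ε) (ha : 0 ≤ a) : Integrable fun x => regPow y ε a x * ‖f x‖ ^ 2 :=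
  (integrable_norm_sq_schwartz f).bdd_mul (c := ε ^ (-a))
    (continuous_regPow y hε a).aestronglyMeasurable
    (Eventually.of_forall fun x => by
      rw [Real.norm_of_nonneg (regPow_nonneg y hε a x)]
      exact regPow_le y hε ha x)

/-- The inequality behind both Hardy's inequality (`a = 1`) and the uncertainty principle for the
Coulomb potential (`a = 1/2`): integrate the divergence of `(x - y) (|x - y|² + ε)^{-a}` against
`|f|²`, and use `2 |w ⟨f, ∂f⟩| ≤ l |w f|² + l⁻¹ |∂f|²`. -/
theorem integral_regPow_schwartz_le (f : 𝓢(Space, EuclideanSpace ℂ (Fin q))) (y : Space) {ε a l : ℝ}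
    (hε : 0 < ε) (ha : 1 / 2 ≤ a) (hl : 0 < l) :
    (3 - 2 * a) * ∫ x, regPow y ε a x * ‖f x‖ ^ 2 ≤
      l * (∫ x, regPow y ε (2 * a - 1) x * ‖f x‖ ^ 2) + l⁻¹ * ‖grad q (schwartzH1 f)‖ ^ 2 := by
  have ha0 : 0 ≤ a := by linarith
  have hf2 := integrable_norm_sq_schwartz f
  have hbdd : ∀ b, 0 ≤ b → Integrable fun x => regPow y ε b x * ‖f x‖ ^ 2 := fun b hb =>
    integrable_regPow_mul f y hε hb
  let d : Fin 3 → 𝓢(Space, EuclideanSpace ℂ (Fin q)) := fun i => ∂_{unitVec i} f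
  have hinner : ∀ i, Integrable fun x => inner ℝ (f x) (d i x) := by
    intro i
    refine Integrable.mono' ((hf2.add (integrable_norm_sq_schwartz (d i)))) ?_
      (Eventually.of_forall fun x => ?_)
    · exact (f.continuous.inner (d i).continuous).aestronglyMeasurable
    · refine (norm_inner_le_norm _ _).trans ?_
      simp only [Pi.add_apply]
      nlinarith [sq_nonneg (‖f x‖ - ‖d i x‖), sq_nonneg ‖f x‖, sq_nonneg ‖d i x‖]
  have hw : ∀ i x, ‖regField y ε a i x‖ ≤ √(ε ^ (-(2 * a - 1))) := by
    intro i x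
    rw [Real.norm_eq_abs]
    exact Real.abs_le_sqrt ((regField_sq_le y hε a i x).trans (regPow_le y hε (by linarith) x))
  have hparts : ∀ i, ∫ x, regFieldDeriv y ε a i x * ‖f x‖ ^ 2 =
      -∫ x, regField y ε a i x * (2 * inner ℝ (f x) (d i x)) := by
    intro i
    have := integral_bilinear_hasLineDerivAt_right_eq_neg_left_of_integrable (μ := volume)
      (f := fun x => ‖f x‖ ^ 2) (f' := fun x => 2 * inner ℝ (f x) (d i x))
      (g := regField y ε a i) (g' := regFieldDeriv y ε a i) (v := unitVec i)
      (B := ContinuousLinearMap.mul ℝ ℝ) ?_ ?_ ?_ ?_ ?_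
    · simp only [ContinuousLinearMap.mul_apply'] at this
      simp only [mul_comm (regFieldDeriv _ _ _ _ _), mul_comm (regField _ _ _ _ _)]
      exact this
    · exact ((hinner i).const_mul 2).mul_bdd (continuous_regField y hε a i).aestronglyMeasurable
        (Eventually.of_forall (hw i))
    · exact hf2.mul_bdd (continuous_regFieldDeriv y hε a i).aestronglyMeasurable
        (Eventually.of_forall (abs_regFieldDeriv_le y hε ha0 i))
    · exact hf2.mul_bdd (continuous_regField y hε a i).aestronglyMeasurable
        (Eventually.of_forall (hw i))
    · intro x _
      have h1 : HasFDerivAt (fun x => ‖f x‖ ^ 2) _ x := (f.differentiableAt.hasFDerivAt).norm_sq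
      have h2 := h1.hasLineDerivAt (unitVec i)
      simpa [d, SchwartzMap.lineDerivOp_apply_eq_fderiv] using h2
    · intro x _
      exact hasLineDerivAt_regField y hε a i x
  have hint1 : ∀ i, Integrable fun x => regFieldDeriv y ε a i x * ‖f x‖ ^ 2 := fun i =>
    hf2.bdd_mul (continuous_regFieldDeriv y hε a i).aestronglyMeasurable
        (Eventually.of_forall (abs_regFieldDeriv_le y hε ha0 i))
  have hint2 : ∀ i, Integrable fun x => regField y ε a i x * (2 * inner ℝ (f x) (d i x)) := fun i =>
    ((hinner i).const_mul 2).bdd_mul (continuous_regField y hε a i).aestronglyMeasurable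
        (Eventually.of_forall (hw i))
  have hgrad : ‖grad q (schwartzH1 f)‖ ^ 2 = ∑ i, ∫ x, ‖d i x‖ ^ 2 := by
    rw [PiLp.norm_sq_eq_of_L2]
    refine Finset.sum_congr rfl fun i _ => ?_
    rw [grad_apply, weakDeriv_schwartzH1, integral_norm_sq_schwartz]
  calc (3 - 2 * a) * ∫ x, regPow y ε a x * ‖f x‖ ^ 2
      = ∫ x, (3 - 2 * a) * (regPow y ε a x * ‖f x‖ ^ 2) := (integral_const_mul _ _).symm
    _ ≤ ∫ x, ∑ i, regFieldDeriv y ε a i x * ‖f x‖ ^ 2 := by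
      refine integral_mono ((hbdd a ha0).const_mul _) (integrable_finsetSum _ fun i _ => hint1 i) ?_
      intro x
      simp only
      rw [← Finset.sum_mul, ← mul_assoc]
      exact mul_le_mul_of_nonneg_right (le_sum_regFieldDeriv y hε ha0 x) (sq_nonneg _)
    _ = ∑ i, -∫ x, regField y ε a i x * (2 * inner ℝ (f x) (d i x)) := by
      rw [integral_finsetSum _ fun i _ => hint1 i]
      exact Finset.sum_congr rfl fun i _ => hparts i
    _ = ∫ x, ∑ i, -(regField y ε a i x * (2 * inner ℝ (f x) (d i x))) := by
      rw [integral_finsetSum _ fun i _ => (hint2 i).fun_neg]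
      exact Finset.sum_congr rfl fun i _ => (integral_neg _).symm
    _ ≤ ∫ x, (l * (regPow y ε (2 * a - 1) x * ‖f x‖ ^ 2) + l⁻¹ * ∑ i, ‖d i x‖ ^ 2) := by
      refine integral_mono (integrable_finsetSum _ fun i _ => (hint2 i).neg)
        (((hbdd _ (by linarith)).const_mul _).add
          ((integrable_finsetSum _ fun i _ => integrable_norm_sq_schwartz (d i)).const_mul _)) ?_
      intro x
      simp only
      have h1 : ∀ i, -(regField y ε a i x * (2 * inner ℝ (f x) (d i x))) ≤
          l * ((x i - y i) ^ 2 * regPow y ε a x ^ 2 * ‖f x‖ ^ 2) + l⁻¹ * ‖d i x‖ ^ 2 := by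
        intro i
        have e1 : |inner ℝ (f x) (d i x)| ≤ ‖f x‖ * ‖d i x‖ := abs_real_inner_le_norm _ _
        have e2 : -(regField y ε a i x * (2 * inner ℝ (f x) (d i x))) ≤
            2 * (|regField y ε a i x| * ‖f x‖) * ‖d i x‖ := by
          refine (neg_le_abs _).trans ?_
          rw [abs_mul, abs_mul, abs_two]
          nlinarith [mul_le_mul_of_nonneg_left e1 (abs_nonneg (regField y ε a i x))]
        have e3 : (x i - y i) ^ 2 * regPow y ε a x ^ 2 * ‖f x‖ ^ 2 =
            (|regField y ε a i x| * ‖f x‖) ^ 2 := by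
          rw [mul_pow, sq_abs, regField, mul_pow]
        rw [e3]
        refine e2.trans ?_
        set u := |regField y ε a i x| * ‖f x‖
        set v := ‖d i x‖
        have e4 : l * u ^ 2 + l⁻¹ * v ^ 2 - 2 * u * v = l⁻¹ * (l * u - v) ^ 2 := by
          field_simp
          ring
        have : 0 ≤ l⁻¹ * (l * u - v) ^ 2 := by positivity
        linarith
      refine (Finset.sum_le_sum fun i _ => h1 i).trans ?_
      rw [Finset.sum_add_distrib, ← Finset.mul_sum, ← Finset.mul_sum, ← Finset.sum_mul,
        ← Finset.sum_mul, sum_sub_sq]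
      gcongr
      exact regPow_sq_mul_le y hε a x
    _ = _ := by
      rw [integral_add ((hbdd _ (by linarith)).const_mul _)
          ((integrable_finsetSum _ fun i _ => integrable_norm_sq_schwartz (d i)).const_mul _),
        integral_const_mul, integral_const_mul,
        integral_finsetSum _ fun i _ => integrable_norm_sq_schwartz (d i), hgrad]

end Hardy

section HardySobolev

variable {q : ℕ}

theorem coulomb_nonneg (x : Space) : 0 ≤ coulomb x := by
  unfold coulomb; positivity

theorem measurable_coulomb : Measurable coulomb := by
  unfold coulomb
  exact measurable_const.div measurable_norm

theorem coulomb_neg (x : Space) : coulomb (-x) = coulomb x := by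
  rw [coulomb, coulomb, norm_neg]

theorem coulomb_sub_comm (x y : Space) : coulomb (x - y) = coulomb (y - x) := by
  rw [← coulomb_neg, neg_sub]

theorem measurable_coulomb_sub : Measurable fun z : Space × Space => coulomb (z.1 - z.2) :=
  measurable_coulomb.comp (measurable_fst.sub measurable_snd)

theorem integral_norm_sq (ψ : Hilb q) : ∫ x, ‖ψ x‖ ^ 2 = ‖ψ‖ ^ 2 := by
  have h := L2.inner_def (𝕜 := ℂ) ψ ψ
  have h2 : ∫ x, inner ℂ (ψ x) (ψ x) = ((∫ x, ‖ψ x‖ ^ 2 : ℝ) : ℂ) := by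
    rw [← integral_complex_ofReal]
    refine integral_congr_ae (Eventually.of_forall fun x => ?_)
    simp [inner_self_eq_norm_sq_to_K]
  rw [h2, inner_self_eq_norm_sq_to_K] at h
  apply Complex.ofReal_injective
  rw [← h]
  push_cast
  rfl

theorem integrable_norm_sq (ψ : Hilb q) : Integrable fun x => ‖ψ x‖ ^ 2 :=
  (Lp.memLp ψ).integrable_norm_pow two_ne_zero

/-- Fatou: a bound on weighted integrals of Schwartz functions passes to the `L²` limit. -/
theorem lintegral_le_of_tendsto {ψ : Hilb q} {f : ℕ → 𝓢(Space, EuclideanSpace ℂ (Fin q))}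
    (hf : Tendsto (fun k => schwartzL2 (f k)) atTop (𝓝 ψ)) {w : ℕ → Space → ℝ} {v : Space → ℝ}
    (hw : ∀ k, Measurable (w k)) (hlim : ∀ᵐ x, Tendsto (fun k => w k x) atTop (𝓝 (v x)))
    {c : ℕ → ℝ} {c' : ℝ} (hc : Tendsto c atTop (𝓝 c'))
    (h : ∀ k, ∫⁻ x, ENNReal.ofReal (w k x * ‖f k x‖ ^ 2) ≤ ENNReal.ofReal (c k)) :
    ∫⁻ x, ENNReal.ofReal (v x * ‖ψ x‖ ^ 2) ≤ ENNReal.ofReal c' := by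
  have hm := tendstoInMeasure_of_tendsto_Lp hf
  obtain ⟨ns, hns, hae⟩ := hm.exists_seq_tendsto_ae
  have hfk : ∀ᵐ x, ∀ k, schwartzL2 (f k) x = f k x :=
    ae_all_iff.2 fun k => (f k).coeFn_toLp 2 volume
  have h1 : ∀ᵐ x, ENNReal.ofReal (v x * ‖ψ x‖ ^ 2) =
      liminf (fun k => ENNReal.ofReal (w (ns k) x * ‖f (ns k) x‖ ^ 2)) atTop := by
    filter_upwards [hae, hfk, hlim] with x hx hk hl
    simp only [hk] at hx
    refine (Tendsto.liminf_eq ?_).symm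
    exact (ENNReal.continuous_ofReal.tendsto _).comp
      ((hl.comp hns.tendsto_atTop).mul (hx.norm.pow 2))
  rw [lintegral_congr_ae h1]
  refine (lintegral_liminf_le fun k => ?_).trans ?_
  · exact ((hw _).mul ((f (ns k)).continuous.measurable.norm.pow_const 2)).ennreal_ofReal
  · have h2 : Tendsto (fun k => ENNReal.ofReal (c (ns k))) atTop (𝓝 (ENNReal.ofReal c')) :=
      (ENNReal.continuous_ofReal.tendsto _).comp (hc.comp hns.tendsto_atTop)
    rw [← h2.liminf_eq]
    exact liminf_le_liminf (Eventually.of_forall fun k => h (ns k))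

theorem tendsto_regPow (y : Space) (a : ℝ) {x : Space} (hx : x ≠ y) :
    Tendsto (fun k : ℕ => regPow y (1 / ((k : ℝ) + 1)) a x) atTop (𝓝 ((‖x - y‖ ^ 2) ^ (-a))) := by
  unfold regPow
  have h0 : ‖x - y‖ ^ 2 ≠ 0 := by
    have := norm_sub_pos_iff.2 hx
    positivity
  have h1 : Tendsto (fun k : ℕ => ‖x - y‖ ^ 2 + 1 / ((k : ℝ) + 1)) atTop (𝓝 (‖x - y‖ ^ 2 + 0)) :=
    tendsto_one_div_add_atTop_nhds_zero_nat.const_add _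
  rw [add_zero] at h1
  exact h1.rpow_const (Or.inl h0)

/-- Hardy's inequality `∫ V(x - y)² |ψ(x)|² dx ≤ 16 ‖∇ψ‖²`. -/
theorem lintegral_coulomb_sq_le (ψ : sobolevOne q) (y : Space) :
    ∫⁻ x, ENNReal.ofReal (coulomb (x - y) ^ 2 * ‖(ψ : Hilb q) x‖ ^ 2) ≤
      ENNReal.ofReal (16 * ‖grad q ψ‖ ^ 2) := by
  obtain ⟨f, hf, hg⟩ := exists_seq_schwartz ψ
  refine lintegral_le_of_tendsto (w := fun k x => 4 * regPow y (1 / ((k : ℝ) + 1)) 1 x) hf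
    (fun k => ((continuous_regPow y (by positivity) 1).measurable.const_mul 4)) ?_
    ((hg.norm.pow 2).const_mul 16) fun k => ?_
  · filter_upwards [compl_mem_ae_iff.2 (measure_singleton y)] with x hx
    have := (tendsto_regPow y 1 (Set.mem_compl_singleton_iff.1 hx)).const_mul 4
    convert this using 2
    rw [coulomb, Real.rpow_neg_one, div_pow, div_eq_mul_inv]
    norm_num
  · have h0 : (0 : ℝ) < 1 / ((k : ℝ) + 1) := by positivity
    have hint := integrable_regPow_mul (f k) y h0 zero_le_one
    have h1 := integral_regPow_schwartz_le (f k) y (a := 1) (l := 1 / 2) h0 (by norm_num)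
      (by norm_num)
    norm_num at h1
    rw [← ofReal_integral_eq_lintegral_ofReal]
    · refine ENNReal.ofReal_le_ofReal ?_
      simp only [mul_assoc]
      rw [integral_const_mul]
      norm_num
      linarith
    · simpa only [mul_assoc] using hint.const_mul 4
    · exact Eventually.of_forall fun x => mul_nonneg (mul_nonneg (by norm_num)
        (regPow_nonneg y h0 1 x)) (sq_nonneg _)

/-- The Coulomb uncertainty principle `∫ V(x - y) |ψ(x)|² dx ≤ 2 ‖ψ‖ ‖∇ψ‖`. -/
theorem lintegral_coulomb_le (ψ : sobolevOne q) (y : Space) :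
    ∫⁻ x, ENNReal.ofReal (coulomb (x - y) * ‖(ψ : Hilb q) x‖ ^ 2) ≤
      ENNReal.ofReal (2 * ‖ψ‖ * ‖grad q ψ‖) := by
  obtain ⟨f, hf, hg⟩ := exists_seq_schwartz ψ
  have hl : ∀ l : ℝ, 0 < l → ∫⁻ x, ENNReal.ofReal (coulomb (x - y) * ‖(ψ : Hilb q) x‖ ^ 2) ≤
      ENNReal.ofReal (l * ‖ψ‖ ^ 2 + l⁻¹ * ‖grad q ψ‖ ^ 2) := by
    intro l hl
    refine lintegral_le_of_tendsto (w := fun k x => 2 * regPow y (1 / ((k : ℝ) + 1)) (1 / 2) x) hf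
      (fun k => ((continuous_regPow y (by positivity) _).measurable.const_mul 2)) ?_
      (((hf.norm.pow 2).const_mul l).add ((hg.norm.pow 2).const_mul l⁻¹)) fun k => ?_
    · filter_upwards [compl_mem_ae_iff.2 (measure_singleton y)] with x hx
      have := (tendsto_regPow y (1 / 2) (Set.mem_compl_singleton_iff.1 hx)).const_mul 2
      convert this using 2
      rw [coulomb, Real.rpow_neg (sq_nonneg _), ← Real.sqrt_eq_rpow, Real.sqrt_sq (norm_nonneg _),
        div_eq_mul_inv]
    · have h0 : (0 : ℝ) < 1 / ((k : ℝ) + 1) := by positivity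
      have hint := integrable_regPow_mul (f k) y h0 (a := 1 / 2) (by norm_num)
      have h1 := integral_regPow_schwartz_le (f k) y (a := 1 / 2) h0 le_rfl hl
      have h2 : ∫ x, regPow y (1 / ((k : ℝ) + 1)) (2 * (1 / 2) - 1) x * ‖f k x‖ ^ 2 =
          ‖schwartzL2 (f k)‖ ^ 2 := by
        rw [← integral_norm_sq_schwartz]
        simp [regPow]
      rw [h2] at h1
      rw [← ofReal_integral_eq_lintegral_ofReal]
      · refine ENNReal.ofReal_le_ofReal ?_
        simp only [mul_assoc]
        rw [integral_const_mul]
        refine le_trans (le_of_eq ?_) h1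
        norm_num
      · simpa only [mul_assoc] using hint.const_mul 2
      · exact Eventually.of_forall fun x => mul_nonneg (mul_nonneg (by norm_num)
          (regPow_nonneg y h0 _ x)) (sq_nonneg _)
  have hδ : ∀ δ : ℝ, 0 < δ → ∫⁻ x, ENNReal.ofReal (coulomb (x - y) * ‖(ψ : Hilb q) x‖ ^ 2) ≤
      ENNReal.ofReal (2 * ‖ψ‖ * ‖grad q ψ‖ + δ * (‖ψ‖ + ‖grad q ψ‖)) := by
    intro δ hδ
    have ha := norm_nonneg ψ
    have hb := norm_nonneg (grad q ψ)
    -- the optimal `l` is `‖∇ψ‖ / ‖ψ‖`; `δ` keeps it positive and finite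
    refine (hl ((‖grad q ψ‖ + δ) / (‖ψ‖ + δ)) (by positivity)).trans
      (ENNReal.ofReal_le_ofReal ?_)
    generalize ‖ψ‖ = a at *
    generalize ‖grad q ψ‖ = b at *
    have h1 : (b + δ) / (a + δ) * a ^ 2 ≤ (b + δ) * a := by
      rw [div_mul_eq_mul_div, div_le_iff₀ (by positivity)]
      nlinarith [mul_nonneg (add_nonneg hb hδ.le) (mul_nonneg ha hδ.le)]
    have h2 : ((b + δ) / (a + δ))⁻¹ * b ^ 2 ≤ (a + δ) * b := by
      rw [inv_div, div_mul_eq_mul_div, div_le_iff₀ (by positivity)]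
      nlinarith [mul_nonneg (add_nonneg ha hδ.le) (mul_nonneg hb hδ.le)]
    linarith
  have hlim : Tendsto (fun δ : ℝ => ENNReal.ofReal (2 * ‖ψ‖ * ‖grad q ψ‖ +
      δ * (‖ψ‖ + ‖grad q ψ‖))) (𝓝[>] 0) (𝓝 (ENNReal.ofReal (2 * ‖ψ‖ * ‖grad q ψ‖))) := by
    have : Continuous fun δ : ℝ => ENNReal.ofReal (2 * ‖ψ‖ * ‖grad q ψ‖ +
      δ * (‖ψ‖ + ‖grad q ψ‖)) := ENNReal.continuous_ofReal.comp (by fun_prop)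
    have h := this.tendsto 0
    simp only [zero_mul, add_zero] at h
    exact h.mono_left nhdsWithin_le_nhds
  refine ge_of_tendsto hlim ?_
  filter_upwards [self_mem_nhdsWithin] with δ h
  exact hδ δ h

end HardySobolev

/-! ### The Coulomb potential is a positive definite function -/

section PositiveDefinite

/-- The parallelogram identity for `x - w` and `y - w`, exponentiated. -/
theorem gaussian_mul_gaussian (t : ℝ) (x y w : Space) :
    Real.exp (-(2 * t) * ‖x - w‖ ^ 2) * Real.exp (-(2 * t) * ‖y - w‖ ^ 2) =
      Real.exp (-t * ‖x - y‖ ^ 2) *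
        Real.exp (-(4 * t) * ‖w - (1 / 2 : ℝ) • (x + y)‖ ^ 2) := by
  rw [← Real.exp_add, ← Real.exp_add]
  congr 1
  have h : w - (1 / 2 : ℝ) • (x + y) = -((1 / 2 : ℝ) • ((x - w) + (y - w))) := by
    module
  have h2 : x - y = (x - w) - (y - w) := by abel
  rw [h, h2]
  generalize x - w = u
  generalize y - w = v
  rw [norm_neg, norm_smul, mul_pow, norm_add_sq_real, norm_sub_sq_real]
  norm_num
  ring

theorem integrable_gaussian {t : ℝ} (ht : 0 < t) :
    Integrable fun w : Space => Real.exp (-t * ‖w‖ ^ 2) := by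
  have h := (GaussianFourier.integrable_cexp_neg_mul_sq_norm_add (V := Space) (b := (t : ℂ))
    (by simpa using ht) 0 0).norm
  refine h.congr (Eventually.of_forall fun w => ?_)
  simp only [Complex.norm_exp]
  congr 1
  simp
  left
  norm_cast

/-- A kernel that is positive semidefinite stays so after multiplication by a Gaussian, since the
Gaussian is a superposition of products `b(x) b(y)`. -/
theorem integral_gaussian_mul_nonneg {κ : Space × Space → ℝ} (hκ : Integrable κ)
    (hpos : ∀ b : Space → ℝ, Continuous b → (∃ C, ∀ x, |b x| ≤ C) →
      0 ≤ ∫ z : Space × Space, b z.1 * b z.2 * κ z) {t : ℝ} (ht : 0 < t) :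
    0 ≤ ∫ z : Space × Space, Real.exp (-t * ‖z.1 - z.2‖ ^ 2) * κ z := by
  have h4 : 0 < 4 * t := by linarith
  have hG := integrable_gaussian h4
  have hGpos : 0 < ∫ w : Space, Real.exp (-(4 * t) * ‖w‖ ^ 2) := by
    rw [integral_pos_iff_support_of_nonneg (fun w => (Real.exp_pos _).le) hG]
    have : Function.support (fun w : Space => Real.exp (-(4 * t) * ‖w‖ ^ 2)) = Set.univ :=
      Set.eq_univ_of_forall fun w => (Real.exp_pos _).ne'
    rw [this]
    exact Measure.measure_univ_pos.2 (NeZero.ne _)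
  let F : (Space × Space) × Space → ℝ := fun p =>
    Real.exp (-(2 * t) * ‖p.1.1 - p.2‖ ^ 2) * Real.exp (-(2 * t) * ‖p.1.2 - p.2‖ ^ 2) * κ p.1
  have hF : ∀ p, F p = Real.exp (-t * ‖p.1.1 - p.1.2‖ ^ 2) * κ p.1 *
      Real.exp (-(4 * t) * ‖p.2 - (1 / 2 : ℝ) • (p.1.1 + p.1.2)‖ ^ 2) := by
    intro p
    simp only [F]
    rw [gaussian_mul_gaussian]
    ring
  have hm : AEStronglyMeasurable F ((volume : Measure (Space × Space)).prod volume) := by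
    refine AEStronglyMeasurable.mul ?_ hκ.aestronglyMeasurable.comp_fst
    exact (by fun_prop : Continuous fun p : (Space × Space) × Space =>
      Real.exp (-(2 * t) * ‖p.1.1 - p.2‖ ^ 2) *
        Real.exp (-(2 * t) * ‖p.1.2 - p.2‖ ^ 2)).aestronglyMeasurable
  have hexp : ∀ z : Space × Space, Real.exp (-t * ‖z.1 - z.2‖ ^ 2) ≤ 1 := fun z =>
    Real.exp_le_one_iff.2 (by nlinarith [sq_nonneg ‖z.1 - z.2‖])
  have hint : Integrable F ((volume : Measure (Space × Space)).prod volume) := by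
    rw [integrable_prod_iff hm]
    constructor
    · refine Eventually.of_forall fun z => ?_
      simp only [hF]
      exact (hG.comp_sub_right _).const_mul _
    · have : ∀ z : Space × Space, ∫ w, ‖F (z, w)‖ = Real.exp (-t * ‖z.1 - z.2‖ ^ 2) *
          (|κ z| * ∫ w : Space, Real.exp (-(4 * t) * ‖w‖ ^ 2)) := by
        intro z
        simp only [hF, norm_mul, Real.norm_eq_abs, Real.abs_exp]
        rw [integral_const_mul,
          integral_sub_right_eq_self (fun w : Space => Real.exp (-(4 * t) * ‖w‖ ^ 2))]
        ring
      simp only [this]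
      refine (hκ.abs.mul_const _).bdd_mul (c := 1) ?_ (Eventually.of_forall fun z => ?_)
      · exact (by fun_prop : Continuous fun z : Space × Space =>
          Real.exp (-t * ‖z.1 - z.2‖ ^ 2)).aestronglyMeasurable
      · rw [Real.norm_eq_abs, Real.abs_exp]
        exact hexp z
  have hswap := integral_integral_swap (f := fun z w => F (z, w)) hint
  have h1 : ∫ z : Space × Space, ∫ w, F (z, w) =
      (∫ z : Space × Space, Real.exp (-t * ‖z.1 - z.2‖ ^ 2) * κ z) *
        ∫ w : Space, Real.exp (-(4 * t) * ‖w‖ ^ 2) := by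
    rw [← integral_mul_const]
    refine integral_congr_ae (Eventually.of_forall fun z => ?_)
    simp only [hF]
    rw [integral_const_mul,
      integral_sub_right_eq_self (fun w : Space => Real.exp (-(4 * t) * ‖w‖ ^ 2))]
  have h2 : 0 ≤ ∫ w : Space, ∫ z : Space × Space, F (z, w) := by
    refine integral_nonneg fun w => ?_
    refine hpos (fun x => Real.exp (-(2 * t) * ‖x - w‖ ^ 2)) (by fun_prop) ⟨1, fun x => ?_⟩
    rw [Real.abs_exp]
    exact Real.exp_le_one_iff.2 (by nlinarith [sq_nonneg ‖x - w‖])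
  rw [← hswap, h1] at h2
  exact nonneg_of_mul_nonneg_left h2 hGpos

/-- The Coulomb potential as a superposition of Gaussians. -/
theorem integral_rpow_mul_exp_eq_coulomb {x : Space} (hx : x ≠ 0) :
    ∫ t in Set.Ioi (0 : ℝ), t ^ (-1 / 2 : ℝ) * Real.exp (-t * ‖x‖ ^ 2) =
      Real.Gamma (1 / 2) / 2 * coulomb x := by
  have h0 : 0 < ‖x‖ := norm_pos_iff.2 hx
  have h := Real.integral_rpow_mul_exp_neg_mul_Ioi (a := 1 / 2) (r := ‖x‖ ^ 2) (by norm_num)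
    (by positivity)
  have e : (1 / ‖x‖ ^ 2) ^ (1 / 2 : ℝ) = 1 / ‖x‖ := by
    rw [← Real.sqrt_eq_rpow, Real.sqrt_div zero_le_one, Real.sqrt_one, Real.sqrt_sq h0.le]
  rw [e] at h
  rw [coulomb, show Real.Gamma (1 / 2) / 2 * (2 / ‖x‖) = 1 / ‖x‖ * Real.Gamma (1 / 2) by ring, ← h]
  refine setIntegral_congr_fun measurableSet_Ioi fun t _ => ?_
  rw [mul_comm (‖x‖ ^ 2) t, neg_mul]
  norm_num

theorem ae_fst_ne_snd : ∀ᵐ z : Space × Space, z.1 - z.2 ≠ 0 := by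
  have hm : MeasurableSet {z : Space × Space | z.1 - z.2 = 0} :=
    (measurable_fst.sub measurable_snd) (measurableSet_singleton 0)
  rw [ae_iff]
  simp only [not_not]
  rw [show (volume : Measure (Space × Space)) = volume.prod volume from rfl,
    Measure.measure_prod_null hm]
  refine Eventually.of_forall fun x => ?_
  have : Prod.mk x ⁻¹' {z : Space × Space | z.1 - z.2 = 0} = {x} := by
    ext y
    simp [sub_eq_zero, eq_comm]
  simp only [this]
  exact measure_singleton x

/-- A kernel that is positive semidefinite stays so after multiplication by the Coulomb potential,
which is a superposition of Gaussians. -/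
theorem integral_coulomb_mul_nonneg {κ : Space × Space → ℝ} (hκ : Integrable κ)
    (hV : Integrable fun z : Space × Space => coulomb (z.1 - z.2) * κ z)
    (hpos : ∀ b : Space → ℝ, Continuous b → (∃ C, ∀ x, |b x| ≤ C) →
      0 ≤ ∫ z : Space × Space, b z.1 * b z.2 * κ z) :
    0 ≤ ∫ z : Space × Space, coulomb (z.1 - z.2) * κ z := by
  let μ : Measure ℝ := volume.restrict (Set.Ioi 0)
  let F : (Space × Space) × ℝ → ℝ := fun p =>
    p.2 ^ (-1 / 2 : ℝ) * Real.exp (-p.2 * ‖p.1.1 - p.1.2‖ ^ 2) * κ p.1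
  have hγ : 0 < Real.Gamma (1 / 2) / 2 := by
    have := Real.Gamma_pos_of_pos (s := 1 / 2) (by norm_num)
    linarith
  have hm : AEStronglyMeasurable F ((volume : Measure (Space × Space)).prod μ) := by
    refine AEStronglyMeasurable.mul ?_ hκ.aestronglyMeasurable.comp_fst
    refine Measurable.aestronglyMeasurable ?_
    refine Measurable.mul (measurable_snd.pow_const _) ?_
    exact (by fun_prop : Continuous fun p : (Space × Space) × ℝ =>
      Real.exp (-p.2 * ‖p.1.1 - p.1.2‖ ^ 2)).measurable
  have hsec : ∀ z : Space × Space, z.1 - z.2 ≠ 0 →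
      ∫ t, t ^ (-1 / 2 : ℝ) * Real.exp (-t * ‖z.1 - z.2‖ ^ 2) ∂μ =
        Real.Gamma (1 / 2) / 2 * coulomb (z.1 - z.2) := fun z hz =>
    integral_rpow_mul_exp_eq_coulomb hz
  have hcpos : ∀ z : Space × Space, z.1 - z.2 ≠ 0 → 0 < coulomb (z.1 - z.2) := fun z hz =>
    div_pos two_pos (norm_pos_iff.2 hz)
  have hint : Integrable F ((volume : Measure (Space × Space)).prod μ) := by
    rw [integrable_prod_iff hm]
    constructor
    · filter_upwards [ae_fst_ne_snd] with z hz
      change Integrable (fun t : ℝ =>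
        t ^ (-1 / 2 : ℝ) * Real.exp (-t * ‖z.1 - z.2‖ ^ 2) * κ z) μ
      refine Integrable.mul_const ?_ _
      -- the integral of a non-integrable function is `0`, but this one is positive
      exact not_imp_comm.1 integral_undef (by
        rw [hsec z hz]
        exact (mul_pos hγ (hcpos z hz)).ne')
    · refine (hV.abs.const_mul (Real.Gamma (1 / 2) / 2)).congr ?_
      filter_upwards [ae_fst_ne_snd] with z hz
      rw [abs_mul, abs_of_pos (hcpos z hz), ← mul_assoc, ← hsec z hz, ← integral_mul_const]
      refine setIntegral_congr_fun measurableSet_Ioi fun t ht => ?_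
      have ht0 : (0 : ℝ) < t := ht
      simp only [F]
      rw [norm_mul, norm_mul, Real.norm_eq_abs (κ z), Real.norm_of_nonneg (Real.exp_pos _).le,
        Real.norm_of_nonneg (Real.rpow_nonneg ht0.le _)]
  have hswap := integral_integral_swap (f := fun z t => F (z, t)) hint
  have h1 : ∫ z : Space × Space, ∫ t, F (z, t) ∂μ =
      Real.Gamma (1 / 2) / 2 * ∫ z : Space × Space, coulomb (z.1 - z.2) * κ z := by
    rw [← integral_const_mul]
    refine integral_congr_ae ?_
    filter_upwards [ae_fst_ne_snd] with z hz
    simp only [F]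
    rw [integral_mul_const, hsec z hz, mul_assoc]
  have h2 : 0 ≤ ∫ t, (∫ z : Space × Space, F (z, t)) ∂μ := by
    refine setIntegral_nonneg measurableSet_Ioi fun t ht => ?_
    have ht0 : (0 : ℝ) < t := ht
    simp only [F, mul_assoc]
    rw [integral_const_mul]
    exact mul_nonneg (Real.rpow_nonneg ht0.le _) (integral_gaussian_mul_nonneg hκ hpos ht0)
  rw [← hswap, h1] at h2
  exact nonneg_of_mul_nonneg_right h2 hγ

end PositiveDefinite

/-! ### Direct and exchange terms of a mean field -/

section MeanField

variable {q : ℕ}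

local notation "⟪" x ", " y "⟫" => inner ℂ x y

theorem integrable_of_lintegral_le {α : Type*} [MeasurableSpace α] {μ : Measure α} {f : α → ℝ}
    (hm : AEStronglyMeasurable f μ) (h0 : ∀ x, 0 ≤ f x) {c : ℝ} (hc : 0 ≤ c)
    (h : ∫⁻ x, ENNReal.ofReal (f x) ∂μ ≤ ENNReal.ofReal c) :
    Integrable f μ ∧ ∫ x, f x ∂μ ≤ c := by
  constructor
  · refine (lintegral_ofReal_ne_top_iff_integrable hm (Eventually.of_forall h0)).1 ?_
    exact (h.trans_lt ENNReal.ofReal_lt_top).ne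
  · rw [integral_eq_lintegral_of_nonneg_ae (Eventually.of_forall h0) hm]
    exact ENNReal.toReal_le_of_le_ofReal hc h

theorem measurable_norm_sq (ψ : Hilb q) : Measurable fun x => ‖ψ x‖ ^ 2 :=
  (Lp.stronglyMeasurable ψ).measurable.norm.pow_const 2

theorem measurable_coulomb_sub_const (y : Space) : Measurable fun x : Space => coulomb (x - y) :=
  measurable_coulomb.comp (measurable_id.sub_const y)

theorem integrable_coulomb_sq (ψ : sobolevOne q) (y : Space) :
    Integrable (fun x => coulomb (x - y) ^ 2 * ‖(ψ : Hilb q) x‖ ^ 2) ∧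
      ∫ x, coulomb (x - y) ^ 2 * ‖(ψ : Hilb q) x‖ ^ 2 ≤ 16 * ‖grad q ψ‖ ^ 2 :=
  integrable_of_lintegral_le
    (((measurable_coulomb_sub_const y).pow_const 2).mul
      (measurable_norm_sq (ψ : Hilb q))).aestronglyMeasurable
    (fun x => mul_nonneg (sq_nonneg _) (sq_nonneg _)) (by positivity) (lintegral_coulomb_sq_le ψ y)

theorem integrable_coulomb (ψ : sobolevOne q) (y : Space) :
    Integrable (fun x => coulomb (x - y) * ‖(ψ : Hilb q) x‖ ^ 2) ∧
      ∫ x, coulomb (x - y) * ‖(ψ : Hilb q) x‖ ^ 2 ≤ 2 * ‖ψ‖ * ‖grad q ψ‖ :=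
  integrable_of_lintegral_le
    ((measurable_coulomb_sub_const y).mul
      (measurable_norm_sq (ψ : Hilb q))).aestronglyMeasurable
    (fun x => mul_nonneg (coulomb_nonneg _) (sq_nonneg _)) (by positivity)
    (lintegral_coulomb_le ψ y)

/-- The Cauchy-Schwarz inequality. -/
theorem sq_integral_mul_le {α : Type*} [MeasurableSpace α] {μ : Measure α} {f g : α → ℝ}
    (hf : MemLp f 2 μ) (hg : MemLp g 2 μ) :
    (∫ x, f x * g x ∂μ) ^ 2 ≤ (∫ x, f x ^ 2 ∂μ) * ∫ x, g x ^ 2 ∂μ := by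
  have h1 := integral_mul_norm_le_Lp_mul_Lq (μ := μ) (f := f) (g := g) Real.HolderConjugate.two_two
    (by simpa using hf) (by simpa using hg)
  have h2 : |∫ x, f x * g x ∂μ| ≤ ∫ x, ‖f x‖ * ‖g x‖ ∂μ := by
    simpa only [norm_mul, Real.norm_eq_abs] using
      norm_integral_le_integral_norm (μ := μ) fun x => f x * g x
  have h3 : ∀ h : α → ℝ, ∫ x, ‖h x‖ ^ (2 : ℝ) ∂μ = ∫ x, h x ^ 2 ∂μ := by
    intro h
    refine integral_congr_ae (Eventually.of_forall fun x => ?_)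
    simp
  rw [h3, h3, ← Real.sqrt_eq_rpow, ← Real.sqrt_eq_rpow] at h1
  rw [← sq_abs]
  refine (pow_le_pow_left₀ (abs_nonneg _) (h2.trans h1) 2).trans (le_of_eq ?_)
  rw [mul_pow, Real.sq_sqrt (integral_nonneg fun x => sq_nonneg _),
    Real.sq_sqrt (integral_nonneg fun x => sq_nonneg _)]

/-- A weight that depends on the difference of two points only can be integrated against a density
`ρ` at one point and `|ψ|²` at the other, with a bound that is uniform in the position of `ρ`. -/
theorem integrable_density_mul {ρ : Space → ℝ} (h0 : ∀ y, 0 ≤ ρ y) (hρ : Integrable ρ)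
    {w : Space → ℝ} (hw : Measurable w) (hw0 : ∀ x, 0 ≤ w x) (ψ : Hilb q) {c : ℝ}
    (h : ∀ y, Integrable (fun x => w (x - y) * ‖ψ x‖ ^ 2) ∧ ∫ x, w (x - y) * ‖ψ x‖ ^ 2 ≤ c) :
    Integrable (fun z : Space × Space => ρ z.2 * (w (z.1 - z.2) * ‖ψ z.1‖ ^ 2)) ∧
      ∫ z : Space × Space, ρ z.2 * (w (z.1 - z.2) * ‖ψ z.1‖ ^ 2) ≤ (∫ y, ρ y) * c := by
  have hm : AEStronglyMeasurable (fun z : Space × Space => ρ z.1 * (w (z.2 - z.1) * ‖ψ z.2‖ ^ 2))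
      ((volume : Measure Space).prod volume) := by
    refine AEStronglyMeasurable.mul hρ.aestronglyMeasurable.comp_fst ?_
    exact ((hw.comp (measurable_snd.sub measurable_fst)).mul
      ((measurable_norm_sq ψ).comp measurable_snd)).aestronglyMeasurable
  have hin : ∀ y, ∫ x, ‖ρ y * (w (x - y) * ‖ψ x‖ ^ 2)‖ = ρ y * ∫ x, w (x - y) * ‖ψ x‖ ^ 2 := by
    intro y
    rw [← integral_const_mul]
    refine integral_congr_ae (Eventually.of_forall fun x => ?_)
    exact Real.norm_of_nonneg (mul_nonneg (h0 y) (mul_nonneg (hw0 _) (sq_nonneg _)))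
  have hle : ∀ y, ρ y * ∫ x, w (x - y) * ‖ψ x‖ ^ 2 ≤ ρ y * c := fun y =>
    mul_le_mul_of_nonneg_left (h y).2 (h0 y)
  have hint2 : Integrable fun y => ρ y * ∫ x, w (x - y) * ‖ψ x‖ ^ 2 := by
    refine Integrable.mono' (hρ.mul_const c) ?_ (Eventually.of_forall fun y => ?_)
    · refine hρ.aestronglyMeasurable.mul ?_
      have : Measurable fun z : Space × Space => w (z.2 - z.1) * ‖ψ z.2‖ ^ 2 :=
        (hw.comp (measurable_snd.sub measurable_fst)).mul
          ((measurable_norm_sq ψ).comp measurable_snd)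
      exact this.stronglyMeasurable.integral_prod_right'.aestronglyMeasurable
    · rw [Real.norm_of_nonneg (mul_nonneg (h0 y) (integral_nonneg fun x =>
        mul_nonneg (hw0 _) (sq_nonneg _)))]
      exact hle y
  have hint : Integrable (fun z : Space × Space => ρ z.1 * (w (z.2 - z.1) * ‖ψ z.2‖ ^ 2))
      ((volume : Measure Space).prod volume) := by
    rw [integrable_prod_iff hm]
    refine ⟨Eventually.of_forall fun y => (h y).1.const_mul (ρ y), ?_⟩
    simp only [hin]
    exact hint2
  refine ⟨hint.swap, ?_⟩
  have e1 : ∫ z : Space × Space, ρ z.2 * (w (z.1 - z.2) * ‖ψ z.1‖ ^ 2) =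
      ∫ y, ρ y * ∫ x, w (x - y) * ‖ψ x‖ ^ 2 := by
    have := integral_prod_symm (μ := (volume : Measure Space)) (ν := (volume : Measure Space))
      (fun z : Space × Space => ρ z.2 * (w (z.1 - z.2) * ‖ψ z.1‖ ^ 2)) hint.swap
    refine this.trans (integral_congr_ae (Eventually.of_forall fun y => ?_))
    exact integral_const_mul (ρ y) (fun x => w (x - y) * ‖ψ x‖ ^ 2)
  rw [e1, ← integral_mul_const]
  exact integral_mono hint2 (hρ.mul_const c) hle

/-- The vector `(∑ₜ τ((x, s), (y, t)) vₜ)ₛ`. -/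
noncomputable def kernelApply (τ : SpinKernel q) (x y : Space) (v : EuclideanSpace ℂ (Fin q)) :
    EuclideanSpace ℂ (Fin q) :=
  WithLp.toLp 2 fun s => ∑ t, τ x y s t * v t

/-- A nonnegative density `ρ` of total mass `m` together with a hermitian, positive semidefinite
kernel `τ` that it dominates: `|τ(x, y)| ≤ √ρ(x) √ρ(y)`. -/
structure IsMeanField (ρ : Space → ℝ) (τ : SpinKernel q) (m : ℝ) : Prop where
  nonneg : ∀ x, 0 ≤ ρ x
  integrable : Integrable ρ
  integral_eq : ∫ x, ρ x = m
  meas : ∀ s t, AEStronglyMeasurable (fun z : Space × Space => τ z.1 z.2 s t) volume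
  conj_symm : ∀ x y s t, conj (τ x y s t) = τ y x t s
  bound : ∀ᵐ z : Space × Space, ∀ v,
    ‖kernelApply τ z.1 z.2 v‖ ≤ √(ρ z.1) * √(ρ z.2) * ‖v‖
  pos : ∀ g : Hilb q, 0 ≤ (∫ z : Space × Space, ⟪g z.1, kernelApply τ z.1 z.2 (g z.2)⟫).re

/-- The direct potential `ρ * V`. -/
noncomputable def hartree (ρ : Space → ℝ) (x : Space) : ℝ := ∫ y : Space, ρ y * coulomb (x - y)

/-- The direct energy `∫∫ ρ(y) V(x - y) |ψ(x)|² dx dy`. -/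
noncomputable def directForm (ρ : Space → ℝ) (ψ : Hilb q) : ℝ :=
  ∫ z : Space × Space, ρ z.2 * (coulomb (z.1 - z.2) * ‖ψ z.1‖ ^ 2)

/-- The exchange energy `∫∫ V(x - y) ⟨χ(x), τ(x, y) ψ(y)⟩ dx dy`. -/
noncomputable def exchangeForm (τ : SpinKernel q) (χ ψ : Hilb q) : ℂ :=
  ∫ z : Space × Space, (coulomb (z.1 - z.2) : ℂ) * ⟪χ z.1, kernelApply τ z.1 z.2 (ψ z.2)⟫

theorem inner_kernelApply (τ : SpinKernel q) (x y : Space) (u v : EuclideanSpace ℂ (Fin q)) :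
    ⟪u, kernelApply τ x y v⟫ = ∑ s, ∑ t, conj (u s) * τ x y s t * v t := by
  simp only [kernelApply, PiLp.inner_apply, RCLike.inner_apply, Finset.sum_mul]
  refine Finset.sum_congr rfl fun s _ => Finset.sum_congr rfl fun t _ => ?_
  ring

namespace IsMeanField

variable {ρ : Space → ℝ} {τ : SpinKernel q} {m : ℝ}

theorem mass_nonneg (h : IsMeanField ρ τ m) : 0 ≤ m :=
  h.integral_eq ▸ integral_nonneg h.nonneg

theorem integrable_direct (h : IsMeanField ρ τ m) (ψ : sobolevOne q) :
    Integrable fun z : Space × Space => ρ z.2 * (coulomb (z.1 - z.2) * ‖(ψ : Hilb q) z.1‖ ^ 2) :=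
  (integrable_density_mul h.nonneg h.integrable (w := coulomb)
    measurable_coulomb coulomb_nonneg (ψ : Hilb q) (integrable_coulomb ψ)).1

theorem integrable_direct_sq (h : IsMeanField ρ τ m) (ψ : sobolevOne q) :
    Integrable (fun z : Space × Space =>
      ρ z.2 * (coulomb (z.1 - z.2) ^ 2 * ‖(ψ : Hilb q) z.1‖ ^ 2)) ∧
    ∫ z : Space × Space, ρ z.2 * (coulomb (z.1 - z.2) ^ 2 * ‖(ψ : Hilb q) z.1‖ ^ 2) ≤
      m * (16 * ‖grad q ψ‖ ^ 2) := by
  have := integrable_density_mul h.nonneg h.integrable (w := fun x => coulomb x ^ 2)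
    (measurable_coulomb.pow_const 2) (fun _ => sq_nonneg _) (ψ : Hilb q) (integrable_coulomb_sq ψ)
  rwa [h.integral_eq] at this

theorem directForm_le (h : IsMeanField ρ τ m) (ψ : sobolevOne q) :
    directForm ρ (ψ : Hilb q) ≤ m * (2 * ‖ψ‖ * ‖grad q ψ‖) := by
  have := (integrable_density_mul h.nonneg h.integrable (w := coulomb)
    measurable_coulomb coulomb_nonneg (ψ : Hilb q) (integrable_coulomb ψ)).2
  rwa [h.integral_eq] at this

theorem aestronglyMeasurable_hartree (hρ : Integrable ρ) :
    AEStronglyMeasurable (hartree ρ) volume := by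
  have : AEStronglyMeasurable (fun z : Space × Space => ρ z.2 * coulomb (z.1 - z.2))
      ((volume : Measure Space).prod volume) :=
    hρ.aestronglyMeasurable.comp_snd.mul measurable_coulomb_sub.aestronglyMeasurable
  exact this.integral_prod_right'

theorem memLp_two_of_sq {E : Type*} [NormedAddCommGroup E] {f : Space → E}
    (hm : AEStronglyMeasurable f volume) {g : Space → ℝ} (hg : Integrable g)
    (h : ∀ᵐ x, ‖f x‖ ^ 2 ≤ g x) : MemLp f 2 volume := by
  rw [memLp_two_iff_integrable_sq_norm hm]
  refine Integrable.mono' hg (hm.norm.pow 2) ?_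
  filter_upwards [h] with x hx
  rwa [Real.norm_of_nonneg (sq_nonneg _)]

theorem norm_toLp_sq_le {f : Space → EuclideanSpace ℂ (Fin q)} (hf : MemLp f 2 volume)
    {g : Space → ℝ} (hg : Integrable g) (h : ∀ᵐ x, ‖f x‖ ^ 2 ≤ g x) :
    ‖hf.toLp f‖ ^ 2 ≤ ∫ x, g x := by
  rw [← integral_norm_sq]
  refine integral_mono_ae (integrable_norm_sq _) hg ?_
  filter_upwards [h, hf.coeFn_toLp] with x hx hx2
  simp only [hx2, hx]

theorem sqrt_memLp (h : IsMeanField ρ τ m) : MemLp (fun y => √(ρ y)) 2 volume := by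
  refine memLp_two_of_sq
    (Real.continuous_sqrt.comp_aestronglyMeasurable h.integrable.aestronglyMeasurable)
    h.integrable (Eventually.of_forall fun x => ?_)
  rw [Real.norm_eq_abs, sq_abs, Real.sq_sqrt (h.nonneg x)]

/-- `U² ≤ m (ρ * V²)` by the Cauchy-Schwarz inequality, which makes Hardy's inequality applicable. -/
theorem hartree_sq_le (h : IsMeanField ρ τ m) (ψ : sobolevOne q) :
    ∀ᵐ x, ‖mulFun (hartree ρ) (ψ : Hilb q) x‖ ^ 2 ≤
      m * ∫ y, ρ y * (coulomb (x - y) ^ 2 * ‖(ψ : Hilb q) x‖ ^ 2) := by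
  have hint := (h.integrable_direct_sq ψ).1
  filter_upwards [Integrable.prod_right_ae hint] with x hx
  have h1 : mulFun (hartree ρ) (ψ : Hilb q) x = (hartree ρ x : ℂ) • (ψ : Hilb q) x := rfl
  have h2 : ‖mulFun (hartree ρ) (ψ : Hilb q) x‖ ^ 2 =
      (∫ y, √(ρ y) * (√(ρ y) * coulomb (x - y) * ‖(ψ : Hilb q) x‖)) ^ 2 := by
    rw [h1, norm_smul, Complex.norm_real, mul_pow, Real.norm_eq_abs, sq_abs, ← mul_pow, hartree,
      ← integral_mul_const]
    congr 1
    refine integral_congr_ae (Eventually.of_forall fun y => ?_)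
    simp only
    rw [← mul_assoc, ← mul_assoc, Real.mul_self_sqrt (h.nonneg y)]
  have h3 : ∀ y, (√(ρ y) * coulomb (x - y) * ‖(ψ : Hilb q) x‖) ^ 2 =
      ρ y * (coulomb (x - y) ^ 2 * ‖(ψ : Hilb q) x‖ ^ 2) := by
    intro y
    rw [mul_pow, mul_pow, Real.sq_sqrt (h.nonneg y), mul_assoc]
  have h4 : MemLp (fun y => √(ρ y) * coulomb (x - y) * ‖(ψ : Hilb q) x‖) 2 volume := by
    refine memLp_two_of_sq ?_ hx (Eventually.of_forall fun y => ?_)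
    · exact (h.sqrt_memLp.aestronglyMeasurable.mul (measurable_coulomb.comp
        (measurable_const.sub measurable_id)).aestronglyMeasurable).mul_const _
    · rw [Real.norm_eq_abs, sq_abs, h3]
  rw [h2]
  refine (sq_integral_mul_le h.sqrt_memLp h4).trans (le_of_eq ?_)
  simp only [h3, Real.sq_sqrt (h.nonneg _), h.integral_eq]

theorem mem_mulDomain_hartree (h : IsMeanField ρ τ m) (ψ : sobolevOne q) :
    (ψ : Hilb q) ∈ mulDomain q (hartree ρ) := by
  have hint := (h.integrable_direct_sq ψ).1
  refine mem_mulDomain.2 (memLp_two_of_sq ?_ (hint.integral_prod_left.const_mul m)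
    (h.hartree_sq_le ψ))
  exact (Complex.continuous_ofReal.comp_aestronglyMeasurable
    (aestronglyMeasurable_hartree h.integrable)).smul (Lp.aestronglyMeasurable _)

theorem norm_hartree_le (h : IsMeanField ρ τ m) (ψ : sobolevOne q) :
    ‖mulOp q (hartree ρ) ⟨ψ, h.mem_mulDomain_hartree ψ⟩‖ ≤ 4 * m * ‖grad q ψ‖ := by
  have hint := h.integrable_direct_sq ψ
  have h1 := norm_toLp_sq_le (mem_mulDomain.1 (h.mem_mulDomain_hartree ψ))
    (hint.1.integral_prod_left.const_mul m) (h.hartree_sq_le ψ)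
  rw [integral_const_mul, ← integral_prod _ hint.1] at h1
  have h2 := h1.trans (mul_le_mul_of_nonneg_left hint.2 h.mass_nonneg)
  refine abs_le_of_sq_le_sq' (h2.trans (le_of_eq (by ring))) ?_ |>.2
  have := h.mass_nonneg
  positivity

theorem inner_hartree (h : IsMeanField ρ τ m) (ψ : sobolevOne q) :
    ⟪(ψ : Hilb q), mulOp q (hartree ρ) ⟨ψ, h.mem_mulDomain_hartree ψ⟩⟫ =
      (directForm ρ (ψ : Hilb q) : ℂ) := by
  have h1 : ∀ᵐ x, ⟪(ψ : Hilb q) x, (mulOp q (hartree ρ) ⟨ψ, h.mem_mulDomain_hartree ψ⟩ : Hilb q) x⟫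
      = ((∫ y, ρ y * (coulomb (x - y) * ‖(ψ : Hilb q) x‖ ^ 2) : ℝ) : ℂ) := by
    filter_upwards [(mem_mulDomain.1 (h.mem_mulDomain_hartree ψ)).coeFn_toLp] with x hx
    have e : (mulOp q (hartree ρ) ⟨ψ, h.mem_mulDomain_hartree ψ⟩ : Hilb q) x =
      mulFun (hartree ρ) (ψ : Hilb q) x := hx
    have e2 : ∫ y, ρ y * (coulomb (x - y) * ‖(ψ : Hilb q) x‖ ^ 2) =
        hartree ρ x * ‖(ψ : Hilb q) x‖ ^ 2 := by
      rw [hartree, ← integral_mul_const]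
      simp only [mul_assoc]
    rw [e, e2, mulFun, inner_smul_right, inner_self_eq_norm_sq_to_K]
    push_cast
    rfl
  rw [L2.inner_def, integral_congr_ae h1, integral_complex_ofReal, directForm]
  congr 1
  exact (integral_prod _ (h.integrable_direct ψ)).symm

end IsMeanField

end MeanField

section Exchange

variable {q : ℕ}

local notation "⟪" x ", " y "⟫" => inner ℂ x y

theorem kernelApply_smul (τ : SpinKernel q) (x y : Space) (c : ℂ) (v : EuclideanSpace ℂ (Fin q)) :
    kernelApply τ x y (c • v) = c • kernelApply τ x y v := by
  ext s
  simp only [kernelApply, PiLp.smul_apply, smul_eq_mul, Finset.mul_sum]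
  exact Finset.sum_congr rfl fun t _ => by ring

namespace IsMeanField

variable {ρ : Space → ℝ} {τ : SpinKernel q} {m : ℝ}

theorem aestronglyMeasurable_kernelApply (h : IsMeanField ρ τ m)
    {f : Space × Space → EuclideanSpace ℂ (Fin q)} (hf : AEStronglyMeasurable f volume) :
    AEStronglyMeasurable (fun z : Space × Space => kernelApply τ z.1 z.2 (f z)) volume := by
  have h1 : ∀ s, AEStronglyMeasurable (fun z : Space × Space => ∑ t, τ z.1 z.2 s t * f z t)
      volume := by
    intro s
    refine Finset.aestronglyMeasurable_fun_sum _ fun t _ => (h.meas s t).mul ?_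
    exact (EuclideanSpace.proj (𝕜 := ℂ) t).continuous.comp_aestronglyMeasurable hf
  have h2 : AEStronglyMeasurable (fun z : Space × Space => fun s => ∑ t, τ z.1 z.2 s t * f z t)
      volume := (aemeasurable_pi_iff.2 fun s => (h1 s).aemeasurable).aestronglyMeasurable
  exact (PiLp.continuous_toLp 2 _).comp_aestronglyMeasurable h2

theorem aestronglyMeasurable_snd (ψ : Hilb q) :
    AEStronglyMeasurable (fun z : Space × Space => ψ z.2) volume :=
  ((Lp.stronglyMeasurable ψ).comp_measurable measurable_snd).aestronglyMeasurable

theorem aestronglyMeasurable_fst (ψ : Hilb q) :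
    AEStronglyMeasurable (fun z : Space × Space => ψ z.1) volume :=
  ((Lp.stronglyMeasurable ψ).comp_measurable measurable_fst).aestronglyMeasurable

theorem aestronglyMeasurable_exchange (h : IsMeanField ρ τ m) (ψ : Hilb q) :
    AEStronglyMeasurable (fun z : Space × Space =>
      (coulomb (z.1 - z.2) : ℂ) • kernelApply τ z.1 z.2 (ψ z.2)) volume :=
  AEStronglyMeasurable.smul
    (Complex.measurable_ofReal.comp measurable_coulomb_sub).aestronglyMeasurable
    (h.aestronglyMeasurable_kernelApply (aestronglyMeasurable_snd ψ))

theorem norm_exchange_le (h : IsMeanField ρ τ m) (ψ : Hilb q) :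
    ∀ᵐ z : Space × Space, ‖(coulomb (z.1 - z.2) : ℂ) • kernelApply τ z.1 z.2 (ψ z.2)‖ ≤
      √(ρ z.1) * (√(ρ z.2) * (coulomb (z.2 - z.1) * ‖ψ z.2‖)) := by
  filter_upwards [h.bound] with z hz
  rw [norm_smul, Complex.norm_real, Real.norm_of_nonneg (coulomb_nonneg _), coulomb_sub_comm z.1]
  refine (mul_le_mul_of_nonneg_left (hz _) (coulomb_nonneg _)).trans (le_of_eq ?_)
  ring

theorem memLp_coulomb_mul (ψ : sobolevOne q) (x : Space) :
    MemLp (fun y => coulomb (y - x) * ‖(ψ : Hilb q) y‖) 2 volume := by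
  refine memLp_two_of_sq ?_ (integrable_coulomb_sq ψ x).1 (Eventually.of_forall fun y => ?_)
  · exact ((measurable_coulomb_sub_const x).mul
      (Lp.stronglyMeasurable _).measurable.norm).aestronglyMeasurable
  · rw [Real.norm_eq_abs, sq_abs, mul_pow]

theorem integral_sqrt_mul_le (h : IsMeanField ρ τ m) (ψ : sobolevOne q) (x : Space) :
    (∫ y, √(ρ y) * (coulomb (y - x) * ‖(ψ : Hilb q) y‖)) ^ 2 ≤ m * (16 * ‖grad q ψ‖ ^ 2) := by
  refine (sq_integral_mul_le h.sqrt_memLp (memLp_coulomb_mul ψ x)).trans ?_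
  simp only [Real.sq_sqrt (h.nonneg _), h.integral_eq, mul_pow]
  exact mul_le_mul_of_nonneg_left (integrable_coulomb_sq ψ x).2 h.mass_nonneg

theorem integrable_exchange_section (h : IsMeanField ρ τ m) (ψ : sobolevOne q) :
    ∀ᵐ x : Space, Integrable fun y : Space =>
      (coulomb (x - y) : ℂ) • kernelApply τ x y ((ψ : Hilb q) y) := by
  have h1 := h.aestronglyMeasurable_exchange (ψ : Hilb q)
  filter_upwards [h1.prodMk_left, Measure.ae_ae_of_ae_prod (h.norm_exchange_le (ψ : Hilb q))]
    with x hx1 hx2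
  have h2 : Integrable fun y => √(ρ y) * (coulomb (y - x) * ‖(ψ : Hilb q) y‖) :=
    h.sqrt_memLp.integrable_mul (memLp_coulomb_mul ψ x)
  exact Integrable.mono' (h2.const_mul √(ρ x)) hx1 hx2

theorem exchangeFun_eq (h : IsMeanField ρ τ m) (ψ : sobolevOne q) :
    ∀ᵐ x : Space, exchangeFun τ (ψ : Hilb q) x =
      ∫ y, (coulomb (x - y) : ℂ) • kernelApply τ x y ((ψ : Hilb q) y) := by
  filter_upwards [h.integrable_exchange_section ψ] with x hx
  ext s
  have := (EuclideanSpace.proj s : EuclideanSpace ℂ (Fin q) →L[ℂ] ℂ).integral_comp_comm hx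
  exact this

theorem exchangeConverges (h : IsMeanField ρ τ m) (ψ : sobolevOne q) :
    ExchangeConverges τ (ψ : Hilb q) := by
  filter_upwards [h.integrable_exchange_section ψ] with x hx s
  exact (EuclideanSpace.proj s : EuclideanSpace ℂ (Fin q) →L[ℂ] ℂ).integrable_comp hx

/-- `|K ψ (x)|² ≤ ρ(x) ‖√ρ‖² ∫ V(x - y)² |ψ(y)|² dy`, by `|τ(x, y)| ≤ √ρ(x) √ρ(y)` and the
Cauchy-Schwarz inequality, followed by Hardy's inequality. -/
theorem norm_exchangeFun_sq_le (h : IsMeanField ρ τ m) (ψ : sobolevOne q) :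
    ∀ᵐ x : Space, ‖exchangeFun τ (ψ : Hilb q) x‖ ^ 2 ≤ ρ x * (m * (16 * ‖grad q ψ‖ ^ 2)) := by
  filter_upwards [h.exchangeFun_eq ψ, h.integrable_exchange_section ψ,
    Measure.ae_ae_of_ae_prod (h.norm_exchange_le (ψ : Hilb q))] with x hx1 hx2 hx3
  have h2 : Integrable fun y => √(ρ y) * (coulomb (y - x) * ‖(ψ : Hilb q) y‖) :=
    h.sqrt_memLp.integrable_mul (memLp_coulomb_mul ψ x)
  have h3 : ‖exchangeFun τ (ψ : Hilb q) x‖ ≤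
      √(ρ x) * ∫ y, √(ρ y) * (coulomb (y - x) * ‖(ψ : Hilb q) y‖) := by
    rw [hx1, ← integral_const_mul]
    exact (norm_integral_le_integral_norm _).trans
      (integral_mono_ae hx2.norm (h2.const_mul _) hx3)
  refine (pow_le_pow_left₀ (norm_nonneg _) h3 2).trans ?_
  rw [mul_pow, Real.sq_sqrt (h.nonneg x)]
  exact mul_le_mul_of_nonneg_left (h.integral_sqrt_mul_le ψ x) (h.nonneg x)

theorem mem_exchangeDomain (h : IsMeanField ρ τ m) (ψ : sobolevOne q) :
    (ψ : Hilb q) ∈ exchangeDomain τ := by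
  refine HartreeFock.mem_exchangeDomain.2 ⟨h.exchangeConverges ψ, ?_⟩
  refine memLp_two_of_sq ?_ (h.integrable.mul_const _) (h.norm_exchangeFun_sq_le ψ)
  have h1 : AEStronglyMeasurable (fun z : Space × Space =>
      (coulomb (z.1 - z.2) : ℂ) • kernelApply τ z.1 z.2 ((ψ : Hilb q) z.2))
      ((volume : Measure Space).prod volume) := h.aestronglyMeasurable_exchange _
  exact h1.integral_prod_right'.congr ((h.exchangeFun_eq ψ).mono fun _ hx => hx.symm)

theorem norm_exchangeOp_le (h : IsMeanField ρ τ m) (ψ : sobolevOne q) :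
    ‖exchangeOp τ ⟨ψ, h.mem_exchangeDomain ψ⟩‖ ≤ 4 * m * ‖grad q ψ‖ := by
  have h1 := norm_toLp_sq_le (HartreeFock.mem_exchangeDomain.1 (h.mem_exchangeDomain ψ)).2
    (h.integrable.mul_const _) (h.norm_exchangeFun_sq_le ψ)
  rw [integral_mul_const, h.integral_eq] at h1
  refine abs_le_of_sq_le_sq' (h1.trans (le_of_eq (by ring))) ?_ |>.2
  have := h.mass_nonneg
  positivity

theorem norm_exchangeDensity_le (h : IsMeanField ρ τ m) (χ ψ : Hilb q) :
    ∀ᵐ z : Space × Space,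
      ‖(coulomb (z.1 - z.2) : ℂ) * ⟪χ z.1, kernelApply τ z.1 z.2 (ψ z.2)⟫‖ ≤
        1 / 2 * (ρ z.2 * (coulomb (z.1 - z.2) * ‖χ z.1‖ ^ 2) +
          ρ z.1 * (coulomb (z.2 - z.1) * ‖ψ z.2‖ ^ 2)) := by
  filter_upwards [h.bound] with z hz
  rw [norm_mul, Complex.norm_real, Real.norm_of_nonneg (coulomb_nonneg _), coulomb_sub_comm z.2]
  have h1 : ‖⟪χ z.1, kernelApply τ z.1 z.2 (ψ z.2)⟫‖ ≤
      ‖χ z.1‖ * (√(ρ z.1) * √(ρ z.2) * ‖ψ z.2‖) :=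
    (norm_inner_le_norm _ _).trans (mul_le_mul_of_nonneg_left (hz _) (norm_nonneg _))
  have h2 : ‖χ z.1‖ * (√(ρ z.1) * √(ρ z.2) * ‖ψ z.2‖) ≤
      1 / 2 * (ρ z.2 * ‖χ z.1‖ ^ 2 + ρ z.1 * ‖ψ z.2‖ ^ 2) := by
    have e1 := Real.sq_sqrt (h.nonneg z.1)
    have e2 := Real.sq_sqrt (h.nonneg z.2)
    have e3 := sq_nonneg (√(ρ z.2) * ‖χ z.1‖ - √(ρ z.1) * ‖ψ z.2‖)
    rw [sub_sq, mul_pow, mul_pow, e1, e2] at e3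
    linarith
  refine (mul_le_mul_of_nonneg_left (h1.trans h2) (coulomb_nonneg _)).trans (le_of_eq ?_)
  ring

theorem integrable_exchangeDensity (h : IsMeanField ρ τ m) (χ ψ : sobolevOne q) :
    Integrable fun z : Space × Space =>
      (coulomb (z.1 - z.2) : ℂ) * ⟪(χ : Hilb q) z.1, kernelApply τ z.1 z.2 ((ψ : Hilb q) z.2)⟫ := by
  refine Integrable.mono' (((h.integrable_direct χ).add (h.integrable_direct ψ).swap).const_mul
    (1 / 2)) ?_ (h.norm_exchangeDensity_le (χ : Hilb q) (ψ : Hilb q))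
  refine AEStronglyMeasurable.mul
    (Complex.measurable_ofReal.comp measurable_coulomb_sub).aestronglyMeasurable ?_
  exact (aestronglyMeasurable_fst _).inner
    (h.aestronglyMeasurable_kernelApply (aestronglyMeasurable_snd _))

theorem inner_exchangeOp (h : IsMeanField ρ τ m) (χ ψ : sobolevOne q) :
    ⟪(χ : Hilb q), exchangeOp τ ⟨ψ, h.mem_exchangeDomain ψ⟩⟫ =
      exchangeForm τ (χ : Hilb q) (ψ : Hilb q) := by
  rw [L2.inner_def, exchangeForm]
  have h2 := integral_prod _ (h.integrable_exchangeDensity χ ψ)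
  refine Eq.trans (integral_congr_ae ?_) h2.symm
  filter_upwards [(HartreeFock.mem_exchangeDomain.1 (h.mem_exchangeDomain ψ)).2.coeFn_toLp,
    h.exchangeFun_eq ψ, h.integrable_exchange_section ψ] with x hx1 hx2 hx3
  have e : (exchangeOp τ ⟨ψ, h.mem_exchangeDomain ψ⟩ : Hilb q) x =
      exchangeFun τ (ψ : Hilb q) x := hx1
  rw [e, hx2, ← integral_inner hx3]
  simp only [inner_smul_right]

theorem conj_inner_kernelApply (h : IsMeanField ρ τ m) (x y : Space)
    (u v : EuclideanSpace ℂ (Fin q)) :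
    conj ⟪u, kernelApply τ x y v⟫ = ⟪v, kernelApply τ y x u⟫ := by
  rw [inner_kernelApply, inner_kernelApply, map_sum]
  simp only [map_sum, map_mul, Complex.conj_conj, h.conj_symm]
  rw [Finset.sum_comm]
  refine Finset.sum_congr rfl fun s _ => Finset.sum_congr rfl fun t _ => ?_
  ring

theorem conj_exchangeForm (h : IsMeanField ρ τ m) (χ ψ : Hilb q) :
    conj (exchangeForm τ χ ψ) = exchangeForm τ ψ χ := by
  have e := integral_prod_swap (μ := (volume : Measure Space)) (ν := (volume : Measure Space))
    (fun z : Space × Space => (coulomb (z.1 - z.2) : ℂ) * ⟪ψ z.1, kernelApply τ z.1 z.2 (χ z.2)⟫)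
  rw [exchangeForm, ← integral_conj, exchangeForm]
  refine Eq.trans ?_ e
  refine integral_congr_ae (Eventually.of_forall fun z => ?_)
  simp only [map_mul, Complex.conj_ofReal, h.conj_inner_kernelApply, Prod.fst_swap, Prod.snd_swap]
  rw [coulomb_sub_comm]

/-- `K ≤ U`: `√ρ(x) √ρ(y) |ψ(x)| |ψ(y)|` is at most the mean of `ρ(y) |ψ(x)|²` and `ρ(x) |ψ(y)|²`. -/
theorem exchangeForm_re_le (h : IsMeanField ρ τ m) (ψ : sobolevOne q) :
    (exchangeForm τ (ψ : Hilb q) (ψ : Hilb q)).re ≤ directForm ρ (ψ : Hilb q) := by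
  have h1 := h.integrable_direct ψ
  refine (Complex.re_le_norm _).trans ((norm_integral_le_integral_norm _).trans ?_)
  refine (integral_mono_ae (h.integrable_exchangeDensity ψ ψ).norm
    ((h1.add h1.swap).const_mul (1 / 2)) (h.norm_exchangeDensity_le _ _)).trans (le_of_eq ?_)
  rw [integral_const_mul, directForm]
  have e := integral_prod_swap (μ := (volume : Measure Space)) (ν := (volume : Measure Space))
    (fun z : Space × Space => ρ z.2 * (coulomb (z.1 - z.2) * ‖(ψ : Hilb q) z.1‖ ^ 2))
  have e2 := integral_add (μ := (volume : Measure Space).prod volume) h1 h1.swap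
  refine (congrArg _ (e2.trans (congrArg _ e))).trans ?_
  simp only [Measure.volume_eq_prod]
  ring

/-- `0 ≤ K`: the kernel `τ`, hence `conj ψ(x) τ(x, y) ψ(y)`, is positive semidefinite, and so is its
product with the Coulomb potential. -/
theorem exchangeForm_re_nonneg (h : IsMeanField ρ τ m) (ψ : sobolevOne q) :
    0 ≤ (exchangeForm τ (ψ : Hilb q) (ψ : Hilb q)).re := by
  let κ : Space × Space → ℝ := fun z =>
    (⟪(ψ : Hilb q) z.1, kernelApply τ z.1 z.2 ((ψ : Hilb q) z.2)⟫).re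
  have hκm : AEStronglyMeasurable (fun z : Space × Space =>
      ⟪(ψ : Hilb q) z.1, kernelApply τ z.1 z.2 ((ψ : Hilb q) z.2)⟫) volume :=
    (aestronglyMeasurable_fst _).inner
      (h.aestronglyMeasurable_kernelApply (aestronglyMeasurable_snd _))
  have hf : Integrable fun x => √(ρ x) * ‖(ψ : Hilb q) x‖ :=
    h.sqrt_memLp.integrable_mul (Lp.memLp (ψ : Hilb q)).norm
  have hκc : Integrable (fun z : Space × Space =>
      ⟪(ψ : Hilb q) z.1, kernelApply τ z.1 z.2 ((ψ : Hilb q) z.2)⟫) := by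
    refine Integrable.mono' (hf.mul_prod hf) hκm ?_
    filter_upwards [h.bound] with z hz
    refine (norm_inner_le_norm _ _).trans
      ((mul_le_mul_of_nonneg_left (hz _) (norm_nonneg _)).trans (le_of_eq ?_))
    ring
  have hint := h.integrable_exchangeDensity ψ ψ
  have e : (exchangeForm τ (ψ : Hilb q) (ψ : Hilb q)).re =
      ∫ z : Space × Space, coulomb (z.1 - z.2) * κ z := by
    rw [exchangeForm]
    refine (integral_re hint).symm.trans (integral_congr_ae (Eventually.of_forall fun z => ?_))
    simp only [κ, RCLike.re_eq_complex_re, Complex.re_ofReal_mul]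
  rw [e]
  refine integral_coulomb_mul_nonneg hκc.re ?_ ?_
  · refine hint.re.congr (Eventually.of_forall fun z => ?_)
    simp only [κ, RCLike.re_eq_complex_re, Complex.re_ofReal_mul]
  · rintro b hb ⟨C, hC⟩
    have hg : MemLp (mulFun b (ψ : Hilb q)) 2 volume := by
      refine MemLp.of_le_mul (c := C) (Lp.memLp (ψ : Hilb q)) ?_ (Eventually.of_forall fun x => ?_)
      · exact (Complex.continuous_ofReal.comp hb).aestronglyMeasurable.smul
          (Lp.aestronglyMeasurable _)
      · rw [mulFun, norm_smul, Complex.norm_real]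
        exact mul_le_mul_of_nonneg_right (hC x) (norm_nonneg _)
    refine (h.pos (hg.toLp _)).trans (le_of_eq ?_)
    have h1 : ∀ᵐ z : Space × Space, ⟪(hg.toLp _ : Hilb q) z.1,
        kernelApply τ z.1 z.2 ((hg.toLp _ : Hilb q) z.2)⟫ = ((b z.1 * b z.2 : ℝ) : ℂ) *
          ⟪(ψ : Hilb q) z.1, kernelApply τ z.1 z.2 ((ψ : Hilb q) z.2)⟫ := by
      have a1 := Measure.quasiMeasurePreserving_fst (μ := (volume : Measure Space))
        (ν := (volume : Measure Space)) |>.ae hg.coeFn_toLp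
      have a2 := Measure.quasiMeasurePreserving_snd (μ := (volume : Measure Space))
        (ν := (volume : Measure Space)) |>.ae hg.coeFn_toLp
      filter_upwards [a1, a2] with z hz1 hz2
      rw [hz1, hz2, mulFun, mulFun, kernelApply_smul, inner_smul_left, inner_smul_right]
      push_cast
      rw [Complex.conj_ofReal]
      ring
    rw [integral_congr_ae h1]
    have hint2 : Integrable fun z : Space × Space => ((b z.1 * b z.2 : ℝ) : ℂ) *
        ⟪(ψ : Hilb q) z.1, kernelApply τ z.1 z.2 ((ψ : Hilb q) z.2)⟫ := by
      refine hκc.bdd_mul (c := C * C) ?_ (Eventually.of_forall fun z => ?_)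
      · exact (by fun_prop : Continuous fun z : Space × Space =>
          ((b z.1 * b z.2 : ℝ) : ℂ)).aestronglyMeasurable
      · rw [Complex.norm_real, norm_mul]
        exact mul_le_mul (hC _) (hC _) (norm_nonneg _) ((abs_nonneg _).trans (hC z.1))
    refine (integral_re hint2).symm.trans (integral_congr_ae (Eventually.of_forall fun z => ?_))
    simp only [κ, RCLike.re_eq_complex_re, Complex.re_ofReal_mul]

end IsMeanField

end Exchange

/-! ### Quadratic forms of the Schrödinger and the Fock operator -/

section FockForm

variable {q : ℕ}

local notation "⟪" x ", " y "⟫" => inner ℂ x y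

/-- The restriction to `H¹` of an operator whose domain contains `H¹`. -/
noncomputable def restrictH1 (A : Hilb q →ₗ.[ℂ] Hilb q) (h : sobolevOne q ≤ A.domain) :
    sobolevOne q →ₗ[ℂ] Hilb q :=
  A.toFun ∘ₗ Submodule.inclusion h

theorem mulOp_symm (w : Space → ℝ) {χ ψ : Hilb q} (hχ : χ ∈ mulDomain q w)
    (hψ : ψ ∈ mulDomain q w) : ⟪mulOp q w ⟨χ, hχ⟩, ψ⟫ = ⟪χ, mulOp q w ⟨ψ, hψ⟩⟫ := by
  rw [L2.inner_def, L2.inner_def]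
  refine integral_congr_ae ?_
  filter_upwards [(mem_mulDomain.1 hχ).coeFn_toLp, (mem_mulDomain.1 hψ).coeFn_toLp] with x h1 h2
  have e1 : (mulOp q w ⟨χ, hχ⟩ : Hilb q) x = mulFun w χ x := h1
  have e2 : (mulOp q w ⟨ψ, hψ⟩ : Hilb q) x = mulFun w ψ x := h2
  rw [e1, e2, mulFun, mulFun, inner_smul_left, inner_smul_right, Complex.conj_ofReal]

theorem coulomb_sq_le (ψ : Hilb q) :
    ∀ᵐ x, ‖mulFun coulomb ψ x‖ ^ 2 ≤ coulomb (x - 0) ^ 2 * ‖ψ x‖ ^ 2 := by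
  refine Eventually.of_forall fun x => le_of_eq ?_
  rw [mulFun, norm_smul, mul_pow, Complex.norm_real, Real.norm_eq_abs, sq_abs, sub_zero]

theorem mem_mulDomain_coulomb (ψ : sobolevOne q) : (ψ : Hilb q) ∈ mulDomain q coulomb := by
  refine mem_mulDomain.2 (IsMeanField.memLp_two_of_sq ?_ (integrable_coulomb_sq ψ 0).1
    (coulomb_sq_le _))
  exact (Complex.measurable_ofReal.comp measurable_coulomb).aestronglyMeasurable.smul
    (Lp.aestronglyMeasurable _)

theorem norm_coulomb_le (ψ : sobolevOne q) :
    ‖mulOp q coulomb ⟨ψ, mem_mulDomain_coulomb ψ⟩‖ ≤ 4 * ‖grad q ψ‖ := by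
  have h1 := IsMeanField.norm_toLp_sq_le (mem_mulDomain.1 (mem_mulDomain_coulomb ψ))
    (integrable_coulomb_sq ψ 0).1 (coulomb_sq_le _)
  refine abs_le_of_sq_le_sq' ((h1.trans (integrable_coulomb_sq ψ 0).2).trans
    (le_of_eq (by ring))) (by positivity) |>.2

theorem inner_coulomb (ψ : sobolevOne q) :
    ⟪(ψ : Hilb q), mulOp q coulomb ⟨ψ, mem_mulDomain_coulomb ψ⟩⟫ =
      ((∫ x, coulomb x * ‖(ψ : Hilb q) x‖ ^ 2 : ℝ) : ℂ) := by
  rw [L2.inner_def, ← integral_complex_ofReal]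
  refine integral_congr_ae ?_
  filter_upwards [(mem_mulDomain.1 (mem_mulDomain_coulomb ψ)).coeFn_toLp] with x hx
  have e : (mulOp q coulomb ⟨ψ, mem_mulDomain_coulomb ψ⟩ : Hilb q) x =
    mulFun coulomb (ψ : Hilb q) x := hx
  rw [e, mulFun, inner_smul_right, inner_self_eq_norm_sq_to_K]
  push_cast
  rfl

theorem integral_coulomb_le (ψ : sobolevOne q) :
    ∫ x, coulomb x * ‖(ψ : Hilb q) x‖ ^ 2 ≤ 2 * ‖ψ‖ * ‖grad q ψ‖ := by
  simpa using (integrable_coulomb ψ 0).2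

/-- Operators `-Δ + B` with domain `H²`, for a symmetric `B` bounded by the gradient. -/
theorem isFormPerturbation_of_domain_eq {A : Hilb q →ₗ.[ℂ] Hilb q}
    {B : sobolevOne q →ₗ[ℂ] Hilb q} {C : ℝ} (hdom : A.domain = sobolevTwo q)
    (happ : ∀ (ψ : A.domain) (h : (ψ : Hilb q) ∈ sobolevTwo q),
      A ψ = negLaplacianMap q ⟨ψ, h⟩ + B ⟨ψ, sobolevTwo_le_sobolevOne h⟩)
    (hsymm : ∀ χ ψ : sobolevOne q, ⟪B χ, (ψ : Hilb q)⟫ = ⟪(χ : Hilb q), B ψ⟫)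
    (hbound : ∀ χ, ‖B χ‖ ≤ C * ‖grad q χ‖) : IsFormPerturbation A (grad q) B C where
  domain_le := hdom.le.trans sobolevTwo_le_sobolevOne
  inner_eq χ ψ := by
    have h : (ψ : Hilb q) ∈ sobolevTwo q := hdom.le ψ.2
    rw [happ ψ h, inner_add_right, inner_negLaplacian]
    rfl
  symm := hsymm
  bound := hbound
  surj c hc f := by
    obtain ⟨⟨u, hu⟩, hψ⟩ := negLaplacian_surj hc f
    have aux : ∀ (ξ : A.domain) (h : (ξ : Hilb q) ∈ sobolevTwo q),
        A ξ - B (Submodule.inclusion (hdom.le.trans sobolevTwo_le_sobolevOne) ξ) =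
          negLaplacianMap q ⟨ξ, h⟩ := by
      intro ξ h
      have e : B (Submodule.inclusion (hdom.le.trans sobolevTwo_le_sobolevOne) ξ) =
        B ⟨ξ, sobolevTwo_le_sobolevOne h⟩ := rfl
      rw [happ ξ h, e, add_sub_cancel_right]
    have hu' : u ∈ A.domain := by rw [hdom]; exact hu
    have h2 := aux ⟨u, hu'⟩ hu
    refine ⟨⟨u, hu'⟩, ?_⟩
    rw [h2]
    exact hψ
  dense ψ ε hε := by
    obtain ⟨f, hf1, hf2⟩ := exists_schwartz_close ψ hε
    exact ⟨⟨schwartzL2 f, hdom.ge (schwartz_mem_sobolevTwo f)⟩, hf1, hf2⟩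

/-- `-V` on `H¹`. -/
noncomputable def nuclearPotential (q : ℕ) : sobolevOne q →ₗ[ℂ] Hilb q :=
  -restrictH1 (mulOp q coulomb) fun ψ hψ => mem_mulDomain_coulomb ⟨ψ, hψ⟩

theorem nuclearPotential_apply (ψ : sobolevOne q) :
    nuclearPotential q ψ = -mulOp q coulomb ⟨ψ, mem_mulDomain_coulomb ψ⟩ := rfl

theorem nuclearPotential_symm (χ ψ : sobolevOne q) :
    ⟪nuclearPotential q χ, (ψ : Hilb q)⟫ = ⟪(χ : Hilb q), nuclearPotential q ψ⟫ := by
  rw [nuclearPotential_apply, nuclearPotential_apply, inner_neg_left, inner_neg_right]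
  rw [mulOp_symm coulomb (mem_mulDomain_coulomb χ) (mem_mulDomain_coulomb ψ)]

theorem norm_nuclearPotential_le (ψ : sobolevOne q) :
    ‖nuclearPotential q ψ‖ ≤ 4 * ‖grad q ψ‖ := by
  rw [nuclearPotential_apply, norm_neg]
  exact norm_coulomb_le ψ

theorem domain_schrodingerOp (q : ℕ) : (schrodingerOp q).domain = sobolevTwo q := by
  change sobolevTwo q ⊓ mulDomain q coulomb = sobolevTwo q
  exact inf_eq_left.2 fun ψ hψ => mem_mulDomain_coulomb ⟨ψ, sobolevTwo_le_sobolevOne hψ⟩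

theorem isFormPerturbation_schrodingerOp (q : ℕ) :
    IsFormPerturbation (schrodingerOp q) (grad q) (nuclearPotential q) 4 := by
  refine isFormPerturbation_of_domain_eq ?_ ?_ nuclearPotential_symm norm_nuclearPotential_le
  · exact domain_schrodingerOp q
  · intro ψ h
    rw [nuclearPotential_apply, ← sub_eq_add_neg]
    rfl

theorem energyForm_nuclearPotential (ψ : sobolevOne q) :
    energyForm (grad q) (nuclearPotential q) ψ =
      ‖grad q ψ‖ ^ 2 - ∫ x, coulomb x * ‖(ψ : Hilb q) x‖ ^ 2 := by
  rw [energyForm, nuclearPotential_apply, inner_neg_right, inner_coulomb, Complex.neg_re,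
    Complex.ofReal_re, sub_eq_add_neg]

/-- The energy bound `t` controls the kinetic energy: `g² - 2 g n ≤ t n²` gives
`g ≤ (1 + √(t + 1)) n`. -/
theorem norm_grad_le {ψ : sobolevOne q} {t : ℝ}
    (ht : energyForm (grad q) (nuclearPotential q) ψ ≤ t * ‖(ψ : Hilb q)‖ ^ 2) :
    ‖grad q ψ‖ ≤ (1 + √(t + 1)) * ‖(ψ : Hilb q)‖ := by
  rw [energyForm_nuclearPotential] at ht
  have h1 := integral_coulomb_le ψ
  have hn : ‖ψ‖ = ‖(ψ : Hilb q)‖ := rfl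
  rw [hn] at h1
  have hn0 : 0 ≤ ‖(ψ : Hilb q)‖ := norm_nonneg _
  have h2 : (‖grad q ψ‖ - ‖(ψ : Hilb q)‖) ^ 2 ≤ (t + 1) * ‖(ψ : Hilb q)‖ ^ 2 := by nlinarith
  have h3 : ‖grad q ψ‖ - ‖(ψ : Hilb q)‖ ≤ √((t + 1) * ‖(ψ : Hilb q)‖ ^ 2) := Real.le_sqrt_of_sq_le h2
  rw [Real.sqrt_mul' _ (sq_nonneg _), Real.sqrt_sq hn0] at h3
  linarith

section

variable {P : Hilb q →L[ℂ] Hilb q} {m : ℝ}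

/-- `-V + Z⁻¹ (U_P - K_P)` on `H¹`. -/
noncomputable def fockPotential (Z : ℝ) (h : IsMeanField (density P) (kernel P) m) :
    sobolevOne q →ₗ[ℂ] Hilb q :=
  nuclearPotential q + ((1 / Z : ℝ) : ℂ) •
    (restrictH1 (mulOp q (directPotential P)) (fun ψ hψ => h.mem_mulDomain_hartree ⟨ψ, hψ⟩) -
      restrictH1 (exchangeOp (kernel P)) fun ψ hψ => h.mem_exchangeDomain ⟨ψ, hψ⟩)

theorem fockPotential_apply (Z : ℝ) (h : IsMeanField (density P) (kernel P) m)
    (ψ : sobolevOne q) : fockPotential Z h ψ = nuclearPotential q ψ + ((1 / Z : ℝ) : ℂ) •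
      (mulOp q (hartree (density P)) ⟨ψ, h.mem_mulDomain_hartree ψ⟩ -
        exchangeOp (kernel P) ⟨ψ, h.mem_exchangeDomain ψ⟩) := rfl

theorem domain_fockOp (Z : ℝ) (h : IsMeanField (density P) (kernel P) m) :
    (fockOp Z P).domain = sobolevTwo q := by
  change (sobolevTwo q ⊓ mulDomain q coulomb) ⊓
    (mulDomain q (directPotential P) ⊓ exchangeDomain (kernel P)) = sobolevTwo q
  refine le_antisymm (inf_le_left.trans inf_le_left) fun ψ hψ => ?_
  have hψ1 := sobolevTwo_le_sobolevOne hψ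
  exact ⟨⟨hψ, mem_mulDomain_coulomb ⟨ψ, hψ1⟩⟩, h.mem_mulDomain_hartree ⟨ψ, hψ1⟩,
    h.mem_exchangeDomain ⟨ψ, hψ1⟩⟩

theorem isFormPerturbation_fockOp (Z : ℝ) (h : IsMeanField (density P) (kernel P) m) :
    IsFormPerturbation (fockOp Z P) (grad q) (fockPotential Z h) (4 + |1 / Z| * (8 * m)) := by
  refine isFormPerturbation_of_domain_eq ?_ ?_ ?_ ?_
  · exact domain_fockOp Z h
  · intro ψ hψ
    rw [fockPotential_apply, nuclearPotential_apply, ← add_assoc, ← sub_eq_add_neg]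
    rfl
  · intro χ ψ
    rw [fockPotential_apply, fockPotential_apply, inner_add_left, inner_add_right,
      nuclearPotential_symm, inner_smul_left, inner_smul_right, Complex.conj_ofReal,
      inner_sub_left, inner_sub_right]
    have h1 := mulOp_symm (hartree (density P)) (h.mem_mulDomain_hartree χ)
      (h.mem_mulDomain_hartree ψ)
    have h2 : ⟪exchangeOp (kernel P) ⟨χ, h.mem_exchangeDomain χ⟩, (ψ : Hilb q)⟫ =
        ⟪(χ : Hilb q), exchangeOp (kernel P) ⟨ψ, h.mem_exchangeDomain ψ⟩⟫ := by
      rw [← inner_conj_symm, h.inner_exchangeOp, h.inner_exchangeOp, h.conj_exchangeForm]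
    rw [h1, h2]
  · intro χ
    rw [fockPotential_apply]
    refine (norm_add_le _ _).trans ?_
    rw [norm_smul, Complex.norm_real, Real.norm_eq_abs]
    have h1 := norm_nuclearPotential_le χ
    have h2 := (norm_sub_le (mulOp q (hartree (density P)) ⟨χ, h.mem_mulDomain_hartree χ⟩)
        (exchangeOp (kernel P) ⟨χ, h.mem_exchangeDomain χ⟩)).trans
      (add_le_add (h.norm_hartree_le χ) (h.norm_exchangeOp_le χ))
    have h3 := mul_le_mul_of_nonneg_left h2 (abs_nonneg (1 / Z))
    linarith

theorem energyForm_fockPotential (Z : ℝ) (h : IsMeanField (density P) (kernel P) m)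
    (ψ : sobolevOne q) : energyForm (grad q) (fockPotential Z h) ψ =
      energyForm (grad q) (nuclearPotential q) ψ + 1 / Z * (directForm (density P) (ψ : Hilb q) -
        (exchangeForm (kernel P) (ψ : Hilb q) (ψ : Hilb q)).re) := by
  rw [energyForm, energyForm, fockPotential_apply, inner_add_right, inner_smul_right,
    inner_sub_right, h.inner_hartree, h.inner_exchangeOp, Complex.add_re, Complex.re_ofReal_mul,
    Complex.sub_re, Complex.ofReal_re, add_assoc]

end

/-- The Fock energy of a mean field exceeds the energy by at most
`Z⁻¹ m (2 + 2 √(t + 1))`, by the uncertainty principle and the bound on the kinetic energy. -/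
theorem IsMeanField.form_le {ρ : Space → ℝ} {τ : SpinKernel q} {m : ℝ} (h : IsMeanField ρ τ m)
    {Z : ℝ} (hZ : 0 < Z) {ψ : sobolevOne q} {t : ℝ}
    (ht : energyForm (grad q) (nuclearPotential q) ψ ≤ t * ‖(ψ : Hilb q)‖ ^ 2) :
    energyForm (grad q) (nuclearPotential q) ψ + 1 / Z * (directForm ρ (ψ : Hilb q) -
      (exchangeForm τ (ψ : Hilb q) (ψ : Hilb q)).re) ≤
      (t + 2 * (m / Z) + 2 * (m / Z) * √(t + 1)) * ‖(ψ : Hilb q)‖ ^ 2 := by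
  have h1 := h.exchangeForm_re_nonneg ψ
  have h2 := h.directForm_le ψ
  have hn : ‖ψ‖ = ‖(ψ : Hilb q)‖ := rfl
  rw [hn] at h2
  have h3 := norm_grad_le ht
  have hm := h.mass_nonneg
  have h4 : m * (2 * ‖(ψ : Hilb q)‖ * ‖grad q ψ‖) ≤
      m * (2 * ‖(ψ : Hilb q)‖ * ((1 + √(t + 1)) * ‖(ψ : Hilb q)‖)) := by gcongr
  have h5 : 1 / Z * (directForm ρ (ψ : Hilb q) -
      (exchangeForm τ (ψ : Hilb q) (ψ : Hilb q)).re) ≤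
      1 / Z * (m * (2 * ‖(ψ : Hilb q)‖ * ((1 + √(t + 1)) * ‖(ψ : Hilb q)‖))) := by
    gcongr
    linarith
  refine (add_le_add ht h5).trans (le_of_eq ?_)
  ring

/-- Passing to the limit `t ↓ a` in an upper bound. -/
theorem le_of_forall_gt_le {a b κ : ℝ}
    (h : ∀ t, a < t → b ≤ t + 2 * κ + 2 * κ * √(t + 1)) : b ≤ a + 2 * κ + 2 * κ * √(a + 1) := by
  have hc : Continuous fun t : ℝ => t + 2 * κ + 2 * κ * √(t + 1) := by fun_prop
  refine ge_of_tendsto ((hc.tendsto a).mono_left (nhdsWithin_le_nhds (s := Set.Ioi a))) ?_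
  filter_upwards [self_mem_nhdsWithin] with t ht
  exact h t ht

/-! ### Infinite dimension of `L²` and `H²` -/

/-- Normalized indicator functions of disjoint balls. -/
theorem exists_orthonormal_seq (hq : 1 ≤ q) : ∃ v : ℕ → Hilb q, Orthonormal ℂ v := by
  have hdisj : ∀ i j : ℕ, i ≠ j → Disjoint (Metric.ball ((i : ℝ) • unitVec 0) (1 / 2))
      (Metric.ball ((j : ℝ) • unitVec 0) (1 / 2)) := by
    intro i j hij
    refine Metric.ball_disjoint_ball ?_
    rw [dist_eq_norm, ← sub_smul, norm_smul, unitVec, PiLp.norm_single, norm_one, mul_one,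
      Real.norm_eq_abs]
    have : (1 : ℤ) ≤ |(i : ℤ) - j| := Int.one_le_abs (sub_ne_zero.2 (by exact_mod_cast hij))
    have h2 : (1 : ℝ) ≤ |(i : ℝ) - j| := by exact_mod_cast this
    linarith
  let e : EuclideanSpace ℂ (Fin q) := EuclideanSpace.single ⟨0, hq⟩ 1
  let v : ℕ → Hilb q := fun i => indicatorConstLp 2
    (Metric.isOpen_ball (x := (i : ℝ) • unitVec 0) (ε := 1 / 2)).measurableSet
    measure_ball_lt_top.ne e
  have hin : ∀ i j, ⟪v i, v j⟫ = (volume.real (Metric.ball ((i : ℝ) • unitVec 0) (1 / 2) ∩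
      Metric.ball ((j : ℝ) • unitVec 0) (1 / 2)) : ℂ) := by
    intro i j
    rw [L2.inner_indicatorConstLp_indicatorConstLp]
    simp [e]
  refine ⟨fun i => ((‖v i‖⁻¹ : ℝ) : ℂ) • v i, ?_, ?_⟩
  · intro i
    have h0 : v i ≠ 0 := by
      intro h0
      have h1 := hin i i
      rw [h0, inner_zero_left, Set.inter_self] at h1
      have h2 : 0 < volume.real (Metric.ball ((i : ℝ) • unitVec 0) (1 / 2)) :=
        ENNReal.toReal_pos (Metric.measure_ball_pos _ _ (by norm_num)).ne'
          measure_ball_lt_top.ne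
      exact h2.ne (by exact_mod_cast h1)
    rw [norm_smul, Complex.norm_real, Real.norm_of_nonneg (by positivity),
      inv_mul_cancel₀ (norm_ne_zero_iff.2 h0)]
  · intro i j hij
    rw [inner_smul_left, inner_smul_right, hin, (hdisj i j hij).inter_eq]
    simp

theorem not_finiteDimensional_hilb (hq : 1 ≤ q) : ¬ FiniteDimensional ℂ (Hilb q) := by
  intro h
  obtain ⟨v, hv⟩ := exists_orthonormal_seq hq
  have := hv.linearIndependent.finite
  exact not_finite ℕ

/-- Without such subspaces, the set that defines the `n`-th eigenvalue might be empty. -/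
theorem exists_submodule_finrank_eq (hq : 1 ≤ q) (n : ℕ) : ∃ M : Submodule ℂ (Hilb q),
    FiniteDimensional ℂ M ∧ Module.finrank ℂ M = n ∧ M ≤ sobolevTwo q := by
  have h1 : ¬ FiniteDimensional ℂ (sobolevTwo q) := by
    intro h
    have h2 : IsClosed (sobolevTwo q : Set (Hilb q)) := Submodule.closed_of_finiteDimensional _
    have h3 : Dense (sobolevTwo q : Set (Hilb q)) := by
      refine Dense.mono ?_ (SchwartzMap.denseRange_toLpCLM (F := EuclideanSpace ℂ (Fin q))
        (E := Space) (μ := volume) (p := 2) ENNReal.ofNat_ne_top)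
      rintro _ ⟨f, rfl⟩
      exact schwartz_mem_sobolevTwo f
    have h4 : sobolevTwo q = ⊤ := by
      rw [← SetLike.coe_set_eq, Submodule.top_coe, ← h3.closure_eq, h2.closure_eq]
    rw [h4] at h
    exact not_finiteDimensional_hilb hq (Module.Finite.equiv Submodule.topEquiv)
  have h2 : (n : Cardinal) ≤ Module.rank ℂ (sobolevTwo q) :=
    (Cardinal.natCast_lt_aleph0.le).trans (not_lt.1 fun h => h1 (Module.rank_lt_aleph0_iff.1 h))
  obtain ⟨s, hs, hli⟩ := exists_finset_linearIndependent_of_le_rank h2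
  have h3 : LinearIndependent ℂ fun x : s => ((x : sobolevTwo q) : Hilb q) :=
    hli.map' (sobolevTwo q).subtype (Submodule.ker_subtype _)
  refine ⟨Submodule.span ℂ (Set.range fun x : s => ((x : sobolevTwo q) : Hilb q)),
    FiniteDimensional.span_of_finite _ (Set.finite_range _), ?_, ?_⟩
  · rw [finrank_span_eq_card h3, Fintype.card_coe, hs]
  · rw [Submodule.span_le]
    rintro _ ⟨x, rfl⟩
    exact x.1.2

/-! ### Eigenvalue bounds for a mean field -/

/-- The Fock form dominates the Schrödinger form, so a trial space for the Fock operator serves for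
the Schrödinger operator as well. -/
theorem nthEigenvalue_schrodingerOp_le (hq : 1 ≤ q) {n : ℕ} (hn : 1 ≤ n) {Z m : ℝ} (hZ : 0 < Z)
    {P : Hilb q →L[ℂ] Hilb q} (h : IsMeanField (density P) (kernel P) m) :
    nthEigenvalue (schrodingerOp q) n ≤ nthEigenvalue (fockOp Z P) n := by
  have hF := isFormPerturbation_fockOp Z h
  refine le_of_forall_gt_imp_ge_of_dense fun s hs => ?_
  obtain ⟨M₀, hM₀⟩ := exists_submodule_finrank_eq hq n
  obtain ⟨M, hMf, hM, hle⟩ := hF.exists_trial ⟨M₀, hM₀.1, hM₀.2.1,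
    hM₀.2.2.trans (domain_fockOp Z h).ge⟩ hs
  refine (isFormPerturbation_schrodingerOp q).nthEigenvalue_le hn M hM fun ψ hψ => ?_
  have h1 := hle ψ hψ
  rw [energyForm_fockPotential] at h1
  have h2 := h.exchangeForm_re_le ψ
  have h3 : 0 ≤ 1 / Z * (directForm (density P) (ψ : Hilb q) -
        (exchangeForm (kernel P) (ψ : Hilb q) (ψ : Hilb q)).re) :=
    mul_nonneg (by positivity) (sub_nonneg.2 h2)
  linarith

/-- A trial space of the Schrödinger operator inside `H¹`, for each level above its `n`-th
eigenvalue. -/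
theorem exists_trial_schrodingerOp (hq : 1 ≤ q) {n : ℕ} {t : ℝ}
    (ht : nthEigenvalue (schrodingerOp q) n < t) :
    ∃ M : Submodule ℂ (sobolevOne q), FiniteDimensional ℂ M ∧ Module.finrank ℂ M = n ∧
      ∀ ψ ∈ M, energyForm (grad q) (nuclearPotential q) ψ ≤ t * ‖(ψ : Hilb q)‖ ^ 2 := by
  obtain ⟨M₀, hM₀⟩ := exists_submodule_finrank_eq hq n
  exact (isFormPerturbation_schrodingerOp q).exists_trial ⟨M₀, hM₀.1, hM₀.2.1,
    hM₀.2.2.trans (domain_schrodingerOp q).ge⟩ ht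

/-- A trial space for the Schrödinger operator serves for the Fock operator, at a higher level. -/
theorem nthEigenvalue_fockOp_le (hq : 1 ≤ q) {n : ℕ} (hn : 1 ≤ n) {Z m : ℝ} (hZ : 0 < Z)
    {P : Hilb q →L[ℂ] Hilb q} (h : IsMeanField (density P) (kernel P) m) :
    nthEigenvalue (fockOp Z P) n ≤ nthEigenvalue (schrodingerOp q) n + 2 * (m / Z) +
      2 * (m / Z) * √(nthEigenvalue (schrodingerOp q) n + 1) := by
  refine le_of_forall_gt_le fun t ht => ?_
  obtain ⟨M, hMf, hM, hle⟩ := exists_trial_schrodingerOp hq ht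
  refine (isFormPerturbation_fockOp Z h).nthEigenvalue_le hn M hM fun ψ hψ => ?_
  rw [energyForm_fockPotential]
  exact h.form_le hZ (hle ψ hψ)

end FockForm

/-! ### The spectral decomposition of a density matrix -/

universe u

section SpectralDecomposition

variable {H : Type u} [NormedAddCommGroup H] [InnerProductSpace ℂ H]

local notation "⟪" x ", " y "⟫" => inner ℂ x y

/-- `P² ≤ P` if `0 ≤ P ≤ 1`. -/
theorem norm_sq_le_of_isPositive {P : H →L[ℂ] H} (h0 : P.IsPositive) (h1 : (1 - P).IsPositive)
    (x : H) : ‖P x‖ ^ 2 ≤ (⟪x, P x⟫).re := by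
  have a1 := h0.re_inner_nonneg_right (x - P x)
  have a2 := h1.re_inner_nonneg_right (P x)
  have a3 : ⟪x, P (P x)⟫ = ⟪P x, P x⟫ := (h0.isSymmetric x (P x)).symm
  simp only [map_sub, inner_sub_left, inner_sub_right, sub_apply, a3,
    one_apply_eq_self, RCLike.re_eq_complex_re] at a1 a2
  have a4 : (⟪P x, P x⟫).re = ‖P x‖ ^ 2 := inner_self_eq_norm_sq (𝕜 := ℂ) (P x)
  have a5 : (⟪P x, x⟫).re = (⟪x, P x⟫).re := by
    rw [← inner_conj_symm, Complex.conj_re]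
  linarith

theorem isCompactOperator_rankOne (x y : H) :
    IsCompactOperator (InnerProductSpace.rankOne ℂ x y) := by
  have h : IsCompactOperator (innerSL ℂ y) :=
    isCompactOperator_of_locallyCompactSpace_dom _
  exact h.clm_comp (ContinuousLinearMap.toSpanSingleton ℂ x)

/-- An operator `0 ≤ P ≤ 1` of finite trace is the norm limit of finite rank operators. -/
theorem isCompactOperator_of_summable [CompleteSpace H] {P : H →L[ℂ] H} (h0 : P.IsPositive)
    (h1 : (1 - P).IsPositive) {ι : Type*} (b : HilbertBasis ι ℂ H)
    (hs : Summable fun i => (⟪b i, P (b i)⟫).re) : IsCompactOperator P := by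
  have hs2 : Summable fun i => ‖P (b i)‖ ^ 2 :=
    hs.of_nonneg_of_le (fun i => sq_nonneg _) fun i => norm_sq_le_of_isPositive h0 h1 (b i)
  let F : Finset ι → H →L[ℂ] H := fun s => ∑ i ∈ s, InnerProductSpace.rankOne ℂ (P (b i)) (b i)
  have hF : ∀ s, IsCompactOperator (F s) := fun s =>
    Submodule.sum_mem (compactOperator (RingHom.id ℂ) H H) fun i _ => isCompactOperator_rankOne _ _
  have hbound : ∀ s, ‖F s - P‖ ≤ √(∑' i : {i // i ∉ s}, ‖P (b i)‖ ^ 2) := by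
    intro s
    refine ContinuousLinearMap.opNorm_le_bound _ (Real.sqrt_nonneg _) fun ψ => ?_
    have e1 : HasSum (fun i => ⟪b i, ψ⟫ • P (b i)) (P ψ) := by
      have := (b.hasSum_repr ψ).mapL P
      simpa only [map_smul, b.repr_apply_apply] using this
    have e2 : P ψ = (P ψ - F s ψ) + ∑ i ∈ s, ⟪b i, ψ⟫ • P (b i) := by
      simp [F, InnerProductSpace.rankOne_apply]
    rw [e2] at e1
    have e3 := s.hasSum_compl_iff.2 e1
    have e4 := Real.summable_and_inner_le_Lp_mul_Lq_tsum_of_nonneg Real.HolderConjugate.two_two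
      (f := fun i : {i // i ∉ s} => ‖⟪b i, ψ⟫‖) (g := fun i : {i // i ∉ s} => ‖P (b i)‖)
      (fun _ => norm_nonneg _) (fun _ => norm_nonneg _)
      (by simpa using (b.orthonormal.comp _ Subtype.val_injective).inner_products_summable ψ)
      (by simpa [Function.comp_def] using hs2.subtype fun i => i ∉ s)
    have e5 : ‖P ψ - F s ψ‖ ≤ ∑' i : {i // i ∉ s}, ‖⟪b i, ψ⟫‖ * ‖P (b i)‖ := by
      rw [← e3.tsum_eq]
      refine (norm_tsum_le_tsum_norm ?_).trans (le_of_eq ?_)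
      · simpa only [Function.comp_def, norm_smul] using e4.1
      · simp only [norm_smul]
    have e6 := (b.orthonormal.comp _ (Subtype.val_injective (p := fun i => i ∉ s))).tsum_inner_products_le
      (x := ψ)
    have e7 := e4.2
    simp only [Real.rpow_two, ← Real.sqrt_eq_rpow] at e7
    rw [sub_apply, norm_sub_rev]
    refine e5.trans (e7.trans ?_)
    rw [mul_comm]
    refine mul_le_mul_of_nonneg_left ?_ (Real.sqrt_nonneg _)
    exact Real.sqrt_le_iff.2 ⟨norm_nonneg _, e6⟩
  refine isCompactOperator_of_tendsto (l := atTop) (F := F) ?_ (Eventually.of_forall hF)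
  rw [tendsto_iff_norm_sub_tendsto_zero]
  refine squeeze_zero (fun _ => norm_nonneg _) hbound ?_
  have := (Real.continuous_sqrt.tendsto _).comp
    (tendsto_tsum_compl_atTop_zero fun i => ‖P (b i)‖ ^ 2)
  rwa [Real.sqrt_zero] at this

/-- A compact self-adjoint operator has a Hilbert basis of eigenvectors. -/
theorem exists_hilbertBasis_eigenvectors [CompleteSpace H] {P : H →L[ℂ] H} (hc : IsCompactOperator P)
    (hs : (P : H →ₗ[ℂ] H).IsSymmetric) : ∃ (ι : Type u) (b : HilbertBasis ι ℂ H) (w : ι → ℝ),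
      ∀ i, P (b i) = (w i : ℂ) • b i := by
  let V : ℂ → Submodule ℂ H := fun μ => Module.End.eigenspace (P : H →ₗ[ℂ] H) μ
  have hV : ∀ μ, IsClosed (V μ : Set H) := by
    intro μ
    have : (V μ : Set H) = {x | P x = μ • x} := by
      ext x
      exact Module.End.mem_eigenspace_iff
    rw [this]
    exact isClosed_eq P.continuous (continuous_const_smul μ)
  have hVc : ∀ μ, CompleteSpace (V μ) := fun μ => (hV μ).completeSpace_coe
  choose w b hb using fun μ => exists_hilbertBasis ℂ (V μ)
  have ho := hs.orthogonalFamily_eigenspaces.orthonormal_sigma_orthonormal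
    fun μ => (b μ).orthonormal
  have hbot : (Submodule.span ℂ (Set.range fun a : Σ μ, w μ => ((b a.1 a.2 : V a.1) : H)))ᗮ = ⊥ := by
    rw [Submodule.eq_bot_iff]
    intro x hx
    have h1 : ∀ μ (y : V μ), ⟪x, (y : H)⟫ = 0 := by
      intro μ y
      have h2 := (((b μ).hasSum_repr y).mapL (V μ).subtypeL).mapL (innerSL ℂ x)
      refine h2.unique ?_
      convert hasSum_zero using 2 with i
      have h3 : ⟪x, ((b μ i : V μ) : H)⟫ = 0 := by
        rw [Submodule.mem_orthogonal'] at hx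
        exact hx _ (Submodule.subset_span ⟨⟨μ, i⟩, rfl⟩)
      simp [h3]
    have h4 : x ∈ (⨆ μ, V μ)ᗮ := by
      rw [Submodule.mem_orthogonal']
      intro u hu
      refine Submodule.iSup_induction V (motive := fun u => ⟪x, u⟫ = 0) hu (fun μ y hy => h1 μ ⟨y, hy⟩)
        (inner_zero_right _) fun y z hy hz => ?_
      rw [inner_add_right, hy, hz, add_zero]
    rwa [ContinuousLinearMap.orthogonalComplement_iSup_eigenspaces_eq_bot hc hs,
      Submodule.mem_bot] at h4
  let B := HilbertBasis.mkOfOrthogonalEqBot ho hbot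
  have hB : ∀ a, B a = ((b a.1 a.2 : V a.1) : H) := fun a => by
    exact congrFun (HilbertBasis.coe_mkOfOrthogonalEqBot ho hbot) a
  have hP : ∀ a, P (B a) = a.1 • B a := fun a => by
    rw [hB]
    exact Module.End.mem_eigenspace_iff.1 (b a.1 a.2).2
  refine ⟨Σ μ, w μ, B, fun a => a.1.re, fun a => ?_⟩
  rw [hP]
  congr 1
  have h5 : conj a.1 = a.1 := by
    refine hs.conj_eigenvalue_eq_self (Module.End.hasEigenvalue_of_hasEigenvector (x := B a)
      ⟨Module.End.mem_eigenspace_iff.2 (hP a), ?_⟩)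
    exact B.orthonormal.ne_zero a
  exact (Complex.conj_eq_iff_re.1 h5).symm

theorem countable_of_orthonormal [TopologicalSpace.SeparableSpace H] {ι : Type*} {v : ι → H}
    (hv : Orthonormal ℂ v) : Countable ι := by
  have hd : Pairwise (Function.onFun Disjoint fun i => Metric.ball (v i) (1 / 2)) := by
    intro i j hij
    refine Metric.ball_disjoint_ball ?_
    have h1 : ‖v i - v j‖ ^ 2 = 2 := by
      have := norm_sub_sq (𝕜 := ℂ) (v i) (v j)
      rw [hv.2 hij, hv.1 i, hv.1 j] at this
      rw [this]
      norm_num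
    rw [dist_eq_norm]
    nlinarith [norm_nonneg (v i - v j)]
  refine hd.countable_of_isOpen_disjoint (fun i => Metric.isOpen_ball)
    fun i => ⟨v i, Metric.mem_ball_self (by norm_num)⟩

end SpectralDecomposition

section Density

variable {q : ℕ}

local notation "⟪" x ", " y "⟫" => inner ℂ x y

instance separableSpace_hilb : TopologicalSpace.SeparableSpace (Hilb q) := by
  have : Fact ((2 : ℝ≥0∞) ≠ ∞) := ⟨ENNReal.ofNat_ne_top⟩
  infer_instance

/-- The eigenbasis is countably infinite, as `L²` is separable and infinite-dimensional, and can be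
indexed by `ℕ`. -/
theorem exists_isSpectralDecomposition (hq : 1 ≤ q) {N : ℕ} {P : Hilb q →L[ℂ] Hilb q}
    (hP : IsDensityMatrix N P) : ∃ d, IsSpectralDecomposition P d := by
  obtain ⟨s, b₀, -⟩ := exists_hilbertBasis ℂ (Hilb q)
  have hc := isCompactOperator_of_summable hP.nonneg hP.le_one b₀ (hP.trace _ b₀).summable
  obtain ⟨ι, b, w, hw⟩ := exists_hilbertBasis_eigenvectors hc hP.nonneg.isSymmetric
  have h1 : Countable ι := countable_of_orthonormal b.orthonormal
  have h2 : Infinite ι := by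
    by_contra hfin
    rw [not_infinite_iff_finite] at hfin
    have := Fintype.ofFinite ι
    exact not_finiteDimensional_hilb hq b.toOrthonormalBasis.toBasis.finiteDimensional_of_finite
  obtain ⟨hden⟩ := nonempty_denumerable ι
  let e : ℕ ≃ ι := (Denumerable.eqv ι).symm
  refine ⟨(fun n => w (e n), fun n => b (e n)), b.orthonormal.comp _ e.injective, fun ψ => ?_⟩
  refine (e.hasSum_iff (f := fun i => (w i : ℂ) • (⟪b i, ψ⟫ • b i))).2 ?_
  have := (b.hasSum_repr ψ).mapL P
  simp only [map_smul, b.repr_apply_apply, hw] at this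
  simpa only [smul_comm (w _ : ℂ)] using this

theorem isSpectralDecomposition_spectralData (hq : 1 ≤ q) {N : ℕ} {P : Hilb q →L[ℂ] Hilb q}
    (hP : IsDensityMatrix N P) : IsSpectralDecomposition P (spectralData P) :=
  Classical.epsilon_spec (exists_isSpectralDecomposition hq hP)

theorem IsSpectralDecomposition.apply_eq {P : Hilb q →L[ℂ] Hilb q} {d : (ℕ → ℝ) × (ℕ → Hilb q)}
    (h : IsSpectralDecomposition P d) (n : ℕ) : P (d.2 n) = (d.1 n : ℂ) • d.2 n := by
  refine (h.2 (d.2 n)).unique ?_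
  have := hasSum_single (f := fun k => (d.1 k : ℂ) • (⟪d.2 k, d.2 n⟫ • d.2 k)) n fun k hk => by
    simp [h.1.2 hk]
  simpa [inner_self_eq_norm_sq_to_K, h.1.1 n] using this

theorem IsSpectralDecomposition.weight_eq {P : Hilb q →L[ℂ] Hilb q} {d : (ℕ → ℝ) × (ℕ → Hilb q)}
    (h : IsSpectralDecomposition P d) (n : ℕ) : (⟪d.2 n, P (d.2 n)⟫).re = d.1 n := by
  rw [h.apply_eq, inner_smul_right, inner_self_eq_norm_sq_to_K, h.1.1 n]
  simp

theorem IsSpectralDecomposition.weight_nonneg {N : ℕ} {P : Hilb q →L[ℂ] Hilb q}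
    (hP : IsDensityMatrix N P) {d : (ℕ → ℝ) × (ℕ → Hilb q)}
    (h : IsSpectralDecomposition P d) (n : ℕ) : 0 ≤ d.1 n := by
  rw [← h.weight_eq]
  exact hP.nonneg.re_inner_nonneg_right _

/-- Extend the eigenvectors to a Hilbert basis to evaluate the trace; `P` vanishes on the added ones. -/
theorem IsSpectralDecomposition.hasSum_weight {N : ℕ} {P : Hilb q →L[ℂ] Hilb q}
    (hP : IsDensityMatrix N P) {d : (ℕ → ℝ) × (ℕ → Hilb q)}
    (h : IsSpectralDecomposition P d) : HasSum d.1 (N : ℝ) := by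
  obtain ⟨w, b, hw, hb⟩ := h.1.toSubtypeRange.exists_hilbertBasis_extension
  let j : ℕ → w := fun n => ⟨d.2 n, hw ⟨n, rfl⟩⟩
  have hj : Function.Injective j := fun m n hmn =>
    h.1.linearIndependent.injective (congrArg Subtype.val hmn)
  have hbj : ∀ n, b (j n) = d.2 n := fun n => by rw [hb]
  have h1 := hP.trace _ b
  rw [← hj.hasSum_iff] at h1
  · simpa only [Function.comp_def, hbj, h.weight_eq] using h1
  · intro i hi
    have h2 : P (b i) = 0 := by
      refine (h.2 (b i)).unique ?_
      convert hasSum_zero using 2 with n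
      rw [← hbj, b.orthonormal.2 (fun hji => hi ⟨n, hji⟩)]
      simp
    rw [h2, inner_zero_right, Complex.zero_re]

end Density

/-! ### The mean field of weighted orbitals -/

section OrbitalField

variable {q : ℕ} {ι : Type*}

local notation "⟪" x ", " y "⟫" => inner ℂ x y

/-- The density `∑ᵢ wᵢ |φᵢ(x)|²`. -/
noncomputable def orbitalDensity (w : ι → ℝ) (φ : ι → Hilb q) (x : Space) : ℝ :=
  ∑' i, w i * ‖φ i x‖ ^ 2

/-- The kernel `∑ᵢ wᵢ φᵢ(x, s) conj φᵢ(y, t)`. -/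
noncomputable def orbitalKernel (w : ι → ℝ) (φ : ι → Hilb q) : SpinKernel q := fun x y s t =>
  ∑' i, (w i : ℂ) * (φ i x s * conj (φ i y t))

variable {w : ι → ℝ} {φ : ι → Hilb q} {m : ℝ}

theorem integral_weight_mul (h1 : ∀ i, ‖φ i‖ = 1) (i : ι) :
    ∫ x, w i * ‖φ i x‖ ^ 2 = w i := by
  rw [integral_const_mul, integral_norm_sq, h1, one_pow, mul_one]

theorem lintegral_weight_mul (h0 : ∀ i, 0 ≤ w i) (h1 : ∀ i, ‖φ i‖ = 1) (i : ι) :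
    ∫⁻ x, ENNReal.ofReal (w i * ‖φ i x‖ ^ 2) = ENNReal.ofReal (w i) := by
  rw [← ofReal_integral_eq_lintegral_ofReal ((integrable_norm_sq _).const_mul _)
    (Eventually.of_forall fun x => mul_nonneg (h0 i) (sq_nonneg _)), integral_weight_mul h1]

theorem ae_summable_weight_mul [Countable ι] (h0 : ∀ i, 0 ≤ w i) (h1 : ∀ i, ‖φ i‖ = 1) (hw : HasSum w m) :
    ∀ᵐ x, Summable fun i => w i * ‖φ i x‖ ^ 2 := by
  have hm : ∀ i, Measurable fun x => ENNReal.ofReal (w i * ‖φ i x‖ ^ 2) := fun i =>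
    ((measurable_norm_sq (φ i)).const_mul (w i)).ennreal_ofReal
  have h2 : ∫⁻ x, ∑' i, ENNReal.ofReal (w i * ‖φ i x‖ ^ 2) ≠ ∞ := by
    rw [lintegral_tsum fun i => (hm i).aemeasurable]
    simp only [lintegral_weight_mul h0 h1]
    rw [← ENNReal.ofReal_tsum_of_nonneg h0 hw.summable]
    exact ENNReal.ofReal_ne_top
  filter_upwards [ae_lt_top (Measurable.tsum hm) h2] with x hx
  have h3 := ENNReal.summable_toReal hx.ne
  refine h3.congr fun i => ?_
  exact ENNReal.toReal_ofReal (mul_nonneg (h0 i) (sq_nonneg _))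

theorem summable_kernel_term (h0 : ∀ i, 0 ≤ w i) {a b : ι → ℝ}
    (ha : Summable fun i => w i * a i ^ 2) (hb : Summable fun i => w i * b i ^ 2)
    {f : ι → ℂ} (hf : ∀ i, ‖f i‖ ≤ a i * b i) : Summable fun i => (w i : ℂ) * f i := by
  refine Summable.of_norm_bounded (g := fun i => w i * a i ^ 2 + w i * b i ^ 2) (ha.add hb)
    fun i => ?_
  rw [norm_mul, Complex.norm_real, Real.norm_of_nonneg (h0 i), ← mul_add]
  refine mul_le_mul_of_nonneg_left ((hf i).trans ?_) (h0 i)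
  nlinarith [sq_nonneg (a i - b i), sq_nonneg (a i + b i)]

theorem norm_coord_le (v : EuclideanSpace ℂ (Fin q)) (s : Fin q) : ‖v s‖ ≤ ‖v‖ :=
  PiLp.norm_apply_le v s

theorem summable_orbitalKernel (h0 : ∀ i, 0 ≤ w i) {x y : Space}
    (hx : Summable fun i => w i * ‖φ i x‖ ^ 2) (hy : Summable fun i => w i * ‖φ i y‖ ^ 2)
    (s t : Fin q) : Summable fun i => (w i : ℂ) * (φ i x s * conj (φ i y t)) := by
  refine summable_kernel_term h0 hx hy fun i => ?_
  rw [norm_mul, RCLike.norm_conj]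
  exact mul_le_mul (norm_coord_le _ _) (norm_coord_le _ _) (norm_nonneg _) (norm_nonneg _)

theorem inner_eq_sum (u v : EuclideanSpace ℂ (Fin q)) : ⟪u, v⟫ = ∑ t, conj (u t) * v t := by
  simp only [PiLp.inner_apply, RCLike.inner_apply]
  exact Finset.sum_congr rfl fun t _ => mul_comm _ _

/-- `τ(x, y) v = ∑ᵢ wᵢ ⟨φᵢ(y), v⟩ φᵢ(x)`, tested against `u`. -/
theorem hasSum_inner_kernelApply (h0 : ∀ i, 0 ≤ w i) {x y : Space}
    (hx : Summable fun i => w i * ‖φ i x‖ ^ 2) (hy : Summable fun i => w i * ‖φ i y‖ ^ 2)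
    (u v : EuclideanSpace ℂ (Fin q)) :
    HasSum (fun i => (w i : ℂ) * (⟪u, φ i x⟫ * ⟪φ i y, v⟫))
      ⟪u, kernelApply (orbitalKernel w φ) x y v⟫ := by
  rw [inner_kernelApply]
  have h1 : ∀ s t, HasSum (fun i => conj (u s) * ((w i : ℂ) * (φ i x s * conj (φ i y t))) * v t)
      (conj (u s) * orbitalKernel w φ x y s t * v t) := fun s t =>
    ((summable_orbitalKernel h0 hx hy s t).hasSum.mul_left _).mul_right _
  have h2 := hasSum_sum (s := Finset.univ) fun s _ =>
    hasSum_sum (s := Finset.univ) fun t _ => h1 s t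
  refine h2.congr_fun fun i => ?_
  rw [inner_eq_sum, inner_eq_sum, Finset.sum_mul_sum, Finset.mul_sum]
  refine Finset.sum_congr rfl fun s _ => ?_
  rw [Finset.mul_sum]
  exact Finset.sum_congr rfl fun t _ => by ring

/-- The Cauchy-Schwarz inequality for weighted sums. -/
theorem tsum_weight_mul_le (h0 : ∀ i, 0 ≤ w i) {a b : ι → ℝ} (ha0 : ∀ i, 0 ≤ a i)
    (hb0 : ∀ i, 0 ≤ b i) (ha : Summable fun i => w i * a i ^ 2)
    (hb : Summable fun i => w i * b i ^ 2) : Summable (fun i => w i * (a i * b i)) ∧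
      ∑' i, w i * (a i * b i) ≤ √(∑' i, w i * a i ^ 2) * √(∑' i, w i * b i ^ 2) := by
  have e : ∀ i (c : ℝ), (√(w i) * c) ^ (2 : ℝ) = w i * c ^ 2 := fun i c => by
    rw [Real.rpow_two, mul_pow, Real.sq_sqrt (h0 i)]
  have h := Real.summable_and_inner_le_Lp_mul_Lq_tsum_of_nonneg Real.HolderConjugate.two_two
    (f := fun i => √(w i) * a i) (g := fun i => √(w i) * b i)
    (fun i => mul_nonneg (Real.sqrt_nonneg _) (ha0 i))
    (fun i => mul_nonneg (Real.sqrt_nonneg _) (hb0 i)) (by simpa only [e] using ha)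
    (by simpa only [e] using hb)
  have e2 : ∀ i, √(w i) * a i * (√(w i) * b i) = w i * (a i * b i) := fun i => by
    rw [mul_mul_mul_comm, Real.mul_self_sqrt (h0 i)]
  simpa only [e, e2, ← Real.sqrt_eq_rpow] using h

/-- The Cauchy-Schwarz inequality `|τ(x, y)| ≤ √ρ(x) √ρ(y)`. -/
theorem norm_kernelApply_le (h0 : ∀ i, 0 ≤ w i) {x y : Space}
    (hx : Summable fun i => w i * ‖φ i x‖ ^ 2) (hy : Summable fun i => w i * ‖φ i y‖ ^ 2)
    (v : EuclideanSpace ℂ (Fin q)) : ‖kernelApply (orbitalKernel w φ) x y v‖ ≤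
      √(orbitalDensity w φ x) * √(orbitalDensity w φ y) * ‖v‖ := by
  set u := kernelApply (orbitalKernel w φ) x y v with hu
  have h1 := hasSum_inner_kernelApply h0 hx hy u v
  have h2 := tsum_weight_mul_le h0 (fun i => norm_nonneg (φ i x)) (fun i => norm_nonneg (φ i y))
    hx hy
  have h3 : ‖⟪u, u⟫‖ ≤ ‖u‖ * ‖v‖ * (√(orbitalDensity w φ x) * √(orbitalDensity w φ y)) := by
    conv_lhs => rw [hu]
    rw [← hu, ← h1.tsum_eq]
    have h4 : ∀ i, ‖(w i : ℂ) * (⟪u, φ i x⟫ * ⟪φ i y, v⟫)‖ ≤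
        ‖u‖ * ‖v‖ * (w i * (‖φ i x‖ * ‖φ i y‖)) := by
      intro i
      rw [norm_mul, Complex.norm_real, Real.norm_of_nonneg (h0 i), norm_mul]
      have := mul_le_mul (norm_inner_le_norm (𝕜 := ℂ) u (φ i x))
        (norm_inner_le_norm (𝕜 := ℂ) (φ i y) v) (norm_nonneg _) (by positivity)
      refine (mul_le_mul_of_nonneg_left this (h0 i)).trans (le_of_eq ?_)
      ring
    refine (tsum_of_norm_bounded (h2.1.mul_left _).hasSum h4).trans ?_
    rw [tsum_mul_left]
    exact mul_le_mul_of_nonneg_left h2.2 (by positivity)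
  have h5 : ‖⟪u, u⟫‖ = ‖u‖ * ‖u‖ := by
    rw [inner_self_eq_norm_sq_to_K, norm_pow, RCLike.norm_ofReal, abs_norm, sq]
  rw [h5, mul_assoc] at h3
  by_cases h6 : ‖u‖ = 0
  · rw [h6]
    positivity
  · have := le_of_mul_le_mul_left h3 (lt_of_le_of_ne (norm_nonneg u) (Ne.symm h6))
    linarith

theorem ae_prod_of_ae {p : Space → Prop} (h : ∀ᵐ x, p x) :
    ∀ᵐ z : Space × Space, p z.1 ∧ p z.2 :=
  ((Measure.quasiMeasurePreserving_fst (μ := (volume : Measure Space))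
    (ν := (volume : Measure Space))).ae h).and
    ((Measure.quasiMeasurePreserving_snd (μ := (volume : Measure Space))
    (ν := (volume : Measure Space))).ae h)

theorem integrable_inner_hilb (f g : Hilb q) : Integrable fun x => ⟪f x, g x⟫ :=
  L2.integrable_inner f g

theorem integral_norm_inner_le (f g : Hilb q) : ∫ x, ‖⟪f x, g x⟫‖ ≤ ‖f‖ * ‖g‖ := by
  have h := sq_integral_mul_le (Lp.memLp f).norm (Lp.memLp g).norm
  rw [integral_norm_sq, integral_norm_sq, ← mul_pow] at h
  have h2 := abs_le_of_sq_le_sq' h (by positivity) |>.2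
  refine le_trans (integral_mono (integrable_inner_hilb f g).norm
    ((Lp.memLp f).norm.integrable_mul (Lp.memLp g).norm) fun x => norm_inner_le_norm _ _) h2

/-- The orbitals `φᵢ` with weights `wᵢ` define a mean field. -/
theorem isMeanField_orbital [Countable ι] (h0 : ∀ i, 0 ≤ w i) (h1 : ∀ i, ‖φ i‖ = 1) (hw : HasSum w m) :
    IsMeanField (orbitalDensity w φ) (orbitalKernel w φ) m where
  nonneg x := tsum_nonneg fun i => mul_nonneg (h0 i) (sq_nonneg _)
  integrable := by
    have hm : Measurable (orbitalDensity w φ) := by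
      have : ∀ x, orbitalDensity w φ x = (∑' i, ENNReal.ofReal (w i * ‖φ i x‖ ^ 2)).toReal := by
        intro x
        rw [ENNReal.tsum_toReal_eq fun i => ENNReal.ofReal_ne_top, orbitalDensity]
        refine tsum_congr fun i => ?_
        rw [ENNReal.toReal_ofReal (mul_nonneg (h0 i) (sq_nonneg _))]
      rw [funext this]
      exact (Measurable.tsum fun i =>
        ((measurable_norm_sq (φ i)).const_mul (w i)).ennreal_ofReal).ennreal_toReal
    refine (lintegral_ofReal_ne_top_iff_integrable hm.aestronglyMeasurable
      (Eventually.of_forall fun x => tsum_nonneg fun i => mul_nonneg (h0 i) (sq_nonneg _))).1 ?_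
    have h2 : ∀ᵐ x, ENNReal.ofReal (orbitalDensity w φ x) =
        ∑' i, ENNReal.ofReal (w i * ‖φ i x‖ ^ 2) := by
      filter_upwards [ae_summable_weight_mul h0 h1 hw] with x hx
      exact ENNReal.ofReal_tsum_of_nonneg (fun i => mul_nonneg (h0 i) (sq_nonneg _)) hx
    rw [lintegral_congr_ae h2, lintegral_tsum fun i =>
      ((measurable_norm_sq (φ i)).const_mul (w i)).ennreal_ofReal.aemeasurable]
    simp only [lintegral_weight_mul h0 h1]
    rw [← ENNReal.ofReal_tsum_of_nonneg h0 hw.summable]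
    exact ENNReal.ofReal_ne_top
  integral_eq := by
    have := hasSum_integral_of_summable_integral_norm (μ := (volume : Measure Space))
      (F := fun i x => w i * ‖φ i x‖ ^ 2)
      (fun i => (integrable_norm_sq _).const_mul _) (by
        have e : ∀ i, ∫ x, ‖w i * ‖φ i x‖ ^ 2‖ = w i := fun i => by
          refine Eq.trans ?_ (integral_weight_mul h1 i)
          refine integral_congr_ae (Eventually.of_forall fun x => ?_)
          exact Real.norm_of_nonneg (mul_nonneg (h0 i) (sq_nonneg _))
        simpa only [e] using hw.summable)
    simp only [integral_weight_mul h1] at this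
    exact this.unique hw
  meas s t := by
    have h2 : ∀ᵐ z : Space × Space, Tendsto (fun F : Finset ι =>
        ∑ i ∈ F, (w i : ℂ) * (φ i z.1 s * conj (φ i z.2 t))) atTop
        (𝓝 (orbitalKernel w φ z.1 z.2 s t)) := by
      filter_upwards [ae_prod_of_ae (ae_summable_weight_mul h0 h1 hw)] with z hz
      exact (summable_orbitalKernel h0 hz.1 hz.2 s t).hasSum
    refine aestronglyMeasurable_of_tendsto_ae _ (fun F => ?_) h2
    refine Finset.aestronglyMeasurable_fun_sum _ fun i _ => AEStronglyMeasurable.const_mul ?_ _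
    refine AEStronglyMeasurable.mul ?_ ?_
    · exact (EuclideanSpace.proj (𝕜 := ℂ) s).continuous.comp_aestronglyMeasurable
        (IsMeanField.aestronglyMeasurable_fst (φ i))
    · exact Complex.continuous_conj.comp_aestronglyMeasurable
        ((EuclideanSpace.proj (𝕜 := ℂ) t).continuous.comp_aestronglyMeasurable
          (IsMeanField.aestronglyMeasurable_snd (φ i)))
  conj_symm x y s t := by
    rw [orbitalKernel, orbitalKernel, Complex.conj_tsum]
    refine tsum_congr fun i => ?_
    rw [map_mul, map_mul, Complex.conj_ofReal, Complex.conj_conj]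
    ring
  bound := by
    filter_upwards [ae_prod_of_ae (ae_summable_weight_mul h0 h1 hw)] with z hz v
    exact norm_kernelApply_le h0 hz.1 hz.2 v
  pos g := by
    have hF : ∀ i, Integrable fun z : Space × Space =>
        (w i : ℂ) * (⟪g z.1, φ i z.1⟫ * ⟪φ i z.2, g z.2⟫) := fun i =>
      ((integrable_inner_hilb g (φ i)).mul_prod (integrable_inner_hilb (φ i) g)).const_mul _
    have h2 := hasSum_integral_of_summable_integral_norm (μ := (volume : Measure (Space × Space)))
      hF (by
        refine Summable.of_nonneg_of_le (fun i => integral_nonneg fun z => norm_nonneg _)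
          (fun i => ?_) (hw.summable.mul_right (‖g‖ ^ 2))
        have e : ∀ z : Space × Space, ‖(w i : ℂ) * (⟪g z.1, φ i z.1⟫ * ⟪φ i z.2, g z.2⟫)‖ =
            w i * (‖⟪g z.1, φ i z.1⟫‖ * ‖⟪φ i z.2, g z.2⟫‖) := fun z => by
          rw [norm_mul, norm_mul, Complex.norm_real, Real.norm_of_nonneg (h0 i)]
        simp only [e]
        rw [integral_const_mul]
        refine mul_le_mul_of_nonneg_left ?_ (h0 i)
        refine (integral_prod_mul (μ := (volume : Measure Space)) (ν := (volume : Measure Space))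
          (fun x => ‖⟪g x, φ i x⟫‖) fun y => ‖⟪φ i y, g y⟫‖).le.trans ?_
        have e1 := integral_norm_inner_le g (φ i)
        have e2 := integral_norm_inner_le (φ i) g
        rw [h1, mul_one] at e1
        rw [h1, one_mul] at e2
        rw [sq]
        exact mul_le_mul e1 e2 (integral_nonneg fun _ => norm_nonneg _) (norm_nonneg _))
    have h3 : ∫ z : Space × Space, ⟪g z.1, kernelApply (orbitalKernel w φ) z.1 z.2 (g z.2)⟫ =
        ∫ z : Space × Space, ∑' i, (w i : ℂ) * (⟪g z.1, φ i z.1⟫ * ⟪φ i z.2, g z.2⟫) := by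
      refine integral_congr_ae ?_
      filter_upwards [ae_prod_of_ae (ae_summable_weight_mul h0 h1 hw)] with z hz
      exact (hasSum_inner_kernelApply h0 hz.1 hz.2 _ _).tsum_eq.symm
    rw [h3]
    have h4 : ∀ i, ∫ z : Space × Space, (w i : ℂ) * (⟪g z.1, φ i z.1⟫ * ⟪φ i z.2, g z.2⟫) =
        ((w i * ‖⟪g, φ i⟫‖ ^ 2 : ℝ) : ℂ) := by
      intro i
      rw [integral_const_mul]
      have e := integral_prod_mul (μ := (volume : Measure Space)) (ν := (volume : Measure Space))
        (fun x => ⟪g x, φ i x⟫) fun y => ⟪φ i y, g y⟫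
      rw [← L2.inner_def, ← L2.inner_def, ← inner_conj_symm (φ i) g, Complex.mul_conj,
        Complex.normSq_eq_norm_sq] at e
      push_cast
      rw [← Complex.ofReal_pow, ← e]
      rfl
    simp only [h4] at h2
    rw [← h2.tsum_eq, ← Complex.ofReal_tsum, Complex.ofReal_re]
    exact tsum_nonneg fun i => mul_nonneg (h0 i) (sq_nonneg _)

/-- The density and the kernel of a density matrix form a mean field of mass `N`. -/
theorem isMeanField_density (hq : 1 ≤ q) {N : ℕ} {P : Hilb q →L[ℂ] Hilb q}
    (hP : IsDensityMatrix N P) : IsMeanField (density P) (kernel P) N :=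
  have h := isSpectralDecomposition_spectralData hq hP
  isMeanField_orbital (h.weight_nonneg hP) h.1.1 (h.hasSum_weight hP)

end OrbitalField

/-! ### Unitary rotations of orbitals -/

section Rotation

variable {q : ℕ} {ι κ : Type*} [Fintype ι] [Fintype κ]

local notation "⟪" x ", " y "⟫" => inner ℂ x y

/-- Each of the families `φ`, `χ` is expanded in the other as in an orthonormal basis. -/
def IsRotation (φ : ι → Hilb q) (χ : κ → Hilb q) : Prop :=
  (∀ j, χ j = ∑ i, ⟪φ i, χ j⟫ • φ i) ∧ ∀ i, φ i = ∑ j, ⟪χ j, φ i⟫ • χ j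

theorem IsRotation.symm {φ : ι → Hilb q} {χ : κ → Hilb q} (h : IsRotation φ χ) : IsRotation χ φ :=
  ⟨h.2, h.1⟩

/-- The trace of a sesquilinear form is invariant under unitary rotations. -/
theorem sum_sesquilinear_eq {V V' : Type*} [AddCommGroup V] [Module ℂ V] [AddCommGroup V']
    [Module ℂ V'] {B : V → V' → ℂ}
    (hl : ∀ (c : ι → ℂ) (v : ι → V) w, B (∑ i, c i • v i) w = ∑ i, c i * B (v i) w)
    (hr : ∀ (c : κ → ℂ) (v : κ → V') w, B w (∑ j, c j • v j) = ∑ j, conj (c j) * B w (v j))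
    {f : ι → V} {g : κ → V} {f' : ι → V'} {g' : κ → V'} {a : ι → κ → ℂ}
    (hg : ∀ j, g j = ∑ i, a i j • f i) (hf : ∀ i, f' i = ∑ j, conj (a i j) • g' j) :
    ∑ i, B (f i) (f' i) = ∑ j, B (g j) (g' j) := by
  have h1 : ∀ i, B (f i) (f' i) = ∑ j, a i j * B (f i) (g' j) := fun i => by
    rw [hf, hr]
    simp
  have h2 : ∀ j, B (g j) (g' j) = ∑ i, a i j * B (f i) (g' j) := fun j => by
    rw [hg, hl]
  simp only [h1, h2]
  exact Finset.sum_comm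

theorem coeFn_sum_smul (c : ι → ℂ) (φ : ι → Hilb q) :
    ∀ᵐ x, (∑ i, c i • φ i : Hilb q) x = ∑ i, c i • φ i x := by
  filter_upwards [Lp.coeFn_fun_finsetSum Finset.univ fun i => c i • φ i,
    ae_all_iff.2 fun i => Lp.coeFn_smul (c i) (φ i)] with x h1 h2
  rw [h1]
  exact Finset.sum_congr rfl fun i _ => h2 i

theorem IsRotation.ae_eq {φ : ι → Hilb q} {χ : κ → Hilb q} (h : IsRotation φ χ) :
    ∀ᵐ x, ∀ j, χ j x = ∑ i, ⟪φ i, χ j⟫ • φ i x := by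
  rw [ae_all_iff]
  intro j
  filter_upwards [coeFn_sum_smul (fun i => ⟪φ i, χ j⟫) φ] with x hx
  rw [← hx, ← h.1 j]

theorem sum_kernel_eq {φ : ι → Hilb q} {χ : κ → Hilb q} {x y : Space}
    (hx : ∀ j, χ j x = ∑ i, ⟪φ i, χ j⟫ • φ i x) (hy : ∀ i, φ i y = ∑ j, ⟪χ j, φ i⟫ • χ j y)
    (s t : Fin q) : ∑ i, φ i x s * conj (φ i y t) = ∑ j, χ j x s * conj (χ j y t) := by
  refine sum_sesquilinear_eq (V := ℂ) (V' := ℂ) (B := fun u v => u * conj v) (ι := ι) (κ := κ)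
    (f := fun i => φ i x s) (g := fun j => χ j x s) (f' := fun i => φ i y t)
    (g' := fun j => χ j y t) (a := fun i j => ⟪φ i, χ j⟫) ?_ ?_ ?_ ?_
  · intro c v w
    simp only [Finset.sum_mul, smul_eq_mul, mul_assoc]
  · intro c v w
    simp only [map_sum, Finset.mul_sum, smul_eq_mul, map_mul]
    exact Finset.sum_congr rfl fun j _ => by ring
  · intro j
    simp [hx j]
  · intro i
    simp [hy i]

theorem sum_norm_sq_eq_re (φ : ι → Hilb q) (x : Space) :
    ∑ i, ‖φ i x‖ ^ 2 = (∑ s, ∑ i, φ i x s * conj (φ i x s)).re := by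
  rw [Finset.sum_comm, Complex.re_sum]
  refine Finset.sum_congr rfl fun i _ => ?_
  rw [EuclideanSpace.norm_sq_eq, Complex.re_sum]
  refine Finset.sum_congr rfl fun s _ => ?_
  rw [Complex.mul_conj, Complex.ofReal_re, Complex.normSq_eq_norm_sq]

theorem IsRotation.sum_norm_sq_eq {φ : ι → Hilb q} {χ : κ → Hilb q} (h : IsRotation φ χ) :
    ∀ᵐ x, ∑ i, ‖φ i x‖ ^ 2 = ∑ j, ‖χ j x‖ ^ 2 := by
  filter_upwards [h.ae_eq, h.symm.ae_eq] with x hx hx'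
  rw [sum_norm_sq_eq_re, sum_norm_sq_eq_re]
  simp only [sum_kernel_eq hx hx']

theorem IsRotation.sum_kernel_eq {φ : ι → Hilb q} {χ : κ → Hilb q} (h : IsRotation φ χ) :
    ∀ᵐ z : Space × Space, ∀ s t,
      ∑ i, φ i z.1 s * conj (φ i z.2 t) = ∑ j, χ j z.1 s * conj (χ j z.2 t) := by
  filter_upwards [ae_prod_of_ae h.ae_eq, ae_prod_of_ae h.symm.ae_eq] with z h1 h2 s t
  exact HartreeFock.sum_kernel_eq h1.1 h2.2 s t

theorem IsRotation.sum_energyForm_eq {φ : ι → sobolevOne q} {χ : κ → sobolevOne q}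
    (h : IsRotation (fun i => (φ i : Hilb q)) fun j => (χ j : Hilb q)) :
    ∑ i, energyForm (grad q) (nuclearPotential q) (φ i) =
      ∑ j, energyForm (grad q) (nuclearPotential q) (χ j) := by
  have key := sum_sesquilinear_eq (ι := ι) (κ := κ) (V := sobolevOne q) (V' := sobolevOne q)
    (B := fun u v => ⟪grad q v, grad q u⟫ + ⟪(v : Hilb q), nuclearPotential q u⟫)
    (f := φ) (g := χ) (f' := φ) (g' := χ) (a := fun i j => ⟪(φ i : Hilb q), (χ j : Hilb q)⟫)
    ?_ ?_ ?_ ?_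
  · have e : ∀ ψ : sobolevOne q, energyForm (grad q) (nuclearPotential q) ψ =
        (⟪grad q ψ, grad q ψ⟫ + ⟪(ψ : Hilb q), nuclearPotential q ψ⟫).re := fun ψ => by
      rw [energyForm, Complex.add_re, re_inner_self_eq]
    simp only [e, ← Complex.re_sum, key]
  · intro c v w
    simp only [map_sum, map_smul, inner_sum, inner_smul_right, mul_add, Finset.sum_add_distrib]
  · intro c v w
    simp only [map_sum, map_smul, sum_inner, inner_smul_left, mul_add, Finset.sum_add_distrib,
      Submodule.coe_sum, Submodule.coe_smul]
  · intro j
    apply Subtype.ext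
    simpa using h.1 j
  · intro i
    apply Subtype.ext
    simpa using h.2 i

theorem isRotation_of_orthonormalBasis {W : Submodule ℂ (Hilb q)} [FiniteDimensional ℂ W]
    (b : OrthonormalBasis ι ℂ W) (c : OrthonormalBasis κ ℂ W) :
    IsRotation (fun i => (b i : Hilb q)) fun j => (c j : Hilb q) := by
  constructor
  · intro j
    have := congrArg Subtype.val (b.sum_repr' (c j))
    simpa using this.symm
  · intro i
    have := congrArg Subtype.val (c.sum_repr' (b i))
    simpa using this.symm

theorem orbitalDensity_one (φ : ι → Hilb q) (x : Space) :
    orbitalDensity (fun _ => 1) φ x = ∑ i, ‖φ i x‖ ^ 2 := by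
  simp [orbitalDensity, tsum_fintype]

theorem orbitalKernel_one (φ : ι → Hilb q) (x y : Space) (s t : Fin q) :
    orbitalKernel (fun _ => 1) φ x y s t = ∑ i, φ i x s * conj (φ i y t) := by
  simp [orbitalKernel, tsum_fintype]

theorem isMeanField_one {φ : ι → Hilb q} (h : ∀ i, ‖φ i‖ = 1) :
    IsMeanField (orbitalDensity (fun _ => 1) φ) (orbitalKernel (fun _ => 1) φ)
      (Fintype.card ι) := by
  refine isMeanField_orbital (fun _ => zero_le_one) h ?_
  have := hasSum_fintype fun _ : ι => (1 : ℝ)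
  simpa using this

theorem directForm_congr {ρ ρ' : Space → ℝ} (h : ∀ᵐ x, ρ x = ρ' x) (ψ : Hilb q) :
    directForm ρ ψ = directForm ρ' ψ := by
  refine integral_congr_ae ?_
  filter_upwards [ae_prod_of_ae h] with z hz
  rw [hz.2]

theorem exchangeForm_congr {τ τ' : SpinKernel q}
    (h : ∀ᵐ z : Space × Space, ∀ s t, τ z.1 z.2 s t = τ' z.1 z.2 s t) (χ ψ : Hilb q) :
    exchangeForm τ χ ψ = exchangeForm τ' χ ψ := by
  refine integral_congr_ae ?_
  filter_upwards [h] with z hz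
  simp only [kernelApply, hz]

/-- If `P` is a projection of finite rank, then the density and the kernel of `P` are those of any
orthonormal basis of the range, although they are defined by some spectral decomposition. -/
theorem density_kernel_eq (hq : 1 ≤ q) {N : ℕ} {P : Hilb q →L[ℂ] Hilb q}
    (hP : IsDensityMatrix N P) {φ : ι → Hilb q} (hφ : Orthonormal ℂ φ)
    (hPφ : P = ∑ i, InnerProductSpace.rankOne ℂ (φ i) (φ i)) :
    (∀ᵐ x, density P x = orbitalDensity (fun _ => 1) φ x) ∧
      ∀ᵐ z : Space × Space, ∀ s t,
        kernel P z.1 z.2 s t = orbitalKernel (fun _ => 1) φ z.1 z.2 s t := by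
  have hd := isSpectralDecomposition_spectralData hq hP
  set d := spectralData P with hdP
  have hPa : ∀ ψ, P ψ = ∑ i, ⟪φ i, ψ⟫ • φ i := fun ψ => by
    simp [hPφ, InnerProductSpace.rankOne_apply]
  have hPid : ∀ i, P (φ i) = φ i := fun i => by
    rw [hPa, Finset.sum_eq_single i]
    · simp [inner_self_eq_norm_sq_to_K, hφ.1 i]
    · intro j _ hj
      rw [hφ.2 hj, zero_smul]
    · simp
  have hPP : ∀ ψ, P (P ψ) = P ψ := fun ψ => by
    conv_lhs => rw [hPa ψ]
    rw [map_sum]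
    simp only [map_smul, hPid]
    exact (hPa ψ).symm
  -- `P² = P`, so that the weights are `0` or `1`
  have hw01 : ∀ n, d.1 n = 0 ∨ d.1 n = 1 := by
    intro n
    have h1 := hPP (d.2 n)
    rw [hd.apply_eq, map_smul, hd.apply_eq, smul_smul] at h1
    have h2 := smul_left_injective ℂ (hd.1.ne_zero n) h1
    have h3 : d.1 n * d.1 n = d.1 n := by exact_mod_cast h2
    rcases eq_or_ne (d.1 n) 0 with h | h
    · exact Or.inl h
    · exact Or.inr (mul_right_cancel₀ h (by rw [h3, one_mul]))
  have hfin : {n | d.1 n ≠ 0}.Finite := by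
    have h1 := (hd.hasSum_weight hP).summable.tendsto_cofinite_zero
    have h2 := h1.eventually (gt_mem_nhds (zero_lt_one' ℝ))
    refine Set.Finite.subset (Filter.eventually_cofinite.1 h2) fun n hn => ?_
    rcases hw01 n with h | h
    · exact absurd h hn
    · simp [h]
  let S := hfin.toFinset
  have hS1 : ∀ n ∈ S, d.1 n = 1 := fun n hn =>
    (hw01 n).resolve_left (hfin.mem_toFinset.1 hn)
  have hS0 : ∀ n ∉ S, d.1 n = 0 := fun n hn => by
    by_contra h
    exact hn (hfin.mem_toFinset.2 h)
  have hPd : ∀ ψ, P ψ = ∑ n : S, ⟪d.2 n, ψ⟫ • d.2 n := fun ψ => by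
    have h1 := hasSum_sum_of_ne_finset_zero (s := S) (L := SummationFilter.unconditional ℕ)
      (f := fun n => (d.1 n : ℂ) • (⟪d.2 n, ψ⟫ • d.2 n)) fun n hn => by simp [hS0 n hn]
    rw [(hd.2 ψ).unique h1, ← Finset.sum_coe_sort S]
    refine Finset.sum_congr rfl fun n _ => ?_
    rw [hS1 n n.2]
    simp
  have hrot : IsRotation φ fun n : S => d.2 n := by
    constructor
    · intro n
      have h1 := hd.apply_eq n
      rw [hS1 n n.2, Complex.ofReal_one, one_smul, hPa] at h1
      exact h1.symm
    · intro i
      have h1 := hPid i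
      rw [hPd] at h1
      exact h1.symm
  constructor
  · filter_upwards [hrot.sum_norm_sq_eq] with x hx
    rw [orbitalDensity_one, hx, density, ← hdP, tsum_eq_sum (s := S) fun n hn => by simp [hS0 n hn],
      ← Finset.sum_coe_sort S]
    refine Finset.sum_congr rfl fun n _ => ?_
    rw [hS1 n n.2, one_mul]
  · filter_upwards [hrot.sum_kernel_eq] with z hz s t
    rw [orbitalKernel_one, hz, kernel, ← hdP, tsum_eq_sum (s := S) fun n hn => by simp [hS0 n hn],
      ← Finset.sum_coe_sort S]
    refine Finset.sum_congr rfl fun n _ => ?_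
    rw [hS1 n n.2, Complex.ofReal_one, one_mul]

end Rotation

/-! ### The Hartree–Fock functional as a function of one orbital -/

section HartreeFockFunctional

variable {q : ℕ}

local notation "⟪" x ", " y "⟫" => inner ℂ x y

/-- The integrand `(ρ(x) ρ(y) - |τ(x, y)|²) V(x - y)` of the interaction energy of orbitals. -/
noncomputable def interaction {n : ℕ} (f : Fin n → Hilb q) (z : Space × Space) : ℝ :=
  ((∑ k, ‖f k z.1‖ ^ 2) * (∑ k, ‖f k z.2‖ ^ 2) -
    ∑ s, ∑ t, ‖∑ k, f k z.1 s * conj (f k z.2 t)‖ ^ 2) * coulomb (z.1 - z.2)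

/-- The energy of `ψ` in the mean field `(ρ, τ)`. -/
noncomputable def meanFieldEnergy (Z : ℝ) (ρ : Space → ℝ) (τ : SpinKernel q) (ψ : sobolevOne q) : ℝ :=
  energyForm (grad q) (nuclearPotential q) ψ +
    1 / Z * (directForm ρ (ψ : Hilb q) - (exchangeForm τ (ψ : Hilb q) (ψ : Hilb q)).re)

theorem hfEnergy_eq (Z : ℝ) {n : ℕ} (f : Fin n → sobolevOne q) :
    hfEnergy Z (fun k => (f k : Hilb q)) =
      ∑ k, energyForm (grad q) (nuclearPotential q) (f k) +
        1 / (2 * Z) * ∫ z, interaction (fun k => (f k : Hilb q)) z := by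
  simp only [hfEnergy, energyForm_nuclearPotential, kineticEnergy_eq, interaction]

/-- The Hartree-Fock energy depends on the span of the orbitals only. -/
theorem hfEnergy_eq_of_isRotation (Z : ℝ) {n : ℕ} {f g : Fin n → sobolevOne q}
    (h : IsRotation (fun k => (f k : Hilb q)) fun k => (g k : Hilb q)) :
    hfEnergy Z (fun k => (f k : Hilb q)) = hfEnergy Z (fun k => (g k : Hilb q)) := by
  rw [hfEnergy_eq, hfEnergy_eq, h.sum_energyForm_eq]
  congr 2
  refine integral_congr_ae ?_
  filter_upwards [ae_prod_of_ae h.sum_norm_sq_eq, h.sum_kernel_eq] with z h1 h2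
  simp only [interaction, h1.1, h1.2, h2]

theorem sum_norm_sq_kernel_le (τ : SpinKernel q) (x y : Space) {c : ℝ}
    (h : ∀ v, ‖kernelApply τ x y v‖ ≤ c * ‖v‖) : ∑ s, ∑ t, ‖τ x y s t‖ ^ 2 ≤ q * c ^ 2 := by
  rw [Finset.sum_comm]
  have h1 : ∀ t, ∑ s, ‖τ x y s t‖ ^ 2 ≤ c ^ 2 := by
    intro t
    have h2 := h (EuclideanSpace.single t 1)
    rw [PiLp.norm_single, norm_one, mul_one] at h2
    have h3 : ∑ s, ‖τ x y s t‖ ^ 2 = ‖kernelApply τ x y (EuclideanSpace.single t 1)‖ ^ 2 := by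
      rw [EuclideanSpace.norm_sq_eq]
      simp [kernelApply]
    rw [h3]
    exact pow_le_pow_left₀ (norm_nonneg _) h2 2
  refine (Finset.sum_le_sum fun t _ => h1 t).trans (le_of_eq ?_)
  simp

/-- The interaction energy converges absolutely, so its integrand may be split into parts. -/
theorem integrable_interaction {n : ℕ} {f : Fin n → sobolevOne q}
    (hf : ∀ k, ‖(f k : Hilb q)‖ = 1) : Integrable (interaction fun k => (f k : Hilb q)) := by
  have h := isMeanField_one hf
  set ρ := orbitalDensity (fun _ => 1) fun k => (f k : Hilb q) with hρ
  set τ := orbitalKernel (fun _ => 1) fun k => (f k : Hilb q) with hτ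
  have h1 : Integrable fun z : Space × Space => coulomb (z.1 - z.2) * (ρ z.1 * ρ z.2) := by
    have := integrable_finsetSum Finset.univ fun k _ => h.integrable_direct (f k)
    refine this.congr (Eventually.of_forall fun z => ?_)
    have e : ρ z.1 = ∑ k, ‖(f k : Hilb q) z.1‖ ^ 2 := orbitalDensity_one _ _
    simp only [e, Finset.mul_sum, Finset.sum_mul]
    exact Finset.sum_congr rfl fun k _ => by ring
  have h2 : Integrable fun z : Space × Space =>
      coulomb (z.1 - z.2) * ∑ s, ∑ t, ‖τ z.1 z.2 s t‖ ^ 2 := by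
    refine Integrable.mono' (h1.const_mul q) ?_ ?_
    · refine measurable_coulomb_sub.aestronglyMeasurable.mul ?_
      exact Finset.aestronglyMeasurable_fun_sum _ fun s _ =>
        Finset.aestronglyMeasurable_fun_sum _ fun t _ => (h.meas s t).norm.pow 2
    · filter_upwards [h.bound] with z hz
      have h3 := sum_norm_sq_kernel_le τ z.1 z.2 hz
      rw [mul_pow, Real.sq_sqrt (h.nonneg _), Real.sq_sqrt (h.nonneg _)] at h3
      have h4 : 0 ≤ ∑ s, ∑ t, ‖τ z.1 z.2 s t‖ ^ 2 :=
        Finset.sum_nonneg fun s _ => Finset.sum_nonneg fun t _ => sq_nonneg _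
      rw [Real.norm_of_nonneg (mul_nonneg (coulomb_nonneg _) h4)]
      refine (mul_le_mul_of_nonneg_left h3 (coulomb_nonneg _)).trans (le_of_eq ?_)
      ring
  refine (h1.sub h2).congr (Eventually.of_forall fun z => ?_)
  simp only [Pi.sub_apply, interaction, hρ, hτ, orbitalDensity_one, orbitalKernel_one]
  ring

/-- Splitting off the last orbital. -/
theorem orbitalDensity_succ {n : ℕ} (f : Fin (n + 1) → Hilb q) (x : Space) :
    orbitalDensity (fun _ => 1) f x =
      orbitalDensity (fun _ => 1) (fun k : Fin n => f k.castSucc) x + ‖f (Fin.last n) x‖ ^ 2 := by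
  rw [orbitalDensity_one, orbitalDensity_one, Fin.sum_univ_castSucc]

theorem orbitalKernel_succ {n : ℕ} (f : Fin (n + 1) → Hilb q) (x y : Space) (s t : Fin q) :
    orbitalKernel (fun _ => 1) f x y s t =
      orbitalKernel (fun _ => 1) (fun k : Fin n => f k.castSucc) x y s t +
        f (Fin.last n) x s * conj (f (Fin.last n) y t) := by
  rw [orbitalKernel_one, orbitalKernel_one, Fin.sum_univ_castSucc]

theorem norm_add_mul_conj_sq (c u v : ℂ) :
    ‖c + u * conj v‖ ^ 2 = ‖c‖ ^ 2 + 2 * (conj u * c * v).re + ‖u‖ ^ 2 * ‖v‖ ^ 2 := by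
  rw [← Complex.normSq_eq_norm_sq, ← Complex.normSq_eq_norm_sq, ← Complex.normSq_eq_norm_sq,
    ← Complex.normSq_eq_norm_sq, Complex.normSq_add, map_mul, Complex.normSq_conj, map_mul,
    Complex.conj_conj]
  rw [show c * (conj u * v) = conj u * c * v by ring]
  ring

theorem sum_norm_add_sq (τ : SpinKernel q) (x y : Space) (u v : EuclideanSpace ℂ (Fin q)) :
    ∑ s, ∑ t, ‖τ x y s t + u s * conj (v t)‖ ^ 2 =
      ∑ s, ∑ t, ‖τ x y s t‖ ^ 2 + 2 * (⟪u, kernelApply τ x y v⟫).re + ‖u‖ ^ 2 * ‖v‖ ^ 2 := by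
  simp only [norm_add_mul_conj_sq, Finset.sum_add_distrib]
  rw [inner_kernelApply, EuclideanSpace.norm_sq_eq, EuclideanSpace.norm_sq_eq, Finset.sum_mul_sum]
  simp only [Complex.re_sum, Finset.mul_sum]

theorem interaction_succ {n : ℕ} (f : Fin (n + 1) → Hilb q) (z : Space × Space) :
    interaction f z = interaction (fun k : Fin n => f k.castSucc) z +
      (orbitalDensity (fun _ => 1) (fun k : Fin n => f k.castSucc) z.2 *
          (coulomb (z.1 - z.2) * ‖f (Fin.last n) z.1‖ ^ 2) +
        orbitalDensity (fun _ => 1) (fun k : Fin n => f k.castSucc) z.1 *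
          (coulomb (z.2 - z.1) * ‖f (Fin.last n) z.2‖ ^ 2)) -
      2 * ((coulomb (z.1 - z.2) : ℂ) * ⟪f (Fin.last n) z.1,
        kernelApply (orbitalKernel (fun _ => 1) fun k : Fin n => f k.castSucc) z.1 z.2
          (f (Fin.last n) z.2)⟫).re := by
  simp only [interaction, ← orbitalDensity_one, ← orbitalKernel_one]
  simp only [orbitalDensity_succ, orbitalKernel_succ, Complex.re_ofReal_mul]
  rw [sum_norm_add_sq, coulomb_sub_comm z.2]
  ring

theorem directForm_sub_exchangeForm {ρ : Space → ℝ} {τ : SpinKernel q} {m : ℝ}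
    (h : IsMeanField ρ τ m) (ψ : sobolevOne q) :
    directForm ρ (ψ : Hilb q) - (exchangeForm τ (ψ : Hilb q) (ψ : Hilb q)).re =
      ∫ z : Space × Space, (ρ z.2 * (coulomb (z.1 - z.2) * ‖(ψ : Hilb q) z.1‖ ^ 2) -
        ((coulomb (z.1 - z.2) : ℂ) *
          ⟪(ψ : Hilb q) z.1, kernelApply τ z.1 z.2 ((ψ : Hilb q) z.2)⟫).re) := by
  have h2 := h.integrable_exchangeDensity ψ ψ
  have e : (exchangeForm τ (ψ : Hilb q) (ψ : Hilb q)).re = ∫ z : Space × Space,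
      ((coulomb (z.1 - z.2) : ℂ) *
          ⟪(ψ : Hilb q) z.1, kernelApply τ z.1 z.2 ((ψ : Hilb q) z.2)⟫).re :=
    (integral_re h2).symm
  rw [e, directForm]
  exact (integral_sub (h.integrable_direct ψ) h2.re).symm

/-- The interaction of an orbital with itself cancels between the direct and the exchange energy. -/
theorem meanFieldEnergy_succ (Z : ℝ) {n : ℕ} {f : Fin (n + 1) → sobolevOne q}
    (hf : ∀ k, ‖(f k : Hilb q)‖ = 1) :
    meanFieldEnergy Z (orbitalDensity (fun _ => 1) fun k => (f k : Hilb q))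
      (orbitalKernel (fun _ => 1) fun k => (f k : Hilb q)) (f (Fin.last n)) =
    meanFieldEnergy Z (orbitalDensity (fun _ => 1) fun k : Fin n => (f k.castSucc : Hilb q))
      (orbitalKernel (fun _ => 1) fun k : Fin n => (f k.castSucc : Hilb q)) (f (Fin.last n)) := by
  rw [meanFieldEnergy, meanFieldEnergy, directForm_sub_exchangeForm (isMeanField_one hf),
    directForm_sub_exchangeForm (isMeanField_one fun k : Fin n => hf k.castSucc)]
  congr 3
  funext z
  rw [orbitalDensity_succ]
  simp only [Complex.re_ofReal_mul, inner_kernelApply, orbitalKernel_succ, mul_add, add_mul,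
    Finset.sum_add_distrib, Complex.add_re]
  have e : (∑ s, ∑ t, conj ((f (Fin.last n) : Hilb q) z.1 s) *
      ((f (Fin.last n) : Hilb q) z.1 s * conj ((f (Fin.last n) : Hilb q) z.2 t)) *
        (f (Fin.last n) : Hilb q) z.2 t).re =
      ‖(f (Fin.last n) : Hilb q) z.1‖ ^ 2 * ‖(f (Fin.last n) : Hilb q) z.2‖ ^ 2 := by
    rw [EuclideanSpace.norm_sq_eq, EuclideanSpace.norm_sq_eq, Finset.sum_mul_sum]
    simp only [Complex.re_sum]
    refine Finset.sum_congr rfl fun s _ => Finset.sum_congr rfl fun t _ => ?_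
    rw [← Complex.normSq_eq_norm_sq, ← Complex.normSq_eq_norm_sq, ← Complex.ofReal_re
      (Complex.normSq _ * Complex.normSq _), Complex.ofReal_mul, Complex.normSq_eq_conj_mul_self,
      Complex.normSq_eq_conj_mul_self]
    congr 1
    ring
  rw [e]
  ring

/-- The Hartree–Fock energy depends on the last orbital through its energy in the mean field of the
other orbitals. -/
theorem hfEnergy_succ (Z : ℝ) {n : ℕ} {f : Fin (n + 1) → sobolevOne q}
    (hf : ∀ k, ‖(f k : Hilb q)‖ = 1) :
    hfEnergy Z (fun k => (f k : Hilb q)) = hfEnergy Z (fun k : Fin n => (f k.castSucc : Hilb q)) +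
      meanFieldEnergy Z (orbitalDensity (fun _ => 1) fun k : Fin n => (f k.castSucc : Hilb q))
        (orbitalKernel (fun _ => 1) fun k : Fin n => (f k.castSucc : Hilb q)) (f (Fin.last n)) := by
  have hg : ∀ k : Fin n, ‖(f k.castSucc : Hilb q)‖ = 1 := fun k => hf k.castSucc
  have h := isMeanField_one hg
  have i1 := integrable_interaction hg
  have i2 := h.integrable_direct (f (Fin.last n))
  have i3 := h.integrable_exchangeDensity (f (Fin.last n)) (f (Fin.last n))
  set ρ := orbitalDensity (fun _ => 1) fun k : Fin n => (f k.castSucc : Hilb q)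
  set τ := orbitalKernel (fun _ => 1) fun k : Fin n => (f k.castSucc : Hilb q)
  have e1 : ∫ z : Space × Space, ρ z.1 *
      (coulomb (z.2 - z.1) * ‖(f (Fin.last n) : Hilb q) z.2‖ ^ 2) =
      directForm ρ (f (Fin.last n) : Hilb q) :=
    integral_prod_swap (μ := (volume : Measure Space)) (ν := (volume : Measure Space))
      (fun z : Space × Space => ρ z.2 * (coulomb (z.1 - z.2) * ‖(f (Fin.last n) : Hilb q) z.1‖ ^ 2))
  have e2 : ∫ z : Space × Space, ((coulomb (z.1 - z.2) : ℂ) * ⟪(f (Fin.last n) : Hilb q) z.1,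
      kernelApply τ z.1 z.2 ((f (Fin.last n) : Hilb q) z.2)⟫).re =
      (exchangeForm τ (f (Fin.last n) : Hilb q) (f (Fin.last n) : Hilb q)).re := integral_re i3
  have key : ∫ z, interaction (fun k => (f k : Hilb q)) z =
      (∫ z, interaction (fun k : Fin n => (f k.castSucc : Hilb q)) z) +
      2 * (directForm ρ (f (Fin.last n) : Hilb q) -
        (exchangeForm τ (f (Fin.last n) : Hilb q) (f (Fin.last n) : Hilb q)).re) := by
    simp only [interaction_succ]
    have i4 := i2.swap
    have i5 := i3.re
    refine (integral_sub (i1.add (i2.add i4)) (i5.const_mul 2)).trans ?_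
    rw [integral_const_mul]
    refine (congrArg₂ _ ((integral_add i1 (i2.add i4)).trans
      (congrArg _ (integral_add i2 i4))) (congrArg _ e2)).trans ?_
    refine (congrArg₂ _ (congrArg _ (congrArg _ e1)) rfl).trans ?_
    rw [directForm]
    ring
  rw [hfEnergy_eq, hfEnergy_eq, key, Fin.sum_univ_castSucc, meanFieldEnergy]
  rw [show 1 / (2 * Z) = 1 / 2 * (1 / Z) by rw [one_div_mul_one_div]]
  ring

theorem energyForm_smul {H E : Type*} [NormedAddCommGroup H] [InnerProductSpace ℂ H]
    [NormedAddCommGroup E] [InnerProductSpace ℂ E] {D : Submodule ℂ H} (G : D →ₗ[ℂ] E)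
    (B : D →ₗ[ℂ] H) (c : ℂ) (ψ : D) : energyForm G B (c • ψ) = ‖c‖ ^ 2 * energyForm G B ψ := by
  have e : conj c * (c * ⟪(ψ : H), B ψ⟫) = ((‖c‖ ^ 2 : ℝ) : ℂ) * ⟪(ψ : H), B ψ⟫ := by
    rw [← mul_assoc, ← Complex.normSq_eq_conj_mul_self, Complex.normSq_eq_norm_sq]
  rw [energyForm, energyForm, map_smul, map_smul, norm_smul, Submodule.coe_smul, inner_smul_left,
    inner_smul_right, e, Complex.re_ofReal_mul]
  ring

/-- An orthonormal family can be rotated within its span so that a given unit vector becomes its last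
member. -/
theorem exists_rotation {n : ℕ} {f : Fin (n + 1) → sobolevOne q}
    (hf : Orthonormal ℂ fun k => (f k : Hilb q)) {u : sobolevOne q} (hu : ‖(u : Hilb q)‖ = 1)
    (hmem : u ∈ Submodule.span ℂ (Set.range f)) : ∃ g : Fin (n + 1) → sobolevOne q,
      Orthonormal ℂ (fun k => (g k : Hilb q)) ∧
      IsRotation (fun k => (f k : Hilb q)) (fun k => (g k : Hilb q)) ∧ g (Fin.last n) = u := by
  let W : Submodule ℂ (Hilb q) := Submodule.span ℂ (Set.range fun k => (f k : Hilb q))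
  let b₀ : Module.Basis (Fin (n + 1)) ℂ W := Module.Basis.span hf.linearIndependent
  have hb₀ : ∀ k, (b₀ k : Hilb q) = f k := fun k =>
    congrArg Subtype.val (Module.Basis.span_apply hf.linearIndependent k)
  have hbo : Orthonormal ℂ b₀ := by
    rw [← W.subtypeₗᵢ.orthonormal_comp_iff]
    have : (W.subtypeₗᵢ ∘ b₀) = fun k => (f k : Hilb q) := funext hb₀
    rwa [this]
  let b := b₀.toOrthonormalBasis hbo
  have hb : ∀ k, (b k : Hilb q) = f k := fun k => by
    rw [Module.Basis.coe_toOrthonormalBasis, hb₀]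
  have hWle : W ≤ sobolevOne q := by
    rw [Submodule.span_le]
    rintro _ ⟨k, rfl⟩
    exact (f k).2
  have huW : (u : Hilb q) ∈ W := by
    have := Submodule.mem_map_of_mem (f := (sobolevOne q).subtype) hmem
    rwa [Submodule.map_span, ← Set.range_comp] at this
  have hfin : Module.finrank ℂ W = Fintype.card (Fin (n + 1)) :=
    Module.finrank_eq_card_basis b₀
  have : FiniteDimensional ℂ W := b₀.finiteDimensional_of_finite
  obtain ⟨c, hc⟩ := Orthonormal.exists_orthonormalBasis_extension_of_card_eq hfin
    (v := fun _ => (⟨u, huW⟩ : W)) (s := {Fin.last n}) (by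
      constructor
      · intro i
        exact hu
      · intro i j hij
        exact absurd (Subsingleton.elim i j) hij)
  have hlast := hc (Fin.last n) rfl
  refine ⟨fun k => ⟨c k, hWle (c k).2⟩, ?_, ?_, ?_⟩
  · exact c.orthonormal.comp_linearIsometry W.subtypeₗᵢ
  · have := isRotation_of_orthonormalBasis b c
    simpa only [hb] using this
  · apply Subtype.ext
    change ((c (Fin.last n) : W) : Hilb q) = u
    rw [hlast]

theorem IsRotation.sum_rankOne_eq {ι κ : Type*} [Fintype ι] [Fintype κ] {φ : ι → Hilb q}
    {χ : κ → Hilb q} (h : IsRotation φ χ) :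
    ∑ i, InnerProductSpace.rankOne ℂ (φ i) (φ i) =
      ∑ j, InnerProductSpace.rankOne ℂ (χ j) (χ j) := by
  ext1 w
  refine ext_inner_left ℂ fun v => ?_
  have key := sum_sesquilinear_eq (ι := ι) (κ := κ) (V := Hilb q) (V' := Hilb q)
    (B := fun a b => ⟪v, a⟫ * ⟪b, w⟫) (f := φ) (g := χ) (f' := φ) (g' := χ)
    (a := fun i j => ⟪φ i, χ j⟫) ?_ ?_ h.1 (fun i => by simpa using h.2 i)
  · have e : ∀ a : Hilb q, ⟪v, InnerProductSpace.rankOne ℂ a a w⟫ = ⟪v, a⟫ * ⟪a, w⟫ := fun a => by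
      rw [InnerProductSpace.rankOne_apply, inner_smul_right, mul_comm]
    simpa only [sum_apply, inner_sum, e] using key
  · intro c a b
    simp only [inner_sum, inner_smul_right, Finset.sum_mul, mul_assoc]
  · intro c a b
    simp only [sum_inner, inner_smul_left, Finset.mul_sum]
    exact Finset.sum_congr rfl fun j _ => by ring

/-- A subspace of dimension greater than `n` contains a unit vector orthogonal to `n` given ones. -/
theorem exists_unit_orthogonal {n : ℕ} (g : Fin n → Hilb q) (M : Submodule ℂ (sobolevOne q))
    [FiniteDimensional ℂ M] (hM : n < Module.finrank ℂ M) :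
    ∃ ψ ∈ M, ‖(ψ : Hilb q)‖ = 1 ∧ ∀ k, ⟪g k, (ψ : Hilb q)⟫ = 0 := by
  have h1 : Module.finrank ℂ (M.map (sobolevOne q).subtype) = Module.finrank ℂ M :=
    (Submodule.equivSubtypeMap _ M).finrank_eq.symm
  have h2 : Module.finrank ℂ (Submodule.span ℂ (Set.range g)) ≤ n := by
    have := finrank_range_le_card (R := ℂ) g
    simpa [Set.finrank] using this
  have : FiniteDimensional ℂ (Submodule.span ℂ (Set.range g)) :=
    FiniteDimensional.span_of_finite _ (Set.finite_range _)
  obtain ⟨x, hx, hxo, hx0⟩ := exists_ne_zero_mem_orthogonal (M.map (sobolevOne q).subtype)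
    (Submodule.span ℂ (Set.range g)) (by omega)
  obtain ⟨y, hy, rfl⟩ := hx
  refine ⟨((‖(y : Hilb q)‖⁻¹ : ℝ) : ℂ) • y, M.smul_mem _ hy, ?_, fun k => ?_⟩
  · have h0 : (y : Hilb q) ≠ 0 := hx0
    rw [Submodule.coe_smul, norm_smul, Complex.norm_real, Real.norm_of_nonneg (by positivity),
      inv_mul_cancel₀ (norm_ne_zero_iff.2 h0)]
  · have h3 : ⟪g k, (y : Hilb q)⟫ = 0 := hxo _ (Submodule.subset_span ⟨k, rfl⟩)
    rw [Submodule.coe_smul, inner_smul_right, h3, mul_zero]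

theorem orthonormal_snoc {n : ℕ} {g : Fin n → Hilb q} (hg : Orthonormal ℂ g) {ψ : Hilb q}
    (hψ : ‖ψ‖ = 1) (h : ∀ k, ⟪g k, ψ⟫ = 0) :
    Orthonormal ℂ (Fin.snoc (α := fun _ => Hilb q) g ψ) := by
  constructor
  · intro k
    refine Fin.lastCases ?_ (fun k => ?_) k
    · rw [Fin.snoc_last, hψ]
    · rw [Fin.snoc_castSucc, hg.1]
  · intro j k
    refine Fin.lastCases ?_ (fun k => ?_) k <;> refine Fin.lastCases ?_ (fun j => ?_) j
    · exact fun h => absurd rfl h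
    · intro _
      rw [Fin.snoc_last, Fin.snoc_castSucc, h]
    · intro _
      rw [Fin.snoc_last, Fin.snoc_castSucc, ← inner_conj_symm, h, map_zero]
    · intro hjk
      rw [Fin.snoc_castSucc, Fin.snoc_castSucc]
      exact hg.2 fun h => hjk (congrArg _ h)

/-- Every unit vector in the range of a minimizer `P` has a small Fock energy: rotate the orbitals so
that it is the last one, and compare with a trial orbital in its place that is orthogonal to the other
`n` orbitals and has energy at most `t`. -/
theorem energyForm_fock_le (hq : 1 ≤ q) {n : ℕ} {Z : ℝ} (hZ : 0 < Z) {P : Hilb q →L[ℂ] Hilb q}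
    (hP : IsDensityMatrix (n + 1) P) {f : Fin (n + 1) → sobolevOne q}
    (hf : Orthonormal ℂ fun k => (f k : Hilb q))
    (hPf : P = ∑ k, InnerProductSpace.rankOne ℂ (f k : Hilb q) (f k : Hilb q))
    (hmin : ∀ χ : Fin (n + 1) → Hilb q, IsAdmissible χ →
      hfEnergy Z (fun k => (f k : Hilb q)) ≤ hfEnergy Z χ)
    {M : Submodule ℂ (sobolevOne q)} [FiniteDimensional ℂ M] (hM : Module.finrank ℂ M = n + 1)
    {t : ℝ} (ht : ∀ ψ ∈ M, energyForm (grad q) (nuclearPotential q) ψ ≤ t * ‖(ψ : Hilb q)‖ ^ 2)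
    {u : sobolevOne q} (hu : ‖(u : Hilb q)‖ = 1) (hmem : u ∈ Submodule.span ℂ (Set.range f)) :
    energyForm (grad q) (fockPotential Z (isMeanField_density hq hP)) u ≤
      t + 2 * (n / Z) + 2 * (n / Z) * √(t + 1) := by
  obtain ⟨g, hg, hrot, rfl⟩ := exists_rotation hf hu hmem
  have hg' : Orthonormal ℂ fun k : Fin n => (g k.castSucc : Hilb q) :=
    hg.comp _ (Fin.castSucc_injective n)
  obtain ⟨ψ, hψM, hψ1, hψo⟩ := exists_unit_orthogonal (fun k : Fin n => (g k.castSucc : Hilb q)) M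
    (by omega)
  let g₂ : Fin (n + 1) → sobolevOne q :=
    Fin.snoc (α := fun _ => sobolevOne q) (fun k : Fin n => g k.castSucc) ψ
  have hg₂ : (fun k => (g₂ k : Hilb q)) =
      Fin.snoc (α := fun _ => Hilb q) (fun k : Fin n => (g k.castSucc : Hilb q)) (ψ : Hilb q) := by
    funext k
    refine Fin.lastCases ?_ (fun k => ?_) k
    · simp [g₂]
    · simp [g₂]
  have ho : Orthonormal ℂ fun k => (g₂ k : Hilb q) := by
    rw [hg₂]
    exact orthonormal_snoc hg' hψ1 hψo
  have h1 := hmin _ ⟨ho, fun k => (g₂ k).2⟩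
  rw [hfEnergy_eq_of_isRotation Z hrot, hfEnergy_succ Z hg.1, hfEnergy_succ Z ho.1] at h1
  have e1 : ∀ k : Fin n, g₂ k.castSucc = g k.castSucc := fun k => by simp [g₂]
  have e2 : g₂ (Fin.last n) = ψ := by simp [g₂]
  simp only [e1, e2] at h1
  have h2 := le_of_add_le_add_left h1
  have h3 := (isMeanField_one hg'.1).form_le hZ (ht ψ hψM)
  rw [hψ1, one_pow, mul_one, Fintype.card_fin] at h3
  rw [← meanFieldEnergy_succ Z hg.1] at h2
  refine le_trans (le_of_eq ?_) (h2.trans h3)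
  obtain ⟨d1, d2⟩ := density_kernel_eq hq hP hg (hPf.trans hrot.sum_rankOne_eq)
  rw [energyForm_fockPotential, meanFieldEnergy, directForm_congr d1, exchangeForm_congr d2]

/-- The span of the orbitals of a minimizer serves as trial space for the Fock operator. -/
theorem IsHFMinimizer.nthEigenvalue_fockOp_le (hq : 1 ≤ q) {n : ℕ} {Z : ℝ} (hZ : 0 < Z)
    {P : Hilb q →L[ℂ] Hilb q} (hP : IsDensityMatrix (n + 1) P) (h : IsHFMinimizer (n + 1) Z P) :
    nthEigenvalue (fockOp Z P) (n + 1) ≤ nthEigenvalue (schrodingerOp q) (n + 1) +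
      2 * (n / Z) + 2 * (n / Z) * √(nthEigenvalue (schrodingerOp q) (n + 1) + 1) := by
  obtain ⟨φ, ⟨ho, hs⟩, hPφ, hmin⟩ := h
  refine le_of_forall_gt_le fun t ht => ?_
  obtain ⟨M, hMf, hM, hle⟩ := exists_trial_schrodingerOp hq ht
  let f : Fin (n + 1) → sobolevOne q := fun k => ⟨φ k, hs k⟩
  have hli : LinearIndependent ℂ f :=
    LinearIndependent.of_comp (sobolevOne q).subtype ho.linearIndependent
  have : FiniteDimensional ℂ (Submodule.span ℂ (Set.range f)) :=
    FiniteDimensional.span_of_finite _ (Set.finite_range _)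
  refine (isFormPerturbation_fockOp Z (isMeanField_density hq hP)).nthEigenvalue_le
    (Nat.le_add_left 1 n) (Submodule.span ℂ (Set.range f)) ?_ fun x hx => ?_
  · rw [finrank_span_eq_card hli, Fintype.card_fin]
  rcases eq_or_ne x 0 with rfl | hx0
  · simp [energyForm]
  have hx0' : ‖(x : Hilb q)‖ ≠ 0 := by simpa using hx0
  have hu : ‖((((‖(x : Hilb q)‖⁻¹ : ℝ) : ℂ) • x : sobolevOne q) : Hilb q)‖ = 1 := by
    rw [Submodule.coe_smul, norm_smul, Complex.norm_real, Real.norm_of_nonneg (by positivity),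
      inv_mul_cancel₀ hx0']
  have key := energyForm_fock_le hq hZ hP ho hPφ hmin hM hle hu (f := f)
    (Submodule.smul_mem _ _ hx)
  rw [energyForm_smul, Complex.norm_real, Real.norm_of_nonneg (by positivity), inv_pow,
    inv_mul_le_iff₀ (by positivity)] at key
  rwa [mul_comm (_ ^ 2)] at key

end HartreeFockFunctional

end HartreeFock

theorem proposition2p2 (q : ℕ) (hq : 1 ≤ q) (N : ℕ) (Z : ℝ) (hZ : 0 < Z)
    (P : HartreeFock.Hilb q →L[ℂ] HartreeFock.Hilb q)
    (hP : HartreeFock.IsDensityMatrix N P) :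
    (∀ n : ℕ, 1 ≤ n →
      HartreeFock.nthEigenvalue (HartreeFock.schrodingerOp q) n ≤
          HartreeFock.nthEigenvalue (HartreeFock.fockOp Z P) n ∧
      HartreeFock.nthEigenvalue (HartreeFock.fockOp Z P) n ≤
        HartreeFock.nthEigenvalue (HartreeFock.schrodingerOp q) n + 2 * (N / Z) +
          2 * (N / Z) *
            √(HartreeFock.nthEigenvalue (HartreeFock.schrodingerOp q) n + 1)) ∧
    (1 ≤ N → HartreeFock.IsHFMinimizer N Z P →
      HartreeFock.nthEigenvalue (HartreeFock.fockOp Z P) N ≤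
        HartreeFock.nthEigenvalue (HartreeFock.schrodingerOp q) N + 2 * (((N : ℝ) - 1) / Z) +
          2 * (((N : ℝ) - 1) / Z) *
            √(HartreeFock.nthEigenvalue (HartreeFock.schrodingerOp q) N + 1)) := by
  refine ⟨fun n hn => ?_, fun hN hmin => ?_⟩
  · have h := HartreeFock.isMeanField_density hq hP
    exact ⟨HartreeFock.nthEigenvalue_schrodingerOp_le hq hn hZ h,
      HartreeFock.nthEigenvalue_fockOp_le hq hn hZ h⟩
  · obtain ⟨n, rfl⟩ := Nat.exists_eq_add_of_le' hN
    rw [Nat.cast_add_one, add_sub_cancel_right]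
    exact hmin.nthEigenvalue_fockOp_le hq hZ hP
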